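/- Let $(M,g)$ be a connected, oriented $3$-dimensional smooth Lorentzian manifold (signature $(-,+,+)$), time-oriented by a smooth timelike vector field $K$ (so $g(K,K)<0$ everywhere), with Levi-Civita connection $\nabla$. Let $$C_KM=\{v\in TM : g(v,v)=0,\ g(v,K_{\pi(v)})=-1\}$$ be the null congruence, a submanifold of $TM$ with projection $\pi:C_KM\to M$. Let $c:TTM\to TM$ be the connection map of $\nabla$ (for a curve $\alpha$ in $TM$, $c(\alpha'(0))=\frac{\nabla\alpha}{dt}|_{0}$), and let $$\widehat g(\zeta,\xi)=g(d\pi(\zeta),d\pi(\xi))+g(c(\zeta),c(\xi))$$ be the Sasaki metric of $TM$; the induced metric on $C_KM$ is also denoted $\widehat g$. For $v\in C_KM$ let $\mathcal V_v$ be the tangent space at $v$ of the fibre of $\pi:C_KM\to M$, and let $\mathcal H_v$ be the $\widehat g$-orthogonal complement of $\mathcal V_v$ in $T_vC_KM$. Put $f=1/\sqrt{-g(K,K)}$ and $\mathcal T=fK$. For $v\in C_KM$ write $\sigma(v)=-v/g(v,\mathcal T)=\mathcal T+\bar w$ with $\bar w\perp\mathcal T$, let $\bar u$ be the vector for which $(\mathcal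 T,\bar w,\bar u)$ is an oriented orthonormal basis of $T_{\pi(v)}M$, and define the action $\Phi$ of $\mathbb S^1$ on $C_KM$ by $$\Phi_\theta(v)=\Phi(e^{i\theta},v)=f(\pi(v))\,\bigl(\mathcal T+\cos\theta\,\bar w+\sin\theta\,\bar u\bigr),$$ which makes $\pi:C_KM\to M$ a principal $\mathbb S^1$-bundle. Then the following are equivalent: 1. $\mathcal T$ is parallel, that is, $\nabla\mathcal T=0$; 2. the horizontal distribution $\mathcal H$ is a connection on the principal bundle $(C_KM,\pi,M,\mathbb S^1)$, that is, $\mathcal H$ is a smooth distribution, $T_vC_KM=\mathcal H_v\oplus\mathcal V_v$ for all $v\in C_KM$, and $d\Phi_\theta(\mathcal H_v)=\mathcal H_{\Phi_\theta(v)}$ for all $\theta$ and all $v\in C_KM$; 3. the action $\Phi$ is isometric, that is, every $\Phi_\theta$ is an isometry of $(C_KM,\widehat g)$. -/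

import Mathlib

open scoped Manifold ContDiff Topology

noncomputable section

namespace NullCongruence

/-! Manifolds are modelled on a real normed space `E`, which has dimension 3 in the theorem. -/

section Christoffel

variable {E : Type*} [NormedAddCommGroup E] [NormedSpace ℝ E]

/-- The Christoffel symbols at `x` of a metric `G` on (an open subset of) `E`: `Γ(a,b)` is the
solution of `2 G(Γ(a,b), c) = ∂_a G(b,c) + ∂_b G(a,c) - ∂_c G(a,b)` for all `c`. -/
def christoffelSymbol (G : E → E →L[ℝ] E →L[ℝ] ℝ) (x a b : E) : E :=
  let DG : E →L[ℝ] E →L[ℝ] E →L[ℝ] ℝ := fderiv ℝ G x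
  (G x).inverse ((1 / 2 : ℝ) • (DG a b + DG b a - (DG.flip a).flip b))

lemma christoffelSymbol_add (G : E → E →L[ℝ] E →L[ℝ] ℝ) (x a a' b : E) :
    christoffelSymbol G x (a + a') b = christoffelSymbol G x a b + christoffelSymbol G x a' b := by
  simp only [christoffelSymbol, ← map_add, ← smul_add]
  congr 2
  ext c
  simp
  ring

lemma christoffelSymbol_smul (G : E → E →L[ℝ] E →L[ℝ] ℝ) (x : E) (r : ℝ) (a b : E) :
    christoffelSymbol G x (r • a) b = r • christoffelSymbol G x a b := by
  simp only [christoffelSymbol, ← map_smul, smul_comm r]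
  congr 2
  ext c
  simp
  ring

end Christoffel

section LinearAlgebra

variable {V : Type*} [AddCommGroup V] [Module ℝ V]

/-- `u` is obtained from `w`, where `B(t,w) = 0`, by a positive quarter turn in the plane orthogonal
to the timelike vector `t`: `t, w, u` are orthogonal, `u` has the length of `w`, and `(t,w,u)` is a
positively oriented basis unless `w = 0`. If `t` and `w` are unit vectors, this says
that `(t,w,u)` is an oriented orthonormal basis. -/
def IsQuarterTurn (B : LinearMap.BilinForm ℝ V) (o : Orientation ℝ V (Fin 3)) (t w u : V) : Prop :=
  B t u = 0 ∧ B w u = 0 ∧ B u u = B w w ∧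
    (w ≠ 0 → ∃ b : Module.Basis (Fin 3) ℝ V, b 0 = t ∧ b 1 = w ∧ b 2 = u ∧ b.orientation = o)

/-- `b` is an orthonormal basis for the form `B` of signature `(-,+,+)`. -/
def IsLorentzBasis (B : LinearMap.BilinForm ℝ V) (b : Module.Basis (Fin 3) ℝ V) : Prop :=
  ∀ i j, B (b i) (b j) = if i = j then (if i = 0 then -1 else 1) else 0

lemma IsLorentzBasis.apply {B : LinearMap.BilinForm ℝ V} {b : Module.Basis (Fin 3) ℝ V}
    (hb : IsLorentzBasis B b) (x y : V) :
    B x y = -(b.repr x 0 * b.repr y 0) + b.repr x 1 * b.repr y 1 + b.repr x 2 * b.repr y 2 := by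
  conv_lhs => rw [← b.sum_repr x, ← b.sum_repr y]
  simp only [Fin.sum_univ_three, map_add, map_smul, LinearMap.add_apply, LinearMap.smul_apply,
    hb _ _, smul_eq_mul]
  simp
  ring

lemma det_vec (b : Module.Basis (Fin 3) ℝ V) (x y z : V) :
    b.det ![x, y, z] = b.repr x 0 * (b.repr y 1 * b.repr z 2 - b.repr y 2 * b.repr z 1)
      - b.repr x 1 * (b.repr y 0 * b.repr z 2 - b.repr y 2 * b.repr z 0)
      + b.repr x 2 * (b.repr y 0 * b.repr z 1 - b.repr y 1 * b.repr z 0) := by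
  rw [Module.Basis.det_apply, Matrix.det_fin_three]
  simp [Module.Basis.toMatrix_apply]
  ring

lemma exists_sign (b : Module.Basis (Fin 3) ℝ V) (o : Orientation ℝ V (Fin 3)) :
    ∃ k : ℝ, (k = 1 ∨ k = -1) ∧ ∀ x y z : V,
      (∃ b' : Module.Basis (Fin 3) ℝ V, b' 0 = x ∧ b' 1 = y ∧ b' 2 = z ∧ b'.orientation = o) ↔
        0 < k * b.det ![x, y, z] := by
  have hvec : ∀ (b' : Module.Basis (Fin 3) ℝ V), ![b' 0, b' 1, b' 2] = b' := by
    intro b'; ext i; fin_cases i <;> rfl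
  have key : ∀ x y z : V, b.det ![x, y, z] ≠ 0 → ∃ b' : Module.Basis (Fin 3) ℝ V,
      b' 0 = x ∧ b' 1 = y ∧ b' 2 = z := by
    intro x y z h
    have := (Module.Basis.is_basis_iff_det b (v := ![x, y, z])).2 (isUnit_iff_ne_zero.2 h)
    refine ⟨Module.Basis.mk this.1 this.2.ge, ?_, ?_, ?_⟩ <;> simp
  rcases b.orientation_eq_or_eq_neg o with h | h
  · refine ⟨1, Or.inl rfl, fun x y z => ⟨?_, fun hp => ?_⟩⟩
    · rintro ⟨b', rfl, rfl, rfl, h'⟩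
      rw [one_mul, hvec]
      exact (b.orientation_eq_iff_det_pos b').1 (h.symm.trans h'.symm)
    · rw [one_mul] at hp
      obtain ⟨b', rfl, rfl, rfl⟩ := key x y z hp.ne'
      rw [hvec] at hp
      exact ⟨b', rfl, rfl, rfl, h ▸ ((b.orientation_eq_iff_det_pos b').2 hp).symm⟩
  · have hne : ∀ b' : Module.Basis (Fin 3) ℝ V, b'.orientation = o ↔ b.det b' < 0 := by
      intro b'
      have h1 := b.orientation_eq_iff_det_pos b'
      have h0 : b.det b' ≠ 0 := (b.isUnit_det b').ne_zero
      rw [h, ← b.orientation_ne_iff_eq_neg, ne_eq, eq_comm, h1, not_lt]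
      exact ⟨fun h2 => lt_of_le_of_ne h2 h0, le_of_lt⟩
    refine ⟨-1, Or.inr rfl, fun x y z => ⟨?_, fun hp => ?_⟩⟩
    · rintro ⟨b', rfl, rfl, rfl, h'⟩
      rw [hvec]
      have := (hne b').1 h'
      linarith
    · obtain ⟨b', rfl, rfl, rfl⟩ := key x y z (by rintro h0; simp [h0] at hp)
      rw [hvec] at hp
      exact ⟨b', rfl, rfl, rfl, (hne b').2 (by linarith)⟩

lemma pos_of_orthogonal {B : LinearMap.BilinForm ℝ V} {b : Module.Basis (Fin 3) ℝ V}
    (hb : IsLorentzBasis B b) {t x : V} (ht : B t t < 0) (h : B t x = 0) (hx : x ≠ 0) :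
    0 < B x x := by
  rw [hb.apply] at *
  set t0 := b.repr t 0; set t1 := b.repr t 1; set t2 := b.repr t 2
  have hx' : b.repr x 0 ≠ 0 ∨ b.repr x 1 ≠ 0 ∨ b.repr x 2 ≠ 0 := by
    by_contra! hc
    apply hx
    apply b.ext_elem
    intro i; fin_cases i <;> simp [hc]
  set x0 := b.repr x 0; set x1 := b.repr x 1; set x2 := b.repr x 2
  by_contra! hc
  have h1 : t0 * x0 = t1 * x1 + t2 * x2 := by linarith
  have h2 : (t0 * x0) ^ 2 ≤ (t1 ^ 2 + t2 ^ 2) * (x1 ^ 2 + x2 ^ 2) := by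
    rw [h1]; nlinarith [sq_nonneg (t1 * x2 - t2 * x1)]
  have h0 : x0 = 0 := by
    by_contra h0
    have h3 : 0 < x0 ^ 2 := by positivity
    have h4 : (t1 ^ 2 + t2 ^ 2) * (x1 ^ 2 + x2 ^ 2) ≤ (t1 ^ 2 + t2 ^ 2) * x0 ^ 2 :=
      mul_le_mul_of_nonneg_left (by linarith) (by positivity)
    have h5 : (t1 ^ 2 + t2 ^ 2) * x0 ^ 2 < t0 ^ 2 * x0 ^ 2 :=
      mul_lt_mul_of_pos_right (by linarith) h3
    linarith [mul_pow t0 x0 2]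
  have h3 : x1 = 0 := by
    rw [h0] at hc
    exact pow_eq_zero_iff two_ne_zero |>.1 (le_antisymm (by linarith [sq_nonneg x2]) (sq_nonneg x1))
  have h4 : x2 = 0 := by
    rw [h0] at hc
    exact pow_eq_zero_iff two_ne_zero |>.1 (le_antisymm (by linarith [sq_nonneg x1]) (sq_nonneg x2))
  simp [h0, h3, h4] at hx'

/-- Existence and uniqueness of the quarter turn. -/
lemma existsUnique_isQuarterTurn {B : LinearMap.BilinForm ℝ V} {b : Module.Basis (Fin 3) ℝ V}
    (hb : IsLorentzBasis B b) (o : Orientation ℝ V (Fin 3)) {t w : V} (ht : B t t = -1)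
    (h : B t w = 0) : ∃! u, IsQuarterTurn B o t w u := by
  obtain ⟨k, hk, hdet⟩ := exists_sign b o
  have hk2 : k * k = 1 := by rcases hk with rfl | rfl <;> norm_num
  have hpos : ∀ x, B t x = 0 → x ≠ 0 → 0 < B x x := fun x =>
    pos_of_orthogonal hb (by rw [ht]; norm_num)
  simp only [IsQuarterTurn, hdet, det_vec]
  set u : V := (b.equivFun.symm ![-(b.repr t 1 * b.repr w 2 - b.repr t 2 * b.repr w 1),
    b.repr t 2 * b.repr w 0 - b.repr t 0 * b.repr w 2,
    b.repr t 0 * b.repr w 1 - b.repr t 1 * b.repr w 0]) with hu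
  have hu' : ∀ i, b.repr u i = ![-(b.repr t 1 * b.repr w 2 - b.repr t 2 * b.repr w 1),
    b.repr t 2 * b.repr w 0 - b.repr t 0 * b.repr w 2,
    b.repr t 0 * b.repr w 1 - b.repr t 1 * b.repr w 0] i := by
    intro i
    rw [← b.equivFun_apply, hu, LinearEquiv.apply_symm_apply]
  have hu0 := hu' 0
  have hu1 := hu' 1
  have hu2 := hu' 2
  simp at hu0 hu1 hu2
  have huu : B u u = B w w := by
    have e : B u u = (B t w) ^ 2 - B t t * B w w := by
      simp only [hb.apply, hu0, hu1, hu2]; ring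
    rw [e, h, ht]; ring
  have htu : B t u = 0 := by simp only [hb.apply, hu0, hu1, hu2]; ring
  have hwu : B w u = 0 := by simp only [hb.apply, hu0, hu1, hu2]; ring
  have hB : ∀ z, B u z = b.repr t 0 * (b.repr w 1 * b.repr z 2 - b.repr w 2 * b.repr z 1)
      - b.repr t 1 * (b.repr w 0 * b.repr z 2 - b.repr w 2 * b.repr z 0)
      + b.repr t 2 * (b.repr w 0 * b.repr z 1 - b.repr w 1 * b.repr z 0) := by
    intro z
    simp only [hb.apply, hu0, hu1, hu2]; ring
  simp only [← hB]
  refine ⟨k • u, ⟨by simp [htu], by simp [hwu], by simp [huu, ← mul_assoc, hk2], ?_⟩, ?_⟩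
  · intro hw
    have := hpos w h hw
    simpa [huu, ← mul_assoc, hk2] using this
  · rintro y ⟨h1, h2, h3, h4⟩
    by_cases hw : w = 0
    · subst hw
      have hy : y = 0 := by
        by_contra hy
        have := hpos y h1 hy
        simp [h3] at this
      have hu : u = 0 := by
        by_contra hu
        have := hpos u htu hu
        simp [huu] at this
      simp [hy, hu]
    · have hwpos := hpos w h hw
      have h4 := h4 hw
      -- the part of `y` orthogonal to `u` is orthogonal to a basis
      have hsymm : ∀ x y, B x y = B y x := fun x y => by simp only [hb.apply]; ring
      have hB' := hB
      simp only [← det_vec] at hB'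
      set c := B u y / B w w with hc
      have hcu : y = c • u := by
        have ho : B t (y - c • u) = 0 := by simp [h1, htu]
        by_contra hne
        have hne' : y - c • u ≠ 0 := sub_ne_zero.2 hne
        have hp := hpos _ ho hne'
        have hw0 : B w (y - c • u) = 0 := by simp [h2, hwu]
        have hu0 : B u (y - c • u) = 0 := by
          simp [huu, hc, div_mul_cancel₀ _ hwpos.ne']
        have hbas : LinearIndependent ℝ ![t, w, u] ∧ ⊤ ≤ Submodule.span ℝ (Set.range ![t, w, u]) := by
          have := (Module.Basis.is_basis_iff_det b (v := ![t, w, u])).2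
            (isUnit_iff_ne_zero.2 (by rw [← hB', huu]; exact hwpos.ne'))
          exact ⟨this.1, this.2.ge⟩
        have hz : B.flip (y - c • u) = 0 := by
          apply (Module.Basis.mk hbas.1 hbas.2).ext
          intro i; fin_cases i <;> simp [-map_sub, -map_smul, ho, hw0, hu0]
        have := LinearMap.congr_fun hz (y - c • u)
        simp only [LinearMap.zero_apply] at this
        exact hp.ne' this
      have hcc : c * c = 1 := by
        have h5 := h3
        rw [hcu] at h5
        simp only [map_smul, LinearMap.smul_apply, smul_eq_mul, huu] at h5
        have : (c * c - 1) * B w w = 0 := by linarith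
        rcases mul_eq_zero.1 this with h6 | h6
        · linarith
        · exact absurd h6 hwpos.ne'
      have hkc : 0 < k * c := by
        have : B u y = c * B w w := by rw [hc, div_mul_cancel₀ _ hwpos.ne']
        rw [this, ← mul_assoc] at h4
        exact pos_of_mul_pos_left h4 hwpos.le
      have : c = k := by
        rcases hk with rfl | rfl <;> nlinarith
      rw [hcu, this]
lemma IsQuarterTurn.combine {B : LinearMap.BilinForm ℝ V} {b : Module.Basis (Fin 3) ℝ V}
    (hb : IsLorentzBasis B b) {o : Orientation ℝ V (Fin 3)} {t w u : V} (ht : B t t = -1)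
    (h : B t w = 0) (hu : IsQuarterTurn B o t w u) (x y : ℝ) :
    IsQuarterTurn B o t (x • w + y • u) (x • u - y • w) := by
  have hsymm : ∀ x y, B x y = B y x := fun x y => by simp only [hb.apply]; ring
  obtain ⟨h1, h2, h3, h4⟩ := hu
  have h2' : B u w = 0 := by rw [hsymm, h2]
  have h12 : B (x • w + y • u) (x • u - y • w) = 0 := by
    simp only [map_add, map_sub, map_smul, LinearMap.add_apply, LinearMap.smul_apply, smul_eq_mul,
      h2, h2', h3]
    ring
  have h11 : B (x • u - y • w) (x • u - y • w) = B (x • w + y • u) (x • w + y • u) := by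
    simp only [map_add, map_sub, map_smul, LinearMap.add_apply, LinearMap.sub_apply,
      LinearMap.smul_apply, smul_eq_mul, h2, h2', h3]
    ring
  refine ⟨by simp [h, h1], h12, h11, fun hne => ?_⟩
  have hw : w ≠ 0 := by
    rintro rfl
    have hu0 : u = 0 := by
      by_contra hu
      have := pos_of_orthogonal hb (by rw [ht]; norm_num) h1 hu
      simp [h3] at this
    simp [hu0] at hne
  obtain ⟨k, hk, hdet⟩ := exists_sign b o
  have h5 := (hdet _ _ _).1 (h4 hw)
  rw [hdet]
  have hxy : 0 < x ^ 2 + y ^ 2 := by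
    by_contra hc
    have hx : x = 0 := by nlinarith [sq_nonneg x, sq_nonneg y]
    have hy : y = 0 := by nlinarith [sq_nonneg x, sq_nonneg y]
    simp [hx, hy] at hne
  have h6 : k * b.det ![t, x • w + y • u, x • u - y • w]
      = (x ^ 2 + y ^ 2) * (k * b.det ![t, w, u]) := by
    simp only [det_vec, map_add, map_sub, map_smul, Finsupp.add_apply, Finsupp.sub_apply,
      Finsupp.smul_apply, smul_eq_mul]
    ring
  rw [h6]
  positivity

open Classical in
/-- The vector obtained from `w ⟂ t` by a positive quarter turn in the plane `t^⟂`. -/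
def quarterTurn (B : LinearMap.BilinForm ℝ V) (o : Orientation ℝ V (Fin 3)) (t w : V) : V :=
  if h : ∃ u, IsQuarterTurn B o t w u then h.choose else 0

lemma quarterTurn_spec {B : LinearMap.BilinForm ℝ V} {b : Module.Basis (Fin 3) ℝ V}
    (hb : IsLorentzBasis B b) (o : Orientation ℝ V (Fin 3)) {t w : V} (ht : B t t = -1)
    (h : B t w = 0) : IsQuarterTurn B o t w (quarterTurn B o t w) := by
  have hex := (existsUnique_isQuarterTurn hb o ht h).exists
  rw [quarterTurn, dif_pos hex]
  exact hex.choose_spec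

lemma quarterTurn_eq {B : LinearMap.BilinForm ℝ V} {b : Module.Basis (Fin 3) ℝ V}
    (hb : IsLorentzBasis B b) {o : Orientation ℝ V (Fin 3)} {t w u : V} (ht : B t t = -1)
    (h : B t w = 0) (hu : IsQuarterTurn B o t w u) : quarterTurn B o t w = u :=
  (existsUnique_isQuarterTurn hb o ht h).unique (quarterTurn_spec hb o ht h) hu

/-- `e^{iθ} · w = t + cos θ w̄ + sin θ ū` for `w = t + w̄` with `w̄ ⟂ t`, where `ū` is
`w̄` turned by a quarter turn. -/
def rotate (B : LinearMap.BilinForm ℝ V) (o : Orientation ℝ V (Fin 3)) (t : V) (z : Circle)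
    (w : V) : V :=
  t + (z : ℂ).re • (w - t) + (z : ℂ).im • quarterTurn B o t (w - t)

lemma rotate_one (B : LinearMap.BilinForm ℝ V) (o : Orientation ℝ V (Fin 3)) (t w : V) :
    rotate B o t 1 w = w := by
  simp [rotate]

lemma rotate_null {B : LinearMap.BilinForm ℝ V} {b : Module.Basis (Fin 3) ℝ V}
    (hb : IsLorentzBasis B b) (o : Orientation ℝ V (Fin 3)) {t w : V} (ht : B t t = -1)
    (h : B t w = -1) (hw : B w w = 0) (z : Circle) :
    B t (rotate B o t z w) = -1 ∧ B (rotate B o t z w) (rotate B o t z w) = 0 := by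
  have hsymm : ∀ x y, B x y = B y x := fun x y => by simp only [hb.apply]; ring
  have hx : B t (w - t) = 0 := by simp [h, ht]
  have hxx : B (w - t) (w - t) = 1 := by
    simp only [map_sub, LinearMap.sub_apply, hsymm w t, hw, h, ht]; ring
  have hz : (z : ℂ).re ^ 2 + (z : ℂ).im ^ 2 = 1 := by
    have := Circle.normSq_coe z
    rw [Complex.normSq_apply] at this
    linarith
  obtain ⟨h1, h2, h3, -⟩ := quarterTurn_spec hb o ht hx
  unfold rotate
  generalize w - t = x at *
  generalize quarterTurn B o t x = u at *
  constructor
  · simp [hx, h1, ht]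
  · simp only [map_add, map_smul, LinearMap.add_apply, LinearMap.smul_apply, smul_eq_mul,
      hsymm x t, hsymm u t, hsymm u x, hx, h1, h2, h3, hxx, ht]
    linarith

lemma rotate_mul {B : LinearMap.BilinForm ℝ V} {b : Module.Basis (Fin 3) ℝ V}
    (hb : IsLorentzBasis B b) (o : Orientation ℝ V (Fin 3)) {t w : V} (ht : B t t = -1)
    (h : B t w = -1) (y z : Circle) :
    rotate B o t (y * z) w = rotate B o t y (rotate B o t z w) := by
  have hx : B t (w - t) = 0 := by simp [h, ht]
  have hq := quarterTurn_spec hb o ht hx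
  unfold rotate
  generalize w - t = x at *
  generalize quarterTurn B o t x = u at *
  have h0 : B t ((z : ℂ).re • x + (z : ℂ).im • u) = 0 := by simp [hx, hq.1]
  have h1 : t + (z : ℂ).re • x + (z : ℂ).im • u - t = (z : ℂ).re • x + (z : ℂ).im • u := by abel
  rw [h1, quarterTurn_eq hb ht h0 (hq.combine hb ht hx _ _)]
  simp only [Circle.coe_mul, Complex.mul_re, Complex.mul_im]
  module

end LinearAlgebra

section Metric

variable (E : Type*) [NormedAddCommGroup E] [NormedSpace ℝ E]
  (M : Type*) [TopologicalSpace M] [ChartedSpace E M] [IsManifold 𝓘(ℝ, E) ∞ M]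

/-- A smooth Lorentzian metric, of signature `(-,+,+)`, on a 3-dimensional manifold. -/
structure LorentzianMetric where
  val : ∀ p : M, TangentSpace 𝓘(ℝ, E) p →L[ℝ] TangentSpace 𝓘(ℝ, E) p →L[ℝ] ℝ
  symm : ∀ (p : M) (u v : TangentSpace 𝓘(ℝ, E) p), val p u v = val p v u
  signature : ∀ p : M, ∃ b : Module.Basis (Fin 3) ℝ (TangentSpace 𝓘(ℝ, E) p),
    ∀ i j, val p (b i) (b j) = if i = j then (if i = 0 then -1 else 1) else 0
  contMDiff : ContMDiff 𝓘(ℝ, E) (𝓘(ℝ, E).prod 𝓘(ℝ, E →L[ℝ] E →L[ℝ] ℝ)) ∞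
    (fun p : M => Bundle.TotalSpace.mk' (E →L[ℝ] E →L[ℝ] ℝ) p (val p))

/-- An orientation of a 3-dimensional manifold: an orientation of every tangent space, which is
locally constant when read in the local trivializations of the tangent bundle. -/
structure ManifoldOrientation where
  fibre : ∀ p : M, Orientation ℝ (TangentSpace 𝓘(ℝ, E) p) (Fin 3)
  locallyConstant : ∀ p : M, ∃ o₀ : Orientation ℝ E (Fin 3), ∀ᶠ q in 𝓝 p,
    ∃ hq : q ∈ (trivializationAt E (TangentSpace 𝓘(ℝ, E) : M → Type _) p).baseSet,
      Orientation.map (Fin 3) ((trivializationAt E (TangentSpace 𝓘(ℝ, E) : M → Type _)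
        p).continuousLinearEquivAt ℝ q hq).toLinearEquiv (fibre q) = o₀

end Metric

variable {E : Type*} [NormedAddCommGroup E] [NormedSpace ℝ E]
  {M : Type*} [TopologicalSpace M] [ChartedSpace E M] [IsManifold 𝓘(ℝ, E) ∞ M]

/-- The metric at `p` as an algebraic bilinear form. -/
def LorentzianMetric.form (g : LorentzianMetric E M) (p : M) :
    LinearMap.BilinForm ℝ (TangentSpace 𝓘(ℝ, E) p) :=
  (g.val p).toLinearMap₁₂

/-! ### The Levi-Civita connection, its connection map and the Sasaki metric -/

/-- The metric `g` in the preferred chart at `p`, as a function on the model space with values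
in the bilinear forms. -/
def metricInChart (g : LorentzianMetric E M) (p : M) (x : E) : E →L[ℝ] E →L[ℝ] ℝ :=
  let q : M := (extChartAt 𝓘(ℝ, E) p).symm x
  let e : E →L[ℝ] TangentSpace 𝓘(ℝ, E) q :=
    (trivializationAt E (TangentSpace 𝓘(ℝ, E) : M → Type _) p).symmL ℝ q
  ContinuousLinearMap.bilinearComp (E := E) (F := E) (E' := E) (F' := E) (g.val q) e e

/-- The Christoffel symbols of the Levi-Civita connection of `g`, at `p` and in the preferred chart
at `p`, which is the one through which `TangentSpace 𝓘(ℝ, E) p` is identified with `E`. -/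
def christoffel (g : LorentzianMetric E M) (p : M) (a b : E) : E :=
  christoffelSymbol (metricInChart g p) (extChartAt 𝓘(ℝ, E) p p) a b

lemma christoffel_add (g : LorentzianMetric E M) (p : M) (a a' b : E) :
    christoffel g p (a + a') b = christoffel g p a b + christoffel g p a' b :=
  christoffelSymbol_add _ _ _ _ _

lemma christoffel_smul (g : LorentzianMetric E M) (p : M) (r : ℝ) (a b : E) :
    christoffel g p (r • a) b = r • christoffel g p a b :=
  christoffelSymbol_smul _ _ _ _ _

/-- The differential `dπ` of the projection `π : TM → M`. -/
def dproj (v : TangentBundle 𝓘(ℝ, E) M) :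
    TangentSpace 𝓘(ℝ, E).tangent v →L[ℝ] TangentSpace 𝓘(ℝ, E) v.proj :=
  mfderiv 𝓘(ℝ, E).tangent 𝓘(ℝ, E) (Bundle.TotalSpace.proj : TangentBundle 𝓘(ℝ, E) M → M) v

/-- The connection map `c : TTM → TM` of the Levi-Civita connection. For a curve
`α` in `TM` with `α(0) = v` and `α'(0) = ξ`, `connector g v ξ` is the covariant derivative of the
vector field `α` along `π ∘ α` at time `0`: derivative of the components plus Christoffel term. -/
def connector (g : LorentzianMetric E M) (v : TangentBundle 𝓘(ℝ, E) M) :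
    TangentSpace 𝓘(ℝ, E).tangent v →ₗ[ℝ] TangentSpace 𝓘(ℝ, E) v.proj where
  toFun ξ :=
    let components : TangentBundle 𝓘(ℝ, E) M → E :=
      fun w => (trivializationAt E (TangentSpace 𝓘(ℝ, E) : M → Type _) v.proj w).2
    let dcomponents : E := mfderiv 𝓘(ℝ, E).tangent 𝓘(ℝ, E) components v ξ
    (dcomponents + christoffel g v.proj (dproj v ξ) v.2 : E)
  map_add' ξ ζ := by
    simp only [map_add]
    exact (congrArg _ (christoffel_add g v.proj _ _ _)).trans (add_add_add_comm (G := E) _ _ _ _)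
  map_smul' r ξ := by
    simp only [map_smul]
    exact (congrArg _ (christoffel_smul g v.proj _ _ _)).trans (smul_add (A := E) r _ _).symm

/-- The covariant derivative `∇_u X` of a vector field `X` at `p`, for the Levi-Civita
connection. -/
def covDeriv (g : LorentzianMetric E M) (X : ∀ p : M, TangentSpace 𝓘(ℝ, E) p) (p : M)
    (u : TangentSpace 𝓘(ℝ, E) p) : TangentSpace 𝓘(ℝ, E) p :=
  connector g (⟨p, X p⟩ : TangentBundle 𝓘(ℝ, E) M)
    (mfderiv 𝓘(ℝ, E) 𝓘(ℝ, E).tangent (fun q : M => (⟨q, X q⟩ : TangentBundle 𝓘(ℝ, E) M)) p u)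

/-- `X` is parallel: `∇ X = 0`. -/
def IsParallel (g : LorentzianMetric E M) (X : ∀ p : M, TangentSpace 𝓘(ℝ, E) p) : Prop :=
  ∀ (p : M) (u : TangentSpace 𝓘(ℝ, E) p), covDeriv g X p u = 0

/-- The Sasaki metric `ĝ(ζ,ξ) = g(dπ ζ, dπ ξ) + g(c ζ, c ξ)` of `TM`. -/
def sasaki (g : LorentzianMetric E M) (v : TangentBundle 𝓘(ℝ, E) M) :
    LinearMap.BilinForm ℝ (TangentSpace 𝓘(ℝ, E).tangent v) :=
  (g.form v.proj).compl₁₂ (dproj v : _ →ₗ[ℝ] _) (dproj v : _ →ₗ[ℝ] _)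
    + (g.form v.proj).compl₁₂ (connector g v) (connector g v)

lemma sasaki_apply (g : LorentzianMetric E M) (v : TangentBundle 𝓘(ℝ, E) M)
    (ζ ξ : TangentSpace 𝓘(ℝ, E).tangent v) :
    sasaki g v ζ ξ = g.val v.proj (dproj v ζ) (dproj v ξ)
      + g.val v.proj (connector g v ζ) (connector g v ξ) := rfl

/-! ### The null congruence as a submanifold of the tangent bundle -/

/-- The null congruence `C_K M = {v ∈ TM | g(v,v) = 0, g(v,K) = -1}`. -/
def nullCongruence (g : LorentzianMetric E M) (K : ∀ p : M, TangentSpace 𝓘(ℝ, E) p) :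
    Set (TangentBundle 𝓘(ℝ, E) M) :=
  {v | g.val v.proj v.2 v.2 = 0 ∧ g.val v.proj v.2 (K v.proj) = -1}

/-- The map `F(v) = (g(v,v)/2, g(v,K))`, whose fibre over the regular value `(0,-1)` is `C_K M`. -/
def levelMap (g : LorentzianMetric E M) (K : ∀ p : M, TangentSpace 𝓘(ℝ, E) p)
    (v : TangentBundle 𝓘(ℝ, E) M) : ℝ × ℝ :=
  (g.val v.proj v.2 v.2 / 2, g.val v.proj v.2 (K v.proj))

lemma mem_nullCongruence_iff (g : LorentzianMetric E M) (K : ∀ p : M, TangentSpace 𝓘(ℝ, E) p)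
    (v : TangentBundle 𝓘(ℝ, E) M) :
    v ∈ nullCongruence g K ↔ levelMap g K v = (0, -1) := by
  simp [nullCongruence, levelMap]

/-- The tangent space `T_v C_K M`, as a subspace of `T_v TM`, at `v ∈ C_K M`: the kernel of
the differential of the submersion that cuts out `C_K M`. -/
def tangentNull (g : LorentzianMetric E M) (K : ∀ p : M, TangentSpace 𝓘(ℝ, E) p)
    (v : TangentBundle 𝓘(ℝ, E) M) : Submodule ℝ (TangentSpace 𝓘(ℝ, E).tangent v) :=
  LinearMap.ker (mfderiv 𝓘(ℝ, E).tangent 𝓘(ℝ, ℝ × ℝ) (levelMap g K) v).toLinearMap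

/-- The vertical space `𝒱_v` of `π : C_K M → M`: the vectors tangent to the fibre. -/
def vertical (g : LorentzianMetric E M) (K : ∀ p : M, TangentSpace 𝓘(ℝ, E) p)
    (v : TangentBundle 𝓘(ℝ, E) M) : Submodule ℝ (TangentSpace 𝓘(ℝ, E).tangent v) :=
  tangentNull g K v ⊓ LinearMap.ker (dproj v).toLinearMap

/-- The horizontal space `ℋ_v` of `π : C_K M → M`: the `ĝ`-orthogonal complement of `𝒱_v` in
`T_v C_K M`. -/
def horizontal (g : LorentzianMetric E M) (K : ∀ p : M, TangentSpace 𝓘(ℝ, E) p)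
    (v : TangentBundle 𝓘(ℝ, E) M) : Submodule ℝ (TangentSpace 𝓘(ℝ, E).tangent v) :=
  tangentNull g K v ⊓ (sasaki g v).orthogonal (vertical g K v)

/-! ### The circle action -/

/-- The factor `f = 1 / √(-g(K,K))`. -/
def normFactor (g : LorentzianMetric E M) (K : ∀ p : M, TangentSpace 𝓘(ℝ, E) p) (p : M) : ℝ :=
  1 / √(-(g.val p (K p) (K p)))

/-- The unit timelike vector field `𝒯 = K / √(-g(K,K))`. -/
def unitField (g : LorentzianMetric E M) (K : ∀ p : M, TangentSpace 𝓘(ℝ, E) p) (p : M) :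
    TangentSpace 𝓘(ℝ, E) p :=
  normFactor g K p • K p

/-- The circle action `Φ(e^{iθ}, v) = f (e^{iθ} · σ(v))`, where `σ(v) = -v / g(v,𝒯)`.
The formula makes sense, and is smooth in `v`, near `C_K M`;
hence the differential of `Φ_θ : C_K M → C_K M` at `v` is the restriction to `T_v C_K M` of the
derivative of this map. -/
def circleAction (g : LorentzianMetric E M) (o : ManifoldOrientation E M)
    (K : ∀ p : M, TangentSpace 𝓘(ℝ, E) p) (z : Circle) (v : TangentBundle 𝓘(ℝ, E) M) :
    TangentBundle 𝓘(ℝ, E) M :=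
  ⟨v.proj, normFactor g K v.proj • rotate (g.form v.proj) (o.fibre v.proj) (unitField g K v.proj) z
    (-(g.val v.proj v.2 (unitField g K v.proj))⁻¹ • v.2)⟩

section Action

variable {g : LorentzianMetric E M} {K : ∀ p : M, TangentSpace 𝓘(ℝ, E) p}

lemma normFactor_pos (hK : ∀ p, g.val p (K p) (K p) < 0) (p : M) : 0 < normFactor g K p := by
  have := hK p
  have : 0 < √(-(g.val p (K p) (K p))) := Real.sqrt_pos.2 (by linarith)
  unfold normFactor
  positivity

lemma form_unitField (hK : ∀ p, g.val p (K p) (K p) < 0) (p : M) :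
    g.form p (unitField g K p) (unitField g K p) = -1 := by
  have h := hK p
  have h2 : √(-(g.val p (K p) (K p))) ≠ 0 := (Real.sqrt_pos.2 (by linarith)).ne'
  have h3 : √(-(g.val p (K p) (K p))) ^ 2 = -(g.val p (K p) (K p)) :=
    Real.sq_sqrt (by linarith)
  have h4 : g.form p (K p) (K p) = g.val p (K p) (K p) := rfl
  simp only [unitField, normFactor, map_smul, LinearMap.smul_apply, smul_eq_mul, h4]
  field_simp
  linarith

lemma sigma_spec (hK : ∀ p, g.val p (K p) (K p) < 0) {v : TangentBundle 𝓘(ℝ, E) M}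
    (hv : v ∈ nullCongruence g K) :
    normFactor g K v.proj • (-(g.val v.proj v.2 (unitField g K v.proj))⁻¹ • v.2) = v.2 ∧
    g.form v.proj (unitField g K v.proj)
      (-(g.val v.proj v.2 (unitField g K v.proj))⁻¹ • v.2) = -1 ∧
    g.form v.proj (-(g.val v.proj v.2 (unitField g K v.proj))⁻¹ • v.2)
      (-(g.val v.proj v.2 (unitField g K v.proj))⁻¹ • v.2) = 0 := by
  have hf := (normFactor_pos hK v.proj).ne'
  have h1 : g.val v.proj v.2 (unitField g K v.proj) = -normFactor g K v.proj := by
    simp only [unitField, map_smul, smul_eq_mul, hv.2]; ring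
  have h2 : g.form v.proj (unitField g K v.proj) v.2 = -normFactor g K v.proj :=
    (g.symm _ _ _).trans h1
  have h3 : g.form v.proj v.2 v.2 = 0 := hv.1
  rw [h1]
  refine ⟨?_, ?_, ?_⟩
  · rw [smul_smul]
    convert one_smul ℝ v.2 using 2
    field_simp
  · rw [map_smul, h2, smul_eq_mul]
    field_simp
  · rw [map_smul, map_smul, LinearMap.smul_apply, h3]
    simp

/-- The circle action preserves `C_K M`. -/
lemma circleAction_mem (hK : ∀ p, g.val p (K p) (K p) < 0) (o : ManifoldOrientation E M)
    (z : Circle) {v : TangentBundle 𝓘(ℝ, E) M} (hv : v ∈ nullCongruence g K) :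
    circleAction g o K z v ∈ nullCongruence g K := by
  obtain ⟨b, hb⟩ := g.signature v.proj
  have hf := (normFactor_pos hK v.proj).ne'
  obtain ⟨-, h2, h3⟩ := sigma_spec hK hv
  obtain ⟨h4, h5⟩ := rotate_null (B := g.form v.proj) hb (o.fibre v.proj)
    (form_unitField hK v.proj) h2 h3 z
  constructor
  · change g.form v.proj (normFactor g K v.proj • _) (normFactor g K v.proj • _) = 0
    rw [map_smul, map_smul, LinearMap.smul_apply, h5]
    simp
  · have h6 : g.form v.proj (K v.proj) (rotate (g.form v.proj) (o.fibre v.proj)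
        (unitField g K v.proj) z (-(g.val v.proj v.2 (unitField g K v.proj))⁻¹ • v.2))
        = -(normFactor g K v.proj)⁻¹ := by
      have h7 : K v.proj = (normFactor g K v.proj)⁻¹ • unitField g K v.proj := by
        rw [unitField, smul_smul, inv_mul_cancel₀ hf, one_smul]
      conv_lhs => rw [h7]
      rw [map_smul, LinearMap.smul_apply, h4]
      simp
    refine (g.symm _ _ _).trans ?_
    change g.form v.proj (K v.proj) (normFactor g K v.proj • _) = -1
    rw [map_smul, h6, smul_eq_mul]
    field_simp

lemma circleAction_one (hK : ∀ p, g.val p (K p) (K p) < 0) (o : ManifoldOrientation E M)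
    {v : TangentBundle 𝓘(ℝ, E) M} (hv : v ∈ nullCongruence g K) :
    circleAction g o K 1 v = v := by
  unfold circleAction
  rw [rotate_one, (sigma_spec hK hv).1]

lemma circleAction_mul (hK : ∀ p, g.val p (K p) (K p) < 0) (o : ManifoldOrientation E M)
    (y z : Circle) {v : TangentBundle 𝓘(ℝ, E) M} (hv : v ∈ nullCongruence g K) :
    circleAction g o K (y * z) v = circleAction g o K y (circleAction g o K z v) := by
  obtain ⟨b, hb⟩ := g.signature v.proj
  have hf := (normFactor_pos hK v.proj).ne'
  obtain ⟨-, h2, h3⟩ := sigma_spec hK hv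
  have h4 := (rotate_null (B := g.form v.proj) hb (o.fibre v.proj)
    (form_unitField hK v.proj) h2 h3 z).1
  have h5 := rotate_mul (B := g.form v.proj) hb (o.fibre v.proj)
    (form_unitField hK v.proj) h2 y z
  unfold circleAction
  dsimp only
  rw [h5]
  congr 3
  generalize rotate (g.form v.proj) (o.fibre v.proj) (unitField g K v.proj) z
    (-(g.val v.proj v.2 (unitField g K v.proj))⁻¹ • v.2) = w at *
  have h6 : g.val v.proj (normFactor g K v.proj • w) (unitField g K v.proj)
      = -normFactor g K v.proj := by
    refine (g.symm _ _ _).trans ?_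
    change g.form v.proj (unitField g K v.proj) (normFactor g K v.proj • w) = _
    rw [map_smul, h4, smul_eq_mul]
    ring
  rw [h6, smul_smul]
  convert (one_smul ℝ w).symm using 2
  field_simp

end Action

/-- The differential `dΦ_θ` at `v`. -/
def dcircleAction (g : LorentzianMetric E M) (o : ManifoldOrientation E M)
    (K : ∀ p : M, TangentSpace 𝓘(ℝ, E) p) (z : Circle) (v : TangentBundle 𝓘(ℝ, E) M) :
    TangentSpace 𝓘(ℝ, E).tangent v →L[ℝ] TangentSpace 𝓘(ℝ, E).tangent (circleAction g o K z v) :=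
  mfderiv 𝓘(ℝ, E).tangent 𝓘(ℝ, E).tangent (circleAction g o K z) v

/-- The distribution `D` on `C_K M` is smooth: locally it is spanned
by smooth vector fields. -/
def IsSmoothDistribution (g : LorentzianMetric E M) (K : ∀ p : M, TangentSpace 𝓘(ℝ, E) p)
    (D : ∀ v : TangentBundle 𝓘(ℝ, E) M, Submodule ℝ (TangentSpace 𝓘(ℝ, E).tangent v)) : Prop :=
  ∀ v ∈ nullCongruence g K, ∃ (U : Set (TangentBundle 𝓘(ℝ, E) M)) (n : ℕ)
    (X : Fin n → ∀ w : TangentBundle 𝓘(ℝ, E) M, TangentSpace 𝓘(ℝ, E).tangent w),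
    IsOpen U ∧ v ∈ U ∧
    (∀ i, ContMDiffOn 𝓘(ℝ, E).tangent 𝓘(ℝ, E).tangent.tangent ∞ (fun w =>
      (⟨w, X i w⟩ : TangentBundle 𝓘(ℝ, E).tangent (TangentBundle 𝓘(ℝ, E) M))) U) ∧
    ∀ w ∈ U ∩ nullCongruence g K, Submodule.span ℝ (Set.range fun i => X i w) = D w

/-- The distribution `D` is a connection on the principal circle bundle `π : C_K M → M`: it is
a smooth distribution on `C_K M`, complementary to the vertical one and invariant under the
circle action. -/
structure IsPrincipalConnection (g : LorentzianMetric E M) (o : ManifoldOrientation E M)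
    (K : ∀ p : M, TangentSpace 𝓘(ℝ, E) p)
    (D : ∀ v : TangentBundle 𝓘(ℝ, E) M, Submodule ℝ (TangentSpace 𝓘(ℝ, E).tangent v)) : Prop where
  disjoint : ∀ v ∈ nullCongruence g K, D v ⊓ vertical g K v = ⊥
  sup_eq : ∀ v ∈ nullCongruence g K, D v ⊔ vertical g K v = tangentNull g K v
  invariant : ∀ (z : Circle), ∀ v ∈ nullCongruence g K,
    (D v).map (dcircleAction g o K z v).toLinearMap = D (circleAction g o K z v)
  smooth : IsSmoothDistribution g K D

/-- The circle action is isometric for the metric induced on `C_K M` by the Sasaki metric. -/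
def IsIsometricAction (g : LorentzianMetric E M) (o : ManifoldOrientation E M)
    (K : ∀ p : M, TangentSpace 𝓘(ℝ, E) p) : Prop :=
  ∀ (z : Circle), ∀ v ∈ nullCongruence g K, ∀ ξ ∈ tangentNull g K v, ∀ ζ ∈ tangentNull g K v,
    sasaki g (circleAction g o K z v) (dcircleAction g o K z v ξ) (dcircleAction g o K z v ζ)
      = sasaki g v ξ ζ

end NullCongruence

end

/-! Let v = f(𝒯 + w) be a point of C_KM, completed to an oriented orthonormal frame 𝒯, w, u, and let
c be the connection map. A vector ξ of T_v TM amounts to the pair (dπ ξ, c ξ). If ξ is tangent to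
C_KM, then c ξ is orthogonal to the null vector 𝒯 + w, so the 𝒯- and w-components of c ξ and c ζ
contribute nothing to g(c ξ, c ζ). With μ(ξ) = g(u, c ξ) this gives ĝ(ξ,ζ) = g(dπ ξ, dπ ζ) + μ(ξ)
μ(ζ) on T_v C_KM (`sasaki_eq_of_mem_tangentNull`). The fibre direction is spanned by the vector with
dπ = 0 and c = u, so ℋ_v is the kernel of μ (`mem_horizontal_iff`).

The map Φ_θ covers the identity of M, so only its effect on μ matters. At Φ_θ(v) the adapted frame
is 𝒯, cos θ w + sin θ u, cos θ u - sin θ w; write μ' for the corresponding form. The central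
computation (`inner_connector_dcircleAction`, resting on `inner_covDeriv_frameRotation`) is μ'(dΦ_θ
ξ) = μ(ξ) + f ((cos θ - 1) g(u, ∇_a 𝒯) - sin θ g(w, ∇_a 𝒯)), where a = dπ ξ.

If ∇𝒯 = 0, then μ' ∘ dΦ_θ = μ, and Φ_θ preserves both ĝ and ℋ. Conversely, let ξ be the horizontal
lift of a. Invariance of ℋ says μ'(dΦ_θ ξ) = 0, and isometry says it too, because ĝ(ξ,ξ) is
preserved. So the correction term vanishes for every θ; θ = π and θ = π/2 show that ∇_a 𝒯 has no u-
and no w-component, and it has no 𝒯-component because 𝒯 is a unit field (`isParallel_unitField`).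
That ℋ is smooth and complementary to 𝒱 holds for every K. -/

set_option maxSynthPendingDepth 3

namespace NullCongruence

/-! ### Christoffel symbols and covariant derivatives on the model space. -/

section LocalMetric

variable {E : Type*} [NormedAddCommGroup E] [NormedSpace ℝ E]

/-- `G` is, near `x`, a smooth symmetric tensor field, and it is nondegenerate at `x`. -/
structure IsMetricAt (G : E → E →L[ℝ] E →L[ℝ] ℝ) (x : E) : Prop where
  smooth : ContDiffAt ℝ ∞ G x
  symm : ∀ᶠ y in 𝓝 x, ∀ b c, G y b c = G y c b
  invertible : (G x).IsInvertible

variable {G : E → E →L[ℝ] E →L[ℝ] ℝ} {x : E}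

namespace IsMetricAt

lemma differentiableAt (hG : IsMetricAt G x) : DifferentiableAt ℝ G x :=
  hG.smooth.differentiableAt (by simp)

lemma symm_apply (hG : IsMetricAt G x) (b c : E) : G x b c = G x c b :=
  hG.symm.self_of_nhds b c

lemma fderiv_symm (hG : IsMetricAt G x) (a b c : E) :
    fderiv ℝ G x a b c = fderiv ℝ G x a c b := by
  have h := fun b c : E => (hG.differentiableAt.hasFDerivAt.clm_apply
    (hasFDerivAt_const b x)).clm_apply (hasFDerivAt_const c x)
  have h2 : (fun y => G y b c) =ᶠ[𝓝 x] fun y => G y c b := by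
    filter_upwards [hG.symm] with y hy using hy b c
  have := (h b c).unique ((h c b).congr_of_eventuallyEq h2)
  simpa using DFunLike.congr_fun this a

lemma injective (hG : IsMetricAt G x) {b b' : E} (h : ∀ c, G x b c = G x b' c) : b = b' := by
  obtain ⟨e, he⟩ := hG.invertible
  apply e.injective
  ext c
  have := h c
  rw [← he] at this
  exact this

lemma christoffelSymbol_spec (hG : IsMetricAt G x) (a b c : E) :
    G x (christoffelSymbol G x a b) c
      = (1 / 2) * (fderiv ℝ G x a b c + fderiv ℝ G x b a c - fderiv ℝ G x c a b) := by
  simp only [christoffelSymbol]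
  obtain ⟨e, he⟩ := hG.invertible
  rw [← he, ContinuousLinearMap.inverse_equiv]
  simp

/-- Metric compatibility, ∇G = 0: in the sum of the Koszul formulas for (a,b) against c and for
(a,c) against b, all terms cancel except the two derivatives in the direction a. -/
lemma fderiv_eq (hG : IsMetricAt G x) (a b c : E) :
    fderiv ℝ G x a b c
      = G x (christoffelSymbol G x a b) c + G x b (christoffelSymbol G x a c) := by
  rw [hG.symm_apply b, hG.christoffelSymbol_spec, hG.christoffelSymbol_spec,
    hG.fderiv_symm a c b, hG.fderiv_symm b a c, hG.fderiv_symm c a b]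
  ring

/-- The connection is torsion free, since the Koszul formula is symmetric in its first two
arguments. -/
lemma christoffelSymbol_symm (hG : IsMetricAt G x) (a b : E) :
    christoffelSymbol G x a b = christoffelSymbol G x b a := by
  apply hG.injective
  intro c
  rw [hG.christoffelSymbol_spec, hG.christoffelSymbol_spec, hG.fderiv_symm c a b]
  ring

lemma christoffelSymbol_add_right (hG : IsMetricAt G x) (a b b' : E) :
    christoffelSymbol G x a (b + b') = christoffelSymbol G x a b + christoffelSymbol G x a b' := by
  rw [hG.christoffelSymbol_symm, christoffelSymbol_add, hG.christoffelSymbol_symm b,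
    hG.christoffelSymbol_symm b']

lemma christoffelSymbol_smul_right (hG : IsMetricAt G x) (r : ℝ) (a b : E) :
    christoffelSymbol G x a (r • b) = r • christoffelSymbol G x a b := by
  rw [hG.christoffelSymbol_symm, christoffelSymbol_smul, hG.christoffelSymbol_symm b]

/-- The transformation law of the Christoffel symbols. -/
lemma christoffelSymbol_transform {G' : E → E →L[ℝ] E →L[ℝ] ℝ} {τ : E → E}
    (hG : IsMetricAt G x) (hG' : IsMetricAt G' (τ x)) (hτ : ContDiffAt ℝ ∞ τ x)
    (hsurj : Function.Surjective (fderiv ℝ τ x))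
    (h : ∀ᶠ y in 𝓝 x, ∀ b c, G y b c = G' (τ y) (fderiv ℝ τ y b) (fderiv ℝ τ y c)) (a b : E) :
    fderiv ℝ τ x (christoffelSymbol G x a b) = fderiv ℝ (fderiv ℝ τ) x a b
      + christoffelSymbol G' (τ x) (fderiv ℝ τ x a) (fderiv ℝ τ x b) := by
  set D := fderiv ℝ τ x with hD
  set D2 := fderiv ℝ (fderiv ℝ τ) x with hD2
  have hsymm2 : ∀ u w, D2 u w = D2 w u := by
    have : IsSymmSndFDerivAt ℝ τ x := hτ.isSymmSndFDerivAt (by simp; norm_cast)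
    exact fun u w => this u w
  have hτ1 : HasFDerivAt τ D x := (hτ.differentiableAt (by simp)).hasFDerivAt
  have hτ2 : HasFDerivAt (fderiv ℝ τ) D2 x :=
    ((hτ.fderiv_right (m := 1) (by norm_cast)).differentiableAt (by simp)).hasFDerivAt
  have hx := h.self_of_nhds
  -- The product rule for the pullback metric.
  have key : ∀ a b c, fderiv ℝ G x a b c = fderiv ℝ G' (τ x) (D a) (D b) (D c)
      + G' (τ x) (D2 a b) (D c) + G' (τ x) (D b) (D2 a c) := by
    intro a b c
    have h1 := (hG.differentiableAt.hasFDerivAt.clm_apply (hasFDerivAt_const b x)).clm_apply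
      (hasFDerivAt_const c x)
    have h2 := ((hG'.differentiableAt.hasFDerivAt.comp x hτ1).clm_apply
      (hτ2.clm_apply (hasFDerivAt_const b x))).clm_apply (hτ2.clm_apply (hasFDerivAt_const c x))
    have h3 := h1.unique (h2.congr_of_eventuallyEq (h.mono fun y hy => hy b c))
    have h4 := DFunLike.congr_fun h3 a
    simp at h4
    rw [h4]
    simp [← hD]
    ring
  -- Test against D c, which is every vector by surjectivity. In the Koszul combination of `key`,
  -- four of the six terms with second derivatives cancel in pairs, and the other two add up to 2
  -- G'(D2 a b, D c).
  apply hG'.injective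
  intro c'
  obtain ⟨c, rfl⟩ := hsurj c'
  rw [← hx, hG.christoffelSymbol_spec, map_add, _root_.add_apply,
    hG'.christoffelSymbol_spec, key, key, key, hsymm2 b a, hsymm2 c a, hsymm2 c b,
    hG'.symm_apply (D b) (D2 a c)]
  ring

/-- The two ingredients of the Christoffel symbols. Completeness of `E` makes inversion of operators
smooth at an invertible one. -/
lemma contDiffAt_christoffelSymbol [CompleteSpace E] (hG : IsMetricAt G x) :
    ContDiffAt ℝ ∞ (fun y => (G y).inverse) x ∧ ContDiffAt ℝ ∞ (fderiv ℝ G) x := by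
  refine ⟨?_, hG.smooth.fderiv_right (by norm_cast)⟩
  obtain ⟨e, he⟩ := hG.invertible
  exact ContDiffAt.comp x (g := ContinuousLinearMap.inverse) (he ▸ contDiffAt_map_inverse e)
    hG.smooth

lemma contDiffAt_christoffelSymbol_apply [CompleteSpace E] {F : Type*} [NormedAddCommGroup F]
    [NormedSpace ℝ F] {X : F → E} {a b : F → E} {n : F} (hX : ContDiffAt ℝ ∞ X n)
    (hG : IsMetricAt G (X n)) (ha : ContDiffAt ℝ ∞ a n) (hb : ContDiffAt ℝ ∞ b n) :
    ContDiffAt ℝ ∞ (fun m => christoffelSymbol G (X m) (a m) (b m)) n := by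
  obtain ⟨h1, h2⟩ := hG.contDiffAt_christoffelSymbol
  have h1 := h1.comp n hX
  have h2 := h2.comp n hX
  simp only [Function.comp_def] at h1 h2
  have h3 : ContDiffAt ℝ ∞ (fun m => ((fderiv ℝ G (X m)).flip (a m)).flip (b m)) n := by
    have := ((ContinuousLinearMap.flipₗᵢ ℝ E E
      (E →L[ℝ] ℝ)).contDiff.contDiffAt.comp n h2).clm_apply ha
    exact ((ContinuousLinearMap.flipₗᵢ ℝ E E ℝ).contDiff.contDiffAt.comp n this).clm_apply hb
  have h4 := (((h2.clm_apply ha).clm_apply hb).add ((h2.clm_apply hb).clm_apply ha)).sub h3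
  exact h1.clm_apply (h4.const_smul (1 / 2 : ℝ))

end IsMetricAt

/-- Along a curve through `x` with velocity `a`, the vector field `Y` is differentiable at time `0`
and has covariant derivative `d` there. -/
def HasCovDerivAlong (G : E → E →L[ℝ] E →L[ℝ] ℝ) (x a : E) (Y : ℝ → E) (d : E) : Prop :=
  HasDerivAt Y (d - christoffelSymbol G x a (Y 0)) 0

namespace HasCovDerivAlong

variable {a : E} {Y Z : ℝ → E} {y z : E}

lemma of_hasDerivAt {d : E} (h : HasDerivAt Y d 0) :
    HasCovDerivAlong G x a Y (d + christoffelSymbol G x a (Y 0)) := by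
  simpa [HasCovDerivAlong] using h

lemma add (hG : IsMetricAt G x) (hY : HasCovDerivAlong G x a Y y)
    (hZ : HasCovDerivAlong G x a Z z) : HasCovDerivAlong G x a (fun t => Y t + Z t) (y + z) := by
  have := HasDerivAt.fun_add hY hZ
  unfold HasCovDerivAlong
  rw [hG.christoffelSymbol_add_right]
  convert this using 1
  abel

lemma smul (hG : IsMetricAt G x) {φ : ℝ → ℝ} {φ' : ℝ} (hφ : HasDerivAt φ φ' 0)
    (hY : HasCovDerivAlong G x a Y y) :
    HasCovDerivAlong G x a (fun t => φ t • Y t) (φ 0 • y + φ' • Y 0) := by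
  have := HasDerivAt.fun_smul hφ hY
  unfold HasCovDerivAlong
  rw [hG.christoffelSymbol_smul_right]
  convert this using 1
  module

/-- The Christoffel terms hidden in the derivatives of `Y` and `Z` cancel the derivative of `G`
along the curve, by `IsMetricAt.fderiv_eq`. This product rule is the only property of the connection
used in the computations with frames. -/
lemma inner (hG : IsMetricAt G x) {γ : ℝ → E} (hγ : HasDerivAt γ a 0) (h0 : γ 0 = x)
    (hY : HasCovDerivAlong G x a Y y) (hZ : HasCovDerivAlong G x a Z z) :
    HasDerivAt (fun t => G (γ t) (Y t) (Z t)) (G x y (Z 0) + G x (Y 0) z) 0 := by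
  subst h0
  have h1 := HasDerivAt.clm_apply
    (HasDerivAt.clm_apply (hG.differentiableAt.hasFDerivAt.comp_hasDerivAt 0 hγ) hY) hZ
  refine h1.congr_deriv ?_
  simp only [Function.comp_apply, _root_.add_apply, hG.fderiv_eq, map_sub, _root_.sub_apply]
  ring

lemma unique {y' : E} (h : HasCovDerivAlong G x a Y y) (h' : HasCovDerivAlong G x a Y y') :
    y = y' := by
  have := HasDerivAt.unique h h'
  simpa using this

end HasCovDerivAlong

end LocalMetric
-- Orthonormal frames, and the covariant derivative of the rotation in a frame.
section LocalFrame

variable {E : Type*} [NormedAddCommGroup E] [NormedSpace ℝ E]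
  {G : E → E →L[ℝ] E →L[ℝ] ℝ} {x : E}

/-- `T, W, U` are orthonormal for the bilinear form `B`, where `T` is timelike. -/
structure IsLorentzTriple {V : Type*} [TopologicalSpace V] [AddCommGroup V] [Module ℝ V]
    (B : V →L[ℝ] V →L[ℝ] ℝ) (t w u : V) : Prop where
  tt : B t t = -1
  ww : B w w = 1
  uu : B u u = 1
  tw : B t w = 0
  tu : B t u = 0
  wu : B w u = 0

lemma contDiffAt_metric_apply (hG : IsMetricAt G x) {Y Z : E → E} (hY : ContDiffAt ℝ ∞ Y x)
    (hZ : ContDiffAt ℝ ∞ Z x) : ContDiffAt ℝ ∞ (fun y => G y (Y y) (Z y)) x :=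
  (hG.smooth.clm_apply hY).clm_apply hZ

/-- Normalization of a vector field that is a unit vector at `x`. -/
lemma exists_normalization (hG : IsMetricAt G x) {Y : E → E} (hY : ContDiffAt ℝ ∞ Y x)
    (h1 : G x (Y x) (Y x) = 1) : ∃ φ : E → ℝ, ContDiffAt ℝ ∞ φ x ∧ φ x = 1 ∧
      ∀ᶠ y in 𝓝 x, G y (φ y • Y y) (φ y • Y y) = 1 := by
  have h := contDiffAt_metric_apply hG hY hY
  refine ⟨fun y => (√(G y (Y y) (Y y)))⁻¹, (h.sqrt (by simp [h1])).inv (by simp [h1]),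
    by simp [h1], ?_⟩
  filter_upwards [h.continuousAt.eventually (lt_mem_nhds (a := 0) (by simp [h1]))] with y hy
  have h2 := Real.sq_sqrt hy.le
  have h3 := (Real.sqrt_pos.2 hy).ne'
  simp only [map_smul, _root_.smul_apply, smul_eq_mul]
  field_simp
  exact h2.symm

/-- The Gram-Schmidt extension of an orthonormal triple to a frame. -/
lemma exists_frame (hG : IsMetricAt G x) {T : E → E} (hT : ContDiffAt ℝ ∞ T x)
    (hTT : ∀ᶠ y in 𝓝 x, G y (T y) (T y) = -1) {w u : E} (h : IsLorentzTriple (G x) (T x) w u) :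
    ∃ W U : E → E, ContDiffAt ℝ ∞ W x ∧ ContDiffAt ℝ ∞ U x ∧ W x = w ∧ U x = u ∧
      ∀ᶠ y in 𝓝 x, IsLorentzTriple (G y) (T y) (W y) (U y) := by
  -- The projection orthogonal to `T` has a plus sign because `T` has square -1.
  set W₀ : E → E := fun y => w + G y (T y) w • T y with hW₀
  have hW₀s : ContDiffAt ℝ ∞ W₀ x :=
    contDiffAt_const.add ((contDiffAt_metric_apply hG hT contDiffAt_const).smul hT)
  have hW₀x : W₀ x = w := by simp [hW₀, h.tw]
  obtain ⟨φ, hφ, hφx, hφ1⟩ := exists_normalization hG hW₀s (by rw [hW₀x, h.ww])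
  set W : E → E := fun y => φ y • W₀ y with hW
  have hWs : ContDiffAt ℝ ∞ W x := hφ.smul hW₀s
  have hWx : W x = w := by simp [hW, hφx, hW₀x]
  set U₀ : E → E := fun y => u + G y (T y) u • T y - G y (W y) u • W y with hU₀
  have hU₀s : ContDiffAt ℝ ∞ U₀ x :=
    (contDiffAt_const.add ((contDiffAt_metric_apply hG hT contDiffAt_const).smul hT)).sub
      ((contDiffAt_metric_apply hG hWs contDiffAt_const).smul hWs)
  have hU₀x : U₀ x = u := by simp [hU₀, h.tu, hWx, h.wu]
  obtain ⟨ψ, hψ, hψx, hψ1⟩ := exists_normalization hG hU₀s (by rw [hU₀x, h.uu])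
  refine ⟨W, fun y => ψ y • U₀ y, hWs, hψ.smul hU₀s, hWx, by simp [hψx, hU₀x], ?_⟩
  filter_upwards [hTT, hφ1, hψ1, hG.symm] with y h1 h2 h3 h4
  have h5 : G y (T y) (W y) = 0 := by simp [hW, hW₀, h1]
  have h6 : G y (W y) (T y) = 0 := by rw [h4, h5]
  have h7 : G y (W y) (W y) = 1 := h2
  exact ⟨h1, h2, h3, h5, by simp [hU₀, h1, h5], by simp [hU₀, h6, h7]⟩

/-- The circle action in terms of an orthonormal frame: `y` is sent to
`f (T + cos θ w̄ + sin θ ū)`, where `-y / G(y,T) = T + w̄` and `w̄ = α W + β U`. -/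
noncomputable def frameRotation (G : E → E →L[ℝ] E →L[ℝ] ℝ) (f : E → ℝ) (T W U : E → E) (c s : ℝ)
    (n : E × E) : E :=
  f n.1 • (T n.1
    + (c * G n.1 (W n.1) (-(G n.1 n.2 (T n.1))⁻¹ • n.2)
      - s * G n.1 (U n.1) (-(G n.1 n.2 (T n.1))⁻¹ • n.2)) • W n.1
    + (c * G n.1 (U n.1) (-(G n.1 n.2 (T n.1))⁻¹ • n.2)
      + s * G n.1 (W n.1) (-(G n.1 n.2 (T n.1))⁻¹ • n.2)) • U n.1)

lemma contDiffAt_frameRotation (hG : IsMetricAt G x) {f : E → ℝ} {T W U : E → E} {y : E}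
    (hf : ContDiffAt ℝ ∞ f x) (hT : ContDiffAt ℝ ∞ T x) (hW : ContDiffAt ℝ ∞ W x)
    (hU : ContDiffAt ℝ ∞ U x) (hy : G x y (T x) ≠ 0) (c s : ℝ) :
    ContDiffAt ℝ ∞ (frameRotation G f T W U c s) (x, y) := by
  have h1 : ContDiffAt ℝ ∞ (Prod.fst : E × E → E) (x, y) := contDiffAt_fst
  have h2 : ContDiffAt ℝ ∞ (Prod.snd : E × E → E) (x, y) := contDiffAt_snd
  have hG' := hG.smooth.comp (x, y) h1
  have hf' := hf.comp (x, y) h1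
  have hT' := hT.comp (x, y) h1
  have hW' := hW.comp (x, y) h1
  have hU' := hU.comp (x, y) h1
  have hσ := ((((hG'.clm_apply h2).clm_apply hT').inv hy).neg).smul h2
  have hα := (hG'.clm_apply hW').clm_apply hσ
  have hβ := (hG'.clm_apply hU').clm_apply hσ
  exact hf'.smul ((hT'.add (((contDiffAt_const.mul hα).sub (contDiffAt_const.mul hβ)).smul hW')).add
    (((contDiffAt_const.mul hβ).add (contDiffAt_const.mul hα)).smul hU'))

/-- How the covariant derivative of the circle action changes the component along the fibre. -/
lemma inner_covDeriv_frameRotation (hG : IsMetricAt G x) {f : E → ℝ} {T W U : E → E}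
    (hf : ContDiffAt ℝ ∞ f x) (hT : ContDiffAt ℝ ∞ T x) (hW : ContDiffAt ℝ ∞ W x)
    (hU : ContDiffAt ℝ ∞ U x) (hframe : ∀ᶠ y in 𝓝 x, IsLorentzTriple (G y) (T y) (W y) (U y))
    (hfx : f x ≠ 0) {c s : ℝ} (hcs : c ^ 2 + s ^ 2 = 1) {a : E} {γ Y : ℝ → E}
    (hγ : HasDerivAt γ a 0) (h0 : γ 0 = x) {y : E} (hY : HasCovDerivAlong G x a Y y)
    (hY0 : Y 0 = f x • (T x + W x)) {d t : E} (ht : HasCovDerivAlong G x a (T ∘ γ) t)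
    (hd : HasCovDerivAlong G x a (fun r => frameRotation G f T W U c s (γ r, Y r)) d) :
    G x (c • U x - s • W x) d = G x (U x) y + f x * ((c - 1) * G x (U x) t - s * G x (W x) t) := by
  subst h0
  have hx := hframe.self_of_nhds
  have hev : ∀ᶠ r in 𝓝 (0 : ℝ), IsLorentzTriple (G (γ r)) (T (γ r)) (W (γ r)) (U (γ r)) :=
    (hγ.continuousAt.tendsto.eventually hframe : _)
  have hcurve : ∀ {Z : E → E}, ContDiffAt ℝ ∞ Z (γ 0) →
      ∃ z, HasCovDerivAlong G (γ 0) a (Z ∘ γ) z := by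
    intro Z hZ
    have h1 := (hZ.differentiableAt (by simp)).hasFDerivAt
    exact ⟨_, .of_hasDerivAt (h1.comp_hasDerivAt 0 hγ)⟩
  obtain ⟨w, hw⟩ := hcurve hW
  obtain ⟨u, hu⟩ := hcurve hU
  obtain ⟨f', hf'⟩ : ∃ f', HasDerivAt (f ∘ γ) f' 0 := by
    have h1 := (hf.differentiableAt (by simp)).hasFDerivAt
    exact ⟨_, h1.comp_hasDerivAt 0 hγ⟩
  have hconst : ∀ {φ : ℝ → ℝ} {φ' k : ℝ}, HasDerivAt φ φ' 0 → (∀ᶠ r in 𝓝 (0 : ℝ), φ r = k) →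
      φ' = 0 := fun h1 h2 => h1.unique ((hasDerivAt_const 0 _).congr_of_eventuallyEq h2)
  -- The connection matrix of an orthonormal frame is skew for the metric. The relation `e1` trades
  -- the derivative of `U` for that of `T`; it is the source of the -1 in the factor c - 1.
  have e1 := hconst (ht.inner hG hγ rfl hu) (hev.mono fun r h => h.tu)
  have e2 := hconst (hw.inner hG hγ rfl hu) (hev.mono fun r h => h.wu)
  have e3 := hconst (hw.inner hG hγ rfl hw) (hev.mono fun r h => h.ww)
  have e4 := hconst (hu.inner hG hγ rfl hu) (hev.mono fun r h => h.uu)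
  have hWT : G (γ 0) (W (γ 0)) (T (γ 0)) = 0 := by rw [hG.symm_apply, hx.tw]
  have hUT : G (γ 0) (U (γ 0)) (T (γ 0)) = 0 := by rw [hG.symm_apply, hx.tu]
  have hUW : G (γ 0) (U (γ 0)) (W (γ 0)) = 0 := by rw [hG.symm_apply, hx.wu]
  have hyT : G (γ 0) (Y 0) (T (γ 0)) = -f (γ 0) := by
    simp only [hY0, map_add, map_smul, _root_.add_apply, _root_.smul_apply, smul_eq_mul,
      hx.tt, hWT]
    ring
  -- The value of h' is immaterial: in the derivative of the `U`-component it multiplies `Y 0`,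
  -- which is orthogonal to `U`.
  obtain ⟨h', hden⟩ : ∃ h', HasDerivAt (fun r => -(G (γ r) (Y r) (T (γ r)))⁻¹) h' 0 :=
    ⟨_, ((hY.inner hG hγ rfl ht).inv (by simpa [hyT] using hfx)).neg⟩
  have hinv : -(G (γ 0) (Y 0) (T (γ 0)))⁻¹ = (f (γ 0))⁻¹ := by rw [hyT, inv_neg, neg_neg]
  have hσ0 : (f (γ 0))⁻¹ • Y 0 = T (γ 0) + W (γ 0) := by
    rw [hY0, smul_smul, inv_mul_cancel₀ hfx, one_smul]
  have hσ := hY.smul hG hden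
  -- The value of α' is immaterial too: c α' W + s α' U is orthogonal to c U - s W.
  obtain ⟨α', hα⟩ : ∃ α', HasDerivAt (fun r => G (γ r) (W (γ r))
    (-(G (γ r) (Y r) (T (γ r)))⁻¹ • Y r)) α' 0 := ⟨_, hw.inner hG hγ rfl hσ⟩
  have hβ := hu.inner hG hγ rfl hσ
  obtain ⟨β', hβ', hβ⟩ : ∃ β', f (γ 0) * β'
      = f (γ 0) * (G (γ 0) u (T (γ 0)) + G (γ 0) u (W (γ 0))) + G (γ 0) (U (γ 0)) y ∧
      HasDerivAt (fun r => G (γ r) (U (γ r)) (-(G (γ r) (Y r) (T (γ r)))⁻¹ • Y r)) β' 0 := by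
    refine ⟨_, ?_, hβ⟩
    simp only [Function.comp_apply, hinv, hσ0]
    simp only [hY0, map_add, map_smul, smul_eq_mul, hUT, hUW]
    field_simp
    ring
  have hd' := HasCovDerivAlong.smul hG hf' ((ht.add hG
    (hw.smul hG ((hα.const_mul c).sub (hβ.const_mul s)))).add hG
    (hu.smul hG ((hβ.const_mul c).add (hα.const_mul s))))
  rw [hd.unique hd']
  simp only [Function.comp_apply, Pi.add_apply, Pi.sub_apply, hinv, hσ0] at e1 e2 e3 e4 ⊢
  simp only [map_add, map_sub,
    map_smul, smul_eq_mul, _root_.sub_apply, _root_.smul_apply, hUT, hUW, hWT, hx.wu, hx.ww, hx.uu]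
  rw [hG.symm_apply u (T (γ 0)), hG.symm_apply u (W (γ 0))] at hβ'
  rw [hG.symm_apply t] at e1
  rw [hG.symm_apply w] at e2 e3
  rw [hG.symm_apply u] at e4
  set At := G (γ 0) (U (γ 0)) t
  set Bt := G (γ 0) (W (γ 0)) t
  set Uw := G (γ 0) (U (γ 0)) w
  set Wu := G (γ 0) (W (γ 0)) u
  set Ww := G (γ 0) (W (γ 0)) w
  set Uu := G (γ 0) (U (γ 0)) u
  set Tu := G (γ 0) (T (γ 0)) u
  set Uy := G (γ 0) (U (γ 0)) y
  set F := f (γ 0)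
  -- The relation `hβ'` replaces F β', `e1` replaces the product of `T` with the derivative of `U`,
  -- `e2`, `e3` and `e4` remove the connection coefficients between `W` and `U`, and `hcs` turns the
  -- remaining factor c² + s² into 1.
  linear_combination (c ^ 2 + s ^ 2) * hβ' + (c ^ 2 + s ^ 2) * F * e1 + F * c ^ 2 * e2
    - F * c * s / 2 * e3 + F * c * s / 2 * e4 + (Uy - F * At) * hcs

end LocalFrame
-- Charts of the tangent bundle and coordinate changes.
section Charts

variable {E : Type*} [NormedAddCommGroup E] [NormedSpace ℝ E]
  {M : Type*} [TopologicalSpace M] [ChartedSpace E M] [IsManifold 𝓘(ℝ, E) ∞ M]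

/-- The chart of `TM` induced by the preferred chart of `M` at `p`. -/
noncomputable def chartTM (p : M) (w : TangentBundle 𝓘(ℝ, E) M) : E × E :=
  (extChartAt 𝓘(ℝ, E) p w.proj, (trivializationAt E (TangentSpace 𝓘(ℝ, E) : M → Type _) p w).2)

/-- The chart of TM at `v` depends on `v` only through its base point, so results on charts of TM
apply to `chartTM`. -/
lemma extChartAt_tangent (v : TangentBundle 𝓘(ℝ, E) M) :
    ⇑(extChartAt 𝓘(ℝ, E).tangent v) = chartTM v.proj := by
  ext w <;> simp [chartTM, extChartAt, FiberBundle.chartedSpace_chartAt]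

lemma mem_extChartAt_tangent_source {v w : TangentBundle 𝓘(ℝ, E) M}
    (hw : w.proj ∈ (chartAt E v.proj).source) : w ∈ (extChartAt 𝓘(ℝ, E).tangent v).source := by
  rw [extChartAt_source]
  simpa using hw

lemma contMDiffAt_chartTM {p : M} {w : TangentBundle 𝓘(ℝ, E) M}
    (hw : w.proj ∈ (chartAt E p).source) :
    ContMDiffAt 𝓘(ℝ, E).tangent 𝓘(ℝ, E × E) ∞ (chartTM p) w := by
  have h := contMDiffAt_extChartAt' (I := 𝓘(ℝ, E).tangent) (n := ∞)
    (x := (⟨p, 0⟩ : TangentBundle 𝓘(ℝ, E) M)) (x' := w)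
    (by simpa using hw)
  rwa [extChartAt_tangent] at h

lemma mdifferentiableAt_chartTM {p : M} {w : TangentBundle 𝓘(ℝ, E) M}
    (hw : w.proj ∈ (chartAt E p).source) :
    MDifferentiableAt 𝓘(ℝ, E).tangent 𝓘(ℝ, E × E) (chartTM p) w :=
  (contMDiffAt_chartTM hw).mdifferentiableAt (by simp)

lemma isInvertible_mfderiv_chartTM {p : M} {w : TangentBundle 𝓘(ℝ, E) M}
    (hw : w.proj ∈ (chartAt E p).source) :
    (mfderiv 𝓘(ℝ, E).tangent 𝓘(ℝ, E × E) (chartTM p) w).IsInvertible := by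
  have h := isInvertible_mfderiv_extChartAt (I := 𝓘(ℝ, E).tangent)
    (x := (⟨p, 0⟩ : TangentBundle 𝓘(ℝ, E) M)) (y := w)
    (mem_extChartAt_tangent_source hw)
  rwa [extChartAt_tangent] at h

/-- The isomorphism of `T_q M` with the model space given by the chart at `p`. -/
noncomputable abbrev toModel (p q : M) : TangentSpace 𝓘(ℝ, E) q →L[ℝ] E :=
  (trivializationAt E (TangentSpace 𝓘(ℝ, E) : M → Type _) p).continuousLinearMapAt ℝ q

/-- The inverse of `toModel`. -/
noncomputable abbrev ofModel (p q : M) : E →L[ℝ] TangentSpace 𝓘(ℝ, E) q :=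
  (trivializationAt E (TangentSpace 𝓘(ℝ, E) : M → Type _) p).symmL ℝ q

lemma ofModel_toModel {p q : M} (hq : q ∈ (chartAt E p).source) (v : TangentSpace 𝓘(ℝ, E) q) :
    ofModel p q (toModel p q v) = v :=
  Bundle.Trivialization.symmL_continuousLinearMapAt _ (by simpa using hq) v

lemma toModel_ofModel {p q : M} (hq : q ∈ (chartAt E p).source) (v : E) :
    toModel p q (ofModel p q v) = v :=
  Bundle.Trivialization.continuousLinearMapAt_symmL _ (by simpa using hq) v

lemma trivializationAt_snd {p q : M} (hq : q ∈ (chartAt E p).source) (v : TangentSpace 𝓘(ℝ, E) q) :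
    (trivializationAt E (TangentSpace 𝓘(ℝ, E) : M → Type _) p ⟨q, v⟩).2 = toModel p q v := by
  rw [Bundle.Trivialization.continuousLinearMapAt_apply, Bundle.Trivialization.linearMapAt_apply,
    if_pos (by simpa using hq)]

/-- The tangent space at `p` is the model space itself, identified through the preferred chart at
`p`, whose differential at `p` is therefore the identity. -/
lemma toModel_self (p : M) (v : TangentSpace 𝓘(ℝ, E) p) : toModel p p v = v := by
  rw [toModel, TangentBundle.continuousLinearMapAt_trivializationAt (by simp),
    mfderiv_extChartAt_self]
  rfl

lemma chartTM_mk {p q : M} (hq : q ∈ (chartAt E p).source) (v : TangentSpace 𝓘(ℝ, E) q) :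
    chartTM p (⟨q, v⟩ : TangentBundle 𝓘(ℝ, E) M) = (extChartAt 𝓘(ℝ, E) p q, toModel p q v) := by
  rw [← trivializationAt_snd hq]; rfl

/-- The coordinate change from the chart at `p` to the chart at `q`. -/
noncomputable def transition (p q : M) : E → E :=
  extChartAt 𝓘(ℝ, E) q ∘ (extChartAt 𝓘(ℝ, E) p).symm

lemma contDiffAt_transition {p q r : M} (hp : r ∈ (chartAt E p).source)
    (hq : r ∈ (chartAt E q).source) :
    ContDiffAt ℝ ∞ (transition p q) (extChartAt 𝓘(ℝ, E) p r) := by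
  have h' : extChartAt 𝓘(ℝ, E) p r ∈
      ((extChartAt 𝓘(ℝ, E) p).symm ≫ (extChartAt 𝓘(ℝ, E) q)).source := by
    rw [PartialEquiv.trans_source'', PartialEquiv.symm_symm, PartialEquiv.symm_target]
    exact Set.mem_image_of_mem _ (by simp [hp, hq])
  have := contDiffWithinAt_ext_coord_change (n := ∞) (I := 𝓘(ℝ, E)) q p h'
  simpa [contDiffWithinAt_univ, transition] using this

lemma fderiv_transition_apply {p q r : M} (hp : r ∈ (chartAt E p).source)
    (hq : r ∈ (chartAt E q).source) (v : E) :
    fderiv ℝ (transition p q) (extChartAt 𝓘(ℝ, E) p r) v = toModel q r (ofModel p r v) := by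
  have h1 : fderiv ℝ (transition p q) (extChartAt 𝓘(ℝ, E) p r)
      = tangentCoordChange 𝓘(ℝ, E) p q r := by
    rw [tangentCoordChange_def]
    simp [transition]
  rw [h1, toModel, ofModel, TangentBundle.continuousLinearMapAt_trivializationAt_eq_core hq,
    TangentBundle.symmL_trivializationAt_eq_core hp]
  exact (tangentCoordChange_comp (by simp [hp, hq])).symm

lemma mfderiv_chartTM_fst {p : M} {w : TangentBundle 𝓘(ℝ, E) M}
    (hw : w.proj ∈ (chartAt E p).source) (ξ : TangentSpace 𝓘(ℝ, E).tangent w) :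
    (mfderiv 𝓘(ℝ, E).tangent 𝓘(ℝ, E × E) (chartTM p) w ξ).1 = toModel p w.proj (dproj w ξ) := by
  have h1 : (fun n : E × E => n.1) ∘ chartTM p
      = extChartAt 𝓘(ℝ, E) p ∘ (Bundle.TotalSpace.proj : TangentBundle 𝓘(ℝ, E) M → M) := rfl
  have h2 := mfderiv_comp_apply w (I' := 𝓘(ℝ, E)) (I'' := 𝓘(ℝ, E)) (mdifferentiableAt_extChartAt hw)
    (Bundle.mdifferentiableAt_proj (TangentSpace 𝓘(ℝ, E) : M → Type _) (p := w)) ξ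
  have h3 := mfderiv_comp_apply w (I' := 𝓘(ℝ, E × E)) (I'' := 𝓘(ℝ, E)) (g := (fun n : E × E => n.1))
    differentiableAt_fst.mdifferentiableAt (mdifferentiableAt_chartTM hw) ξ
  rw [h1, mfderiv_eq_fderiv, fderiv_fst] at h3
  rw [toModel, TangentBundle.continuousLinearMapAt_trivializationAt hw]
  exact h3.symm.trans h2

/-- Reduces derivatives of functions on TM to derivatives on `E × E`. -/
lemma hasMFDerivAt_of_chartTM {F : Type*} [NormedAddCommGroup F] [NormedSpace ℝ F] {p : M}
    {w : TangentBundle 𝓘(ℝ, E) M} (hw : w.proj ∈ (chartAt E p).source)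
    {f : TangentBundle 𝓘(ℝ, E) M → F} {h : E × E → F} {h' : E × E →L[ℝ] F}
    (hh : HasFDerivAt h h' (chartTM p w)) (hf : f =ᶠ[𝓝 w] h ∘ chartTM p) :
    MDifferentiableAt 𝓘(ℝ, E).tangent 𝓘(ℝ, F) f w ∧
      ∀ ξ, mfderiv 𝓘(ℝ, E).tangent 𝓘(ℝ, F) f w ξ
        = h' (mfderiv 𝓘(ℝ, E).tangent 𝓘(ℝ, E × E) (chartTM p) w ξ) := by
  have hd := (hh.hasMFDerivAt.comp w
    (mdifferentiableAt_chartTM hw).hasMFDerivAt).congr_of_eventuallyEq hf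
  refine ⟨hd.mdifferentiableAt, fun ξ => ?_⟩
  rw [hd.mfderiv]
  rfl

end Charts
-- The metric, vector fields and the connection map in an arbitrary chart.
section Connector

variable {E : Type*} [NormedAddCommGroup E] [NormedSpace ℝ E]
  {M : Type*} [TopologicalSpace M] [ChartedSpace E M] [IsManifold 𝓘(ℝ, E) ∞ M]

lemma metricInChart_apply (g : LorentzianMetric E M) {p q : M} (hq : q ∈ (chartAt E p).source)
    (b c : E) : metricInChart g p (extChartAt 𝓘(ℝ, E) p q) b c
      = g.val q (ofModel p q b) (ofModel p q c) := by
  have h : (extChartAt 𝓘(ℝ, E) p).symm (extChartAt 𝓘(ℝ, E) p q) = q :=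
    (extChartAt 𝓘(ℝ, E) p).left_inv (by simpa using hq)
  unfold metricInChart
  generalize (extChartAt 𝓘(ℝ, E) p).symm (extChartAt 𝓘(ℝ, E) p q) = r at *
  subst h
  rfl

lemma metricInChart_toModel (g : LorentzianMetric E M) {p q : M} (hq : q ∈ (chartAt E p).source)
    (v w : TangentSpace 𝓘(ℝ, E) q) :
    metricInChart g p (extChartAt 𝓘(ℝ, E) p q) (toModel p q v) (toModel p q w) = g.val q v w := by
  rw [metricInChart_apply g hq, ofModel_toModel hq, ofModel_toModel hq]

-- Carries a local property of points of M over to the model space, where every coordinate vector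
-- near that of `q` comes from a point near `q`.
omit [IsManifold 𝓘(ℝ, E) ∞ M] in
lemma eventually_extChartAt_symm {p q : M} (hq : q ∈ (chartAt E p).source) {P : M → Prop}
    (h : ∀ᶠ r in 𝓝 q, P r) :
    ∀ᶠ y in 𝓝 (extChartAt 𝓘(ℝ, E) p q), ∃ r, r ∈ (chartAt E p).source ∧
      extChartAt 𝓘(ℝ, E) p r = y ∧ P r := by
  have hq' : q ∈ (extChartAt 𝓘(ℝ, E) p).source := by simpa using hq
  have h1 : Filter.Tendsto (extChartAt 𝓘(ℝ, E) p).symm (𝓝 (extChartAt 𝓘(ℝ, E) p q)) (𝓝 q) := by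
    have := continuousAt_extChartAt_symm' hq'
    rwa [ContinuousAt, (extChartAt 𝓘(ℝ, E) p).left_inv hq'] at this
  filter_upwards [h1.eventually h, extChartAt_target_mem_nhds' (I := 𝓘(ℝ, E))
    ((extChartAt 𝓘(ℝ, E) p).map_source hq')] with y h2 h3
  exact ⟨_, by simpa using (extChartAt 𝓘(ℝ, E) p).map_target h3,
    (extChartAt 𝓘(ℝ, E) p).right_inv h3, h2⟩

/-- A smooth vector field in the chart at `p`. -/
noncomputable def fieldInChart (X : ∀ q : M, TangentSpace 𝓘(ℝ, E) q) (p : M) (y : E) : E :=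
  toModel p ((extChartAt 𝓘(ℝ, E) p).symm y) (X ((extChartAt 𝓘(ℝ, E) p).symm y))

lemma fieldInChart_apply (X : ∀ q : M, TangentSpace 𝓘(ℝ, E) q) {p q : M}
    (hq : q ∈ (chartAt E p).source) :
    fieldInChart X p (extChartAt 𝓘(ℝ, E) p q) = toModel p q (X q) := by
  have h : (extChartAt 𝓘(ℝ, E) p).symm (extChartAt 𝓘(ℝ, E) p q) = q :=
    (extChartAt 𝓘(ℝ, E) p).left_inv (by simpa using hq)
  unfold fieldInChart
  rw [h]

lemma contDiffAt_comp_extChartAt_symm {F : Type*} [NormedAddCommGroup F] [NormedSpace ℝ F]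
    {f : M → F} {p q : M} (hq : q ∈ (chartAt E p).source)
    (hf : ContMDiffAt 𝓘(ℝ, E) 𝓘(ℝ, F) ∞ f q) :
    ContDiffAt ℝ ∞ (f ∘ (extChartAt 𝓘(ℝ, E) p).symm) (extChartAt 𝓘(ℝ, E) p q) := by
  have hq' : q ∈ (extChartAt 𝓘(ℝ, E) p).source := by simpa using hq
  have h1 : ContMDiffAt 𝓘(ℝ, E) 𝓘(ℝ, E) ∞ (extChartAt 𝓘(ℝ, E) p).symm (extChartAt 𝓘(ℝ, E) p q) :=
    (contMDiffOn_extChartAt_symm p).contMDiffAt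
      (extChartAt_target_mem_nhds' ((extChartAt 𝓘(ℝ, E) p).map_source hq'))
  rw [← contMDiffAt_iff_contDiffAt]
  refine ContMDiffAt.comp _ ?_ h1
  rwa [(extChartAt 𝓘(ℝ, E) p).left_inv hq']

lemma contDiffAt_fieldInChart {X : ∀ q : M, TangentSpace 𝓘(ℝ, E) q} {p q : M}
    (hq : q ∈ (chartAt E p).source)
    (hX : ContMDiffAt 𝓘(ℝ, E) 𝓘(ℝ, E).tangent ∞
      (fun r => (⟨r, X r⟩ : TangentBundle 𝓘(ℝ, E) M)) q) :
    ContDiffAt ℝ ∞ (fieldInChart X p) (extChartAt 𝓘(ℝ, E) p q) := by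
  have h1 := (((trivializationAt E (TangentSpace 𝓘(ℝ, E) : M → Type _) p).contMDiffAt_iff
    (by simpa using hq)).1 hX).2
  refine (contDiffAt_comp_extChartAt_symm hq h1).congr_of_eventuallyEq ?_
  filter_upwards [eventually_extChartAt_symm hq (P := fun _ => True) (by simp)]
    with y ⟨r, hr, hry, _⟩
  subst hry
  rw [fieldInChart_apply X hr, Function.comp_apply,
    (extChartAt 𝓘(ℝ, E) p).left_inv (by simpa using hr), trivializationAt_snd hr]

lemma contMDiffAt_ofModel {p q : M} (hq : q ∈ (chartAt E p).source) (b : E) :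
    ContMDiffAt 𝓘(ℝ, E) 𝓘(ℝ, E).tangent ∞
      (fun r => (⟨r, ofModel p r b⟩ : TangentBundle 𝓘(ℝ, E) M)) q := by
  rw [(trivializationAt E (TangentSpace 𝓘(ℝ, E) : M → Type _) p).contMDiffAt_iff
    (by simpa using hq)]
  refine ⟨contMDiffAt_id, contMDiffAt_const (c := b) |>.congr_of_eventuallyEq ?_⟩
  filter_upwards [(chartAt E p).open_source.mem_nhds hq] with r hr
  rw [trivializationAt_snd hr, toModel_ofModel hr]

lemma contMDiffAt_metric_apply (g : LorentzianMetric E M) {X Y : ∀ q : M, TangentSpace 𝓘(ℝ, E) q}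
    {q : M} (hX : ContMDiffAt 𝓘(ℝ, E) 𝓘(ℝ, E).tangent ∞
      (fun r => (⟨r, X r⟩ : TangentBundle 𝓘(ℝ, E) M)) q)
    (hY : ContMDiffAt 𝓘(ℝ, E) 𝓘(ℝ, E).tangent ∞
      (fun r => (⟨r, Y r⟩ : TangentBundle 𝓘(ℝ, E) M)) q) :
    ContMDiffAt 𝓘(ℝ, E) 𝓘(ℝ, ℝ) ∞ (fun r => g.val r (X r) (Y r)) q := by
  have h := ContMDiffAt.clm_bundle_apply₂ (E₃ := fun _ : M => ℝ) (F₃ := ℝ) (b := fun r : M => r)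
    (ψ := g.val) (g.contMDiff q) hX hY
  exact (Bundle.contMDiffAt_section q).1 h

/-- Nondegeneracy: up to sign, the products with an orthonormal basis are the coordinates of `v`. -/
lemma LorentzianMetric.eq_zero (g : LorentzianMetric E M) {q : M} {v : TangentSpace 𝓘(ℝ, E) q}
    (h : ∀ w, g.val q v w = 0) : v = 0 := by
  obtain ⟨b, hb⟩ := g.signature q
  apply b.ext_elem
  intro j
  have h3 : g.form q v (b j) = 0 := h (b j)
  rw [IsLorentzBasis.apply (B := g.form q) hb] at h3
  fin_cases j <;> simpa [Finsupp.single_apply] using h3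

lemma isInvertible_metricInChart [FiniteDimensional ℝ E] (g : LorentzianMetric E M) {p q : M}
    (hq : q ∈ (chartAt E p).source) :
    (metricInChart g p (extChartAt 𝓘(ℝ, E) p q)).IsInvertible := by
  have hinj : Function.Injective (metricInChart g p (extChartAt 𝓘(ℝ, E) p q)).toLinearMap := by
    rw [injective_iff_map_eq_zero]
    intro v hv
    have h2 : ofModel p q v = 0 := by
      refine g.eq_zero fun w => ?_
      have := DFunLike.congr_fun hv (toModel p q w)
      rw [← ofModel_toModel hq w, ← metricInChart_apply g hq]
      exact this
    rw [← toModel_ofModel hq v, h2, map_zero]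
  have hdim : Module.finrank ℝ E = Module.finrank ℝ (E →L[ℝ] ℝ) := by
    rw [← (LinearMap.toContinuousLinearMap (E := E) (F' := ℝ) (𝕜 := ℝ)).finrank_eq]
    exact Subspace.dual_finrank_eq.symm
  exact ⟨(LinearEquiv.ofInjectiveOfFinrankEq _ hinj hdim).toContinuousLinearEquiv, by ext; rfl⟩

lemma contDiffAt_metricInChart [FiniteDimensional ℝ E] (g : LorentzianMetric E M) {p q : M}
    (hq : q ∈ (chartAt E p).source) :
    ContDiffAt ℝ ∞ (metricInChart g p) (extChartAt 𝓘(ℝ, E) p q) := by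
  have hq' : q ∈ (extChartAt 𝓘(ℝ, E) p).source := by simpa using hq
  refine ContDiffOn.contDiffAt (s := (extChartAt 𝓘(ℝ, E) p).target) ?_
    (extChartAt_target_mem_nhds' ((extChartAt 𝓘(ℝ, E) p).map_source hq'))
  -- In finite dimension it is enough to check the coefficients, which are products of the
  -- coordinate fields `ofModel p · b`.
  rw [contDiffOn_clm_apply]
  intro b
  rw [contDiffOn_clm_apply]
  intro c y hy
  have hr : (extChartAt 𝓘(ℝ, E) p).symm y ∈ (chartAt E p).source := by
    simpa using (extChartAt 𝓘(ℝ, E) p).map_target hy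
  have h := contDiffAt_comp_extChartAt_symm hr
    (contMDiffAt_metric_apply g (contMDiffAt_ofModel hr b) (contMDiffAt_ofModel hr c))
  rw [(extChartAt 𝓘(ℝ, E) p).right_inv hy] at h
  exact h.contDiffWithinAt

lemma isMetricAt_metricInChart [FiniteDimensional ℝ E] (g : LorentzianMetric E M) {p q : M}
    (hq : q ∈ (chartAt E p).source) :
    IsMetricAt (metricInChart g p) (extChartAt 𝓘(ℝ, E) p q) where
  smooth := contDiffAt_metricInChart g hq
  symm := by
    filter_upwards [eventually_extChartAt_symm hq (P := fun _ => True) (by simp)]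
      with y ⟨r, hr, hry, _⟩ b c
    subst hry
    rw [metricInChart_apply g hr, metricInChart_apply g hr, g.symm]
  invertible := isInvertible_metricInChart g hq

/-- The connection map in the chart at `p`. -/
lemma toModel_connector [FiniteDimensional ℝ E] (g : LorentzianMetric E M) {p : M}
    {w : TangentBundle 𝓘(ℝ, E) M} (hw : w.proj ∈ (chartAt E p).source)
    (ξ : TangentSpace 𝓘(ℝ, E).tangent w) :
    toModel p w.proj (connector g w ξ)
      = (mfderiv 𝓘(ℝ, E).tangent 𝓘(ℝ, E × E) (chartTM p) w ξ).2
        + christoffelSymbol (metricInChart g p) (extChartAt 𝓘(ℝ, E) p w.proj)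
          (toModel p w.proj (dproj w ξ)) (toModel p w.proj w.2) := by
  set q := w.proj with hq
  set x := extChartAt 𝓘(ℝ, E) p q with hx
  set n : E × E := mfderiv 𝓘(ℝ, E).tangent 𝓘(ℝ, E × E) (chartTM p) w ξ with hn
  have hqq : q ∈ (chartAt E q).source := by simp
  have hτ := contDiffAt_transition hw hqq
  have hτx : transition p q x = extChartAt 𝓘(ℝ, E) q q := by
    simp only [transition, Function.comp_apply, hx]
    rw [(extChartAt 𝓘(ℝ, E) p).left_inv (by simpa using hw)]
  have hD : ∀ v : TangentSpace 𝓘(ℝ, E) q, fderiv ℝ (transition p q) x (toModel p q v) = v := by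
    intro v
    rw [fderiv_transition_apply hw hqq, ofModel_toModel hw, toModel_self]
  have hD' : ∀ v : E, fderiv ℝ (transition p q) x v = ofModel p q v := by
    intro v
    conv_lhs => rw [← toModel_ofModel hw v, hD]
  -- The connection map is defined through the preferred chart at `q`, the base point of `w`. The
  -- transformation law compares it with the chart at `p`.
  have htr := (isMetricAt_metricInChart g hw).christoffelSymbol_transform
    (G' := metricInChart g q) (τ := transition p q) (hτx ▸ isMetricAt_metricInChart g hqq) hτ
    (fun v => ⟨toModel p q v, hD v⟩) (by
      filter_upwards [eventually_extChartAt_symm hw ((chartAt E q).open_source.mem_nhds hqq)]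
        with y ⟨r, hr, hry, hr'⟩ b c
      subst hry
      have h1 : transition p q (extChartAt 𝓘(ℝ, E) p r) = extChartAt 𝓘(ℝ, E) q r := by
        simp only [transition, Function.comp_apply]
        rw [(extChartAt 𝓘(ℝ, E) p).left_inv (by simpa using hr)]
      rw [h1, fderiv_transition_apply hr hr', fderiv_transition_apply hr hr',
        metricInChart_toModel g hr', metricInChart_apply g hr]) n.1 (toModel p q w.2)
  -- The components in the chart at `q` are those in the chart at `p`, moved by the differential of
  -- the coordinate change. Differentiating this produces the second derivative of the coordinate
  -- change that occurs in `htr`.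
  have hcomp : (fun w' : TangentBundle 𝓘(ℝ, E) M =>
      (trivializationAt E (TangentSpace 𝓘(ℝ, E) : M → Type _) q w').2) =ᶠ[𝓝 w]
      (fun m : E × E => fderiv ℝ (transition p q) m.1 m.2) ∘ chartTM p := by
    have h1 : ∀ᶠ w' : TangentBundle 𝓘(ℝ, E) M in 𝓝 w, w'.proj ∈ (chartAt E p).source ∧
        w'.proj ∈ (chartAt E q).source :=
      (FiberBundle.continuous_proj E (TangentSpace 𝓘(ℝ, E) : M → Type _)).continuousAt.eventually
        (Filter.inter_mem ((chartAt E p).open_source.mem_nhds hw)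
          ((chartAt E q).open_source.mem_nhds hqq))
    filter_upwards [h1] with ⟨r, v⟩ ⟨h2, h3⟩
    rw [Function.comp_apply, chartTM_mk h2, fderiv_transition_apply h2 h3, ofModel_toModel h2,
      trivializationAt_snd h3]
  have hchart : chartTM p w = (x, toModel p q w.2) := chartTM_mk hw w.2
  have hmap := ((hτ.fderiv_right (m := 1) (by norm_cast)).differentiableAt (by simp)).hasFDerivAt
  have hmap2 : HasFDerivAt (fun m : E × E => fderiv ℝ (transition p q) m.1 m.2) _ (chartTM p w) :=
    HasFDerivAt.clm_apply (HasFDerivAt.comp (chartTM p w) (g := fderiv ℝ (transition p q))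
      (f := Prod.fst) (by rw [hchart]; exact hmap) hasFDerivAt_fst) hasFDerivAt_snd
  have hmf := (hasMFDerivAt_of_chartTM hw hmap2 hcomp).2 ξ
  have hn1 : n.1 = toModel p q (dproj w ξ) := mfderiv_chartTM_fst hw ξ
  have hconn : connector g w ξ = fderiv ℝ (fderiv ℝ (transition p q)) x n.1 (toModel p q w.2)
      + fderiv ℝ (transition p q) x n.2
      + christoffelSymbol (metricInChart g q) (extChartAt 𝓘(ℝ, E) q q) (dproj w ξ) w.2 := by
    have h1 : connector g w ξ = @HAdd.hAdd E E E _
      (mfderiv 𝓘(ℝ, E).tangent 𝓘(ℝ, E) (fun w' : TangentBundle 𝓘(ℝ, E) M =>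
        (trivializationAt E (TangentSpace 𝓘(ℝ, E) : M → Type _) q w').2) w ξ)
      (christoffelSymbol (metricInChart g q) (extChartAt 𝓘(ℝ, E) q q) (dproj w ξ) w.2) := rfl
    rw [h1, hmf]
    congr 1
    rw [← hn, hchart]
    simp
    abel
  rw [hτx, hn1, hD, hD] at htr
  rw [hn1] at hconn
  have h5 : connector g w ξ = fderiv ℝ (transition p q) x
      (n.2 + christoffelSymbol (metricInChart g p) x (toModel p q (dproj w ξ))
          (toModel p q w.2)) := by
    rw [map_add, htr, hconn]
    abel
  rw [h5, hD', toModel_ofModel hw]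

end Connector
-- Tangent vectors of TM as pairs (dπ ξ, c ξ), and the tangent space of the null congruence.
section LevelMap

variable {E : Type*} [NormedAddCommGroup E] [NormedSpace ℝ E] [FiniteDimensional ℝ E]
  {M : Type*} [TopologicalSpace M] [ChartedSpace E M] [IsManifold 𝓘(ℝ, E) ∞ M]

omit [FiniteDimensional ℝ E] in
lemma eventually_proj_mem_source {p : M} {w : TangentBundle 𝓘(ℝ, E) M}
    (hw : w.proj ∈ (chartAt E p).source) :
    ∀ᶠ w' : TangentBundle 𝓘(ℝ, E) M in 𝓝 w, w'.proj ∈ (chartAt E p).source :=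
  (FiberBundle.continuous_proj E (TangentSpace 𝓘(ℝ, E) : M → Type _)).continuousAt.eventually
    ((chartAt E p).open_source.mem_nhds hw)

/-- A tangent vector of `TM` is represented by a curve in the chart at `p`. -/
lemma exists_curve (g : LorentzianMetric E M) {p : M} {w : TangentBundle 𝓘(ℝ, E) M}
    (hw : w.proj ∈ (chartAt E p).source) (ξ : TangentSpace 𝓘(ℝ, E).tangent w) :
    ∃ γ Y : ℝ → E, HasDerivAt γ (toModel p w.proj (dproj w ξ)) 0 ∧
      γ 0 = extChartAt 𝓘(ℝ, E) p w.proj ∧ Y 0 = toModel p w.proj w.2 ∧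
      HasCovDerivAlong (metricInChart g p) (extChartAt 𝓘(ℝ, E) p w.proj)
        (toModel p w.proj (dproj w ξ)) Y (toModel p w.proj (connector g w ξ)) ∧
      HasDerivAt (fun t => (γ t, Y t))
        (mfderiv 𝓘(ℝ, E).tangent 𝓘(ℝ, E × E) (chartTM p) w ξ : E × E) 0 := by
  set n : E × E := mfderiv 𝓘(ℝ, E).tangent 𝓘(ℝ, E × E) (chartTM p) w ξ with hn
  have h1 : n.1 = toModel p w.proj (dproj w ξ) := mfderiv_chartTM_fst hw ξ
  have hlin : ∀ x y : E, HasDerivAt (fun t : ℝ => x + t • y) y 0 := fun x y => by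
    simpa using ((hasDerivAt_id (0 : ℝ)).smul_const y).const_add x
  -- A straight line in the chart of TM suffices.
  have h2 := hlin (extChartAt 𝓘(ℝ, E) p w.proj) n.1
  have h3 := hlin (toModel p w.proj w.2) n.2
  refine ⟨_, _, h1 ▸ h2, by simp, by simp, ?_, h2.prodMk h3⟩
  rw [toModel_connector g hw ξ, ← hn]
  convert HasCovDerivAlong.of_hasDerivAt h3 using 1
  simp

omit [FiniteDimensional ℝ E] in
/-- The derivative of a function on `TM` along a curve in the chart at `p`. -/
lemma hasDerivAt_of_curve {F : Type*} [NormedAddCommGroup F] [NormedSpace ℝ F] {p : M}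
    {w : TangentBundle 𝓘(ℝ, E) M} (hw : w.proj ∈ (chartAt E p).source)
    {ξ : TangentSpace 𝓘(ℝ, E).tangent w} {γ Y : ℝ → E}
    (h0 : γ 0 = extChartAt 𝓘(ℝ, E) p w.proj) (hY0 : Y 0 = toModel p w.proj w.2)
    (hγ : HasDerivAt (fun t => (γ t, Y t))
        (mfderiv 𝓘(ℝ, E).tangent 𝓘(ℝ, E × E) (chartTM p) w ξ : E × E) 0)
    {f : TangentBundle 𝓘(ℝ, E) M → F} {h : E × E → F} (hh : DifferentiableAt ℝ h (chartTM p w))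
    (hf : f =ᶠ[𝓝 w] h ∘ chartTM p) :
    HasDerivAt (fun t => h (γ t, Y t)) (mfderiv 𝓘(ℝ, E).tangent 𝓘(ℝ, F) f w ξ) 0 := by
  have hw0 : chartTM p w = (γ 0, Y 0) := by rw [h0, hY0]; exact chartTM_mk hw w.2
  rw [(hasMFDerivAt_of_chartTM hw hh.hasFDerivAt hf).2 ξ]
  have h1 := hh.hasFDerivAt
  rw [hw0] at h1 ⊢
  exact h1.comp_hasDerivAt 0 hγ

/-- The covariant derivative of a vector field in the chart at `p`. -/
noncomputable def covDerivInChart (g : LorentzianMetric E M) (X : ∀ q : M, TangentSpace 𝓘(ℝ, E) q)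
    (p : M) (x a : E) : E :=
  fderiv ℝ (fieldInChart X p) x a + christoffelSymbol (metricInChart g p) x a (fieldInChart X p x)

omit [FiniteDimensional ℝ E] in
lemma hasCovDerivAlong_fieldInChart (g : LorentzianMetric E M)
    {X : ∀ q : M, TangentSpace 𝓘(ℝ, E) q} {p : M} {x a : E}
    (hX : ContDiffAt ℝ ∞ (fieldInChart X p) x)
    {γ : ℝ → E} (hγ : HasDerivAt γ a 0) (h0 : γ 0 = x) :
    HasCovDerivAlong (metricInChart g p) x a (fieldInChart X p ∘ γ)
      (covDerivInChart g X p x a) := by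
  subst h0
  exact .of_hasDerivAt ((hX.differentiableAt (by simp)).hasFDerivAt.comp_hasDerivAt 0 hγ)

/-- The linear form `a ↦ g(y, ∇_a K)` in the chart at `p`, at the vector `y` at `x`. -/
noncomputable def nablaForm (g : LorentzianMetric E M) (K : ∀ q : M, TangentSpace 𝓘(ℝ, E) q)
    (p : M) (n : E × E) : E →ₗ[ℝ] ℝ where
  toFun a := metricInChart g p n.1 n.2 (covDerivInChart g K p n.1 a)
  map_add' a b := by
    simp only [covDerivInChart, map_add, christoffelSymbol_add]
    ring
  map_smul' r a := by
    simp only [covDerivInChart, map_smul, map_add, christoffelSymbol_smul, smul_eq_mul,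
      RingHom.id_apply]
    ring

omit [FiniteDimensional ℝ E] in
lemma metricInChart_chartTM (g : LorentzianMetric E M) {p : M} {w : TangentBundle 𝓘(ℝ, E) M}
    (hw : w.proj ∈ (chartAt E p).source) (b : E) :
    metricInChart g p (chartTM p w).1 (chartTM p w).2 b
      = g.val w.proj w.2 (ofModel p w.proj b) := by
  have h : chartTM p w = _ := chartTM_mk hw w.2
  rw [h, metricInChart_apply g hw, ofModel_toModel hw]

omit [FiniteDimensional ℝ E] in
lemma fieldInChart_chartTM {X : ∀ q : M, TangentSpace 𝓘(ℝ, E) q} {p : M}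
    {w : TangentBundle 𝓘(ℝ, E) M} (hw : w.proj ∈ (chartAt E p).source) :
    fieldInChart X p (chartTM p w).1 = toModel p w.proj (X w.proj) :=
  fieldInChart_apply X hw

/-- The differential of the map that cuts out the null congruence. -/
lemma mfderiv_levelMap (g : LorentzianMetric E M) {K : ∀ q : M, TangentSpace 𝓘(ℝ, E) q}
    (hK : ContMDiff 𝓘(ℝ, E) 𝓘(ℝ, E).tangent ∞
      (fun p => (⟨p, K p⟩ : TangentBundle 𝓘(ℝ, E) M)))
    {p : M} {w : TangentBundle 𝓘(ℝ, E) M} (hw : w.proj ∈ (chartAt E p).source) :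
    MDifferentiableAt 𝓘(ℝ, E).tangent 𝓘(ℝ, ℝ × ℝ) (levelMap g K) w ∧
    ∀ ξ, mfderiv 𝓘(ℝ, E).tangent 𝓘(ℝ, ℝ × ℝ) (levelMap g K) w ξ
      = ((g.val w.proj w.2 (connector g w ξ), g.val w.proj (connector g w ξ) (K w.proj)
        + nablaForm g K p (chartTM p w) (toModel p w.proj (dproj w ξ))) : ℝ × ℝ) := by
  have hwc : chartTM p w = (extChartAt 𝓘(ℝ, E) p w.proj, toModel p w.proj w.2) := chartTM_mk hw w.2
  have hG := isMetricAt_metricInChart g hw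
  have hX := contDiffAt_fieldInChart hw hK.contMDiffAt
  set h : E × E → ℝ × ℝ := fun n => (metricInChart g p n.1 n.2 n.2 / 2,
    metricInChart g p n.1 n.2 (fieldInChart K p n.1)) with hh
  have hdiff : DifferentiableAt ℝ h (chartTM p w) := by
    rw [hwc]
    set m := (extChartAt 𝓘(ℝ, E) p w.proj, toModel p w.proj w.2) with hm
    have h1 : DifferentiableAt ℝ (fun n : E × E => metricInChart g p n.1) m :=
      DifferentiableAt.comp m (g := metricInChart g p) (f := Prod.fst) hG.differentiableAt
        differentiableAt_fst
    have h2 : DifferentiableAt ℝ (fun n : E × E => fieldInChart K p n.1) m :=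
      DifferentiableAt.comp m (g := fieldInChart K p) (f := Prod.fst)
        (hX.differentiableAt (by simp)) differentiableAt_fst
    have h3 : DifferentiableAt ℝ (fun n : E × E => n.2) m := differentiableAt_snd
    have h4 : DifferentiableAt ℝ (fun n : E × E => metricInChart g p n.1 n.2 n.2) m :=
      (h1.clm_apply h3).clm_apply h3
    have h5 : DifferentiableAt ℝ (fun n : E × E => metricInChart g p n.1 n.2 n.2 / 2) m := by
      simpa only [div_eq_mul_inv] using h4.mul_const (2 : ℝ)⁻¹
    exact h5.prodMk ((h1.clm_apply h3).clm_apply h2)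
  have hev : levelMap g K =ᶠ[𝓝 w] h ∘ chartTM p := by
    filter_upwards [eventually_proj_mem_source hw] with w' hw'
    have hw2 : (chartTM p w').2 = toModel p w'.proj w'.2 := congrArg Prod.snd (chartTM_mk hw' w'.2)
    simp only [Function.comp_apply, hh, metricInChart_chartTM g hw', fieldInChart_chartTM hw']
    rw [ofModel_toModel hw', hw2, ofModel_toModel hw']
    rfl
  refine ⟨(hasMFDerivAt_of_chartTM hw hdiff.hasFDerivAt hev).1, fun ξ => ?_⟩
  -- Differentiating along a curve with velocity ξ lets `HasCovDerivAlong.inner` express both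
  -- components by covariant derivatives.
  obtain ⟨γ, Y, hγ, h0, hY0, hY, hγY⟩ := exists_curve g hw ξ
  have hd := hasDerivAt_of_curve hw h0 hY0 hγY hdiff hev
  have d1 := (hY.inner hG hγ h0 hY).div_const 2
  have d2 := hY.inner hG hγ h0 (hasCovDerivAlong_fieldInChart g hX hγ h0)
  refine (hd.unique (d1.prodMk d2)).trans (Prod.ext ?_ ?_)
  · simp only [hY0]
    rw [metricInChart_toModel g hw, metricInChart_toModel g hw, g.symm]
    ring
  · simp only [hY0, h0, Function.comp_apply, fieldInChart_apply K hw, hwc]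
    rw [metricInChart_toModel g hw]
    rfl

lemma mem_tangentNull_iff (g : LorentzianMetric E M) {K : ∀ q : M, TangentSpace 𝓘(ℝ, E) q}
    (hK : ContMDiff 𝓘(ℝ, E) 𝓘(ℝ, E).tangent ∞
      (fun p => (⟨p, K p⟩ : TangentBundle 𝓘(ℝ, E) M)))
    {p : M} {w : TangentBundle 𝓘(ℝ, E) M} (hw : w.proj ∈ (chartAt E p).source)
    (ξ : TangentSpace 𝓘(ℝ, E).tangent w) :
    ξ ∈ tangentNull g K w ↔ g.val w.proj w.2 (connector g w ξ) = 0 ∧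
      g.val w.proj (connector g w ξ) (K w.proj)
        + nablaForm g K p (chartTM p w) (toModel p w.proj (dproj w ξ)) = 0 := by
  have h := (mfderiv_levelMap g hK hw).2 ξ
  rw [tangentNull, LinearMap.mem_ker]
  change mfderiv 𝓘(ℝ, E).tangent 𝓘(ℝ, ℝ × ℝ) (levelMap g K) w ξ = (0 : ℝ × ℝ) ↔ _
  rw [h]
  exact Prod.ext_iff

/-- A tangent vector of `TM` is determined by its projection and its covariant part, which are
arbitrary. -/
lemma exists_tangent_vector (g : LorentzianMetric E M) (w : TangentBundle 𝓘(ℝ, E) M)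
    (a b : TangentSpace 𝓘(ℝ, E) w.proj) :
    ∃ ξ : TangentSpace 𝓘(ℝ, E).tangent w, dproj w ξ = a ∧ connector g w ξ = b := by
  have hw : w.proj ∈ (chartAt E w.proj).source := by simp
  obtain ⟨e, he⟩ := isInvertible_mfderiv_chartTM hw
  set n : E × E := (toModel w.proj w.proj a, toModel w.proj w.proj b
    - christoffelSymbol (metricInChart g w.proj) (extChartAt 𝓘(ℝ, E) w.proj w.proj)
        (toModel w.proj w.proj a) (toModel w.proj w.proj w.2))
  have hn : mfderiv 𝓘(ℝ, E).tangent 𝓘(ℝ, E × E) (chartTM w.proj) w (e.symm n) = n := by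
    rw [← he]
    exact e.apply_symm_apply n
  have h1 : dproj w (e.symm n) = a := by
    have := mfderiv_chartTM_fst hw (e.symm n)
    rw [hn, toModel_self] at this
    exact this.symm.trans (toModel_self _ a)
  refine ⟨e.symm n, h1, ?_⟩
  have := toModel_connector g hw (e.symm n)
  rw [hn, h1, sub_add_cancel, toModel_self, toModel_self] at this
  exact this

/-- In the chart the pair (dπ ξ, c ξ) is (n₁, n₂ + Γ(n₁, w)), a triangular change of the components
(n₁, n₂) of ξ. -/
lemma tangent_vector_ext (g : LorentzianMetric E M) {w : TangentBundle 𝓘(ℝ, E) M}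
    {ξ ζ : TangentSpace 𝓘(ℝ, E).tangent w} (h1 : dproj w ξ = dproj w ζ)
    (h2 : connector g w ξ = connector g w ζ) : ξ = ζ := by
  have hw : w.proj ∈ (chartAt E w.proj).source := by simp
  obtain ⟨e, he⟩ := isInvertible_mfderiv_chartTM hw
  have h3 := toModel_connector g hw ξ
  rw [h2, toModel_connector g hw ζ, h1] at h3
  have h4 := (mfderiv_chartTM_fst hw ξ).trans
    ((congrArg _ h1).trans (mfderiv_chartTM_fst hw ζ).symm)
  have h5 := Prod.ext h4 (add_right_cancel h3).symm
  rw [← he] at h5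
  exact e.injective h5

/-- The covariant derivative of a vector field, in the preferred chart at the point. -/
lemma toModel_covDeriv (g : LorentzianMetric E M) {X : ∀ q : M, TangentSpace 𝓘(ℝ, E) q} {p : M}
    (hX : ContMDiffAt 𝓘(ℝ, E) 𝓘(ℝ, E).tangent ∞
      (fun r => (⟨r, X r⟩ : TangentBundle 𝓘(ℝ, E) M)) p) (u : TangentSpace 𝓘(ℝ, E) p) :
    toModel p p (covDeriv g X p u)
      = covDerivInChart g X p (extChartAt 𝓘(ℝ, E) p p) (toModel p p u) := by
  have hp : p ∈ (chartAt E p).source := by simp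
  have hXd := hX.mdifferentiableAt (by simp)
  set s : M → TangentBundle 𝓘(ℝ, E) M := fun r => ⟨r, X r⟩ with hs
  set ζ : TangentSpace 𝓘(ℝ, E).tangent (s p) := mfderiv 𝓘(ℝ, E) 𝓘(ℝ, E).tangent s p u with hζ
  have h1 : dproj (s p) ζ = u := by
    have h2 := mfderiv_comp_apply p (I' := 𝓘(ℝ, E).tangent) (I'' := 𝓘(ℝ, E))
      (Bundle.mdifferentiableAt_proj (TangentSpace 𝓘(ℝ, E) : M → Type _) (p := s p)) hXd u
    have h3 : (Bundle.TotalSpace.proj ∘ s) = id := rfl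
    rw [h3, mfderiv_id] at h2
    exact h2.symm
  have hf := contDiffAt_fieldInChart hp hX
  have h2 : (mfderiv 𝓘(ℝ, E).tangent 𝓘(ℝ, E × E) (chartTM p) (s p) ζ).2
      = fderiv ℝ (fieldInChart X p) (extChartAt 𝓘(ℝ, E) p p) (toModel p p u) := by
    have h3 := mfderiv_comp_apply p (I' := 𝓘(ℝ, E).tangent) (I'' := 𝓘(ℝ, E × E))
      (mdifferentiableAt_chartTM (w := s p) hp) hXd u
    have h4 : chartTM p ∘ s =ᶠ[𝓝 p] (fun y => (y, fieldInChart X p y)) ∘ extChartAt 𝓘(ℝ, E) p := by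
      filter_upwards [(chartAt E p).open_source.mem_nhds hp] with r hr
      simp only [hs, Function.comp_apply, chartTM_mk hr, fieldInChart_apply X hr]
    have h5 := ((hasFDerivAt_id _).prodMk
      (hf.differentiableAt (by simp)).hasFDerivAt).hasMFDerivAt.comp p
      (mdifferentiableAt_extChartAt (I := 𝓘(ℝ, E)) hp).hasMFDerivAt
    rw [(h5.congr_of_eventuallyEq h4).mfderiv] at h3
    rw [toModel, TangentBundle.continuousLinearMapAt_trivializationAt hp]
    exact (congrArg Prod.snd h3).symm
  have h3 := toModel_connector g (w := s p) hp ζ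
  rw [h2, h1] at h3
  rw [covDerivInChart, fieldInChart_apply X hp]
  exact h3

end LevelMap
-- Vertical space, horizontal space and Sasaki metric in an adapted frame.
section Fibre

variable {E : Type*} [NormedAddCommGroup E] [NormedSpace ℝ E]
  {M : Type*} [TopologicalSpace M] [ChartedSpace E M] [IsManifold 𝓘(ℝ, E) ∞ M]
  {g : LorentzianMetric E M} {K : ∀ q : M, TangentSpace 𝓘(ℝ, E) q}

section Triple

variable {q : M} {t w u : TangentSpace 𝓘(ℝ, E) q}

lemma IsLorentzTriple.exists_basis (h : IsLorentzTriple (g.val q) t w u) :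
    ∃ b : Module.Basis (Fin 3) ℝ (TangentSpace 𝓘(ℝ, E) q),
      b 0 = t ∧ b 1 = w ∧ b 2 = u ∧ IsLorentzBasis (g.form q) b := by
  have e1 : g.val q w t = 0 := by rw [g.symm, h.tw]
  have e2 : g.val q u t = 0 := by rw [g.symm, h.tu]
  have e3 : g.val q u w = 0 := by rw [g.symm, h.wu]
  have hli : LinearIndependent ℝ ![t, w, u] := by
    rw [Fintype.linearIndependent_iff]
    intro c hc
    simp only [Fin.sum_univ_three, Matrix.cons_val] at hc
    have h0 := congrArg (g.val q t) hc
    have h1 := congrArg (g.val q w) hc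
    have h2 := congrArg (g.val q u) hc
    simp only [map_add, map_smul, map_zero, smul_eq_mul, h.tt, h.tw, h.tu, e1, h.ww, h.wu, e2, e3,
      h.uu] at h0 h1 h2
    intro i
    fin_cases i <;> simp <;> linarith
  obtain ⟨b, -⟩ := g.signature q
  have hcard : Fintype.card (Fin 3) = Module.finrank ℝ (TangentSpace 𝓘(ℝ, E) q) :=
    (Module.finrank_eq_card_basis b).symm
  refine ⟨basisOfLinearIndependentOfCardEqFinrank hli hcard, by simp, by simp, by simp, ?_⟩
  intro i j
  rw [coe_basisOfLinearIndependentOfCardEqFinrank]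
  change g.val q _ _ = _
  fin_cases i <;> fin_cases j <;> simp [h.tt, h.tw, h.tu, e1, h.ww, h.wu, e2, e3, h.uu]

lemma IsLorentzTriple.expand (h : IsLorentzTriple (g.val q) t w u) (x : TangentSpace 𝓘(ℝ, E) q) :
    x = -(g.val q t x) • t + g.val q w x • w + g.val q u x • u := by
  obtain ⟨b, rfl, rfl, rfl, hb⟩ := h.exists_basis
  have hx : ∀ i, g.val q (b i) x = if i = 0 then -b.repr x 0 else b.repr x i := by
    intro i
    have := hb.apply (b i) x
    rw [show g.val q (b i) x = g.form q (b i) x from rfl, this]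
    fin_cases i <;> simp
  refine (b.sum_repr x).symm.trans ?_
  rw [Fin.sum_univ_three]
  simp [hx]

lemma IsLorentzTriple.inner_eq (h : IsLorentzTriple (g.val q) t w u)
    (x y : TangentSpace 𝓘(ℝ, E) q) :
    g.val q x y = -(g.val q t x * g.val q t y) + g.val q w x * g.val q w y
      + g.val q u x * g.val q u y := by
  conv_lhs => rw [h.expand x]
  simp

/-- A rotated frame. -/
lemma IsLorentzTriple.rotate (h : IsLorentzTriple (g.val q) t w u) {c s : ℝ}
    (hcs : c ^ 2 + s ^ 2 = 1) :
    IsLorentzTriple (g.val q) t (c • w + s • u) (c • u - s • w) := by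
  have e3 : g.val q u w = 0 := by rw [g.symm, h.wu]
  constructor <;> simp only [map_add, map_sub, map_smul, _root_.add_apply, _root_.sub_apply,
    _root_.smul_apply, smul_eq_mul, h.tt, h.tw, h.tu, h.ww, h.wu, h.uu, e3] <;> linarith

end Triple

variable {v : TangentBundle 𝓘(ℝ, E) M}

/-- A frame adapted to a vector of the null congruence. -/
lemma exists_adapted_frame (hKt : ∀ p, g.val p (K p) (K p) < 0) (o : ManifoldOrientation E M)
    (hv : v ∈ nullCongruence g K) :
    ∃ w u : TangentSpace 𝓘(ℝ, E) v.proj,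
      IsLorentzTriple (g.val v.proj) (unitField g K v.proj) w u ∧
      IsQuarterTurn (g.form v.proj) (o.fibre v.proj) (unitField g K v.proj) w u ∧
      v.2 = normFactor g K v.proj • (unitField g K v.proj + w) := by
  obtain ⟨b, hb⟩ := g.signature v.proj
  obtain ⟨h1, h2, h3⟩ := sigma_spec hKt hv
  have ht := form_unitField (g := g) hKt v.proj
  set σ := -(g.val v.proj v.2 (unitField g K v.proj))⁻¹ • v.2
  set t := unitField g K v.proj
  have hs : g.form v.proj σ t = -1 := (g.symm _ _ _).trans h2
  have htw : g.form v.proj t (σ - t) = 0 := by rw [map_sub, h2, ht, sub_self]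
  have hww : g.form v.proj (σ - t) (σ - t) = 1 := by
    simp only [map_sub, LinearMap.sub_apply, h2, h3, hs, ht]
    norm_num
  have hq := quarterTurn_spec (B := g.form v.proj) hb (o.fibre v.proj) ht htw
  refine ⟨σ - t, _, ⟨ht, hww, hq.2.2.1.trans hww, htw, hq.1, hq.2.1⟩, hq, ?_⟩
  rw [add_sub_cancel, h1]

variable [FiniteDimensional ℝ E] {w u : TangentSpace 𝓘(ℝ, E) v.proj}
  {ξ ζ : TangentSpace 𝓘(ℝ, E).tangent v}

omit [FiniteDimensional ℝ E] in
lemma normFactor_smul_inner (g : LorentzianMetric E M) (K : ∀ q : M, TangentSpace 𝓘(ℝ, E) q)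
    (q : M) (x : TangentSpace 𝓘(ℝ, E) q) :
    normFactor g K q * g.val q x (K q) = g.val q x (unitField g K q) := by
  rw [unitField, map_smul, smul_eq_mul]

lemma inner_add_of_mem_tangentNull (hK : ContMDiff 𝓘(ℝ, E) 𝓘(ℝ, E).tangent ∞
      (fun p => (⟨p, K p⟩ : TangentBundle 𝓘(ℝ, E) M)))
    (hKt : ∀ p, g.val p (K p) (K p) < 0)
    (hvw : v.2 = normFactor g K v.proj • (unitField g K v.proj + w)) (hξ : ξ ∈ tangentNull g K v) :
    g.val v.proj (unitField g K v.proj) (connector g v ξ)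
      + g.val v.proj w (connector g v ξ) = 0 := by
  have h := ((mem_tangentNull_iff g hK (p := v.proj) (by simp) ξ).1 hξ).1
  rw [hvw, map_smul, map_add, _root_.smul_apply, _root_.add_apply, smul_eq_mul] at h
  exact (mul_eq_zero.1 h).resolve_left (normFactor_pos hKt _).ne'

/-- When dπ ζ = 0 the term with ∇K drops out of the tangency condition, so c ζ is orthogonal to K
and to v, hence to 𝒯 and w, and only its u-component is left. -/
lemma mem_vertical_iff (hK : ContMDiff 𝓘(ℝ, E) 𝓘(ℝ, E).tangent ∞
      (fun p => (⟨p, K p⟩ : TangentBundle 𝓘(ℝ, E) M)))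
    (hKt : ∀ p, g.val p (K p) (K p) < 0)
    (hvw : v.2 = normFactor g K v.proj • (unitField g K v.proj + w))
    (h : IsLorentzTriple (g.val v.proj) (unitField g K v.proj) w u) :
    ζ ∈ vertical g K v ↔ dproj v ζ = 0 ∧
      connector g v ζ = g.val v.proj u (connector g v ζ) • u := by
  have hf := (normFactor_pos hKt v.proj).ne'
  have hmem := mem_tangentNull_iff g hK (p := v.proj) (by simp) ζ
  have hker : ζ ∈ vertical g K v ↔ ζ ∈ tangentNull g K v ∧ dproj v ζ = 0 := Iff.rfl
  rw [hker]
  constructor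
  · rintro ⟨h1, h2⟩
    refine ⟨h2, ?_⟩
    have h3 := inner_add_of_mem_tangentNull hK hKt hvw h1
    have h4 := (hmem.1 h1).2
    rw [h2, map_zero, map_zero, add_zero] at h4
    have h5 := normFactor_smul_inner g K v.proj (connector g v ζ)
    rw [h4, mul_zero, g.symm] at h5
    rw [← h5, zero_add] at h3
    conv_lhs => rw [h.expand (connector g v ζ), h3, ← h5]
    simp
  · rintro ⟨h1, h2⟩
    refine ⟨hmem.2 ⟨?_, ?_⟩, h1⟩
    · rw [hvw, h2]
      simp [h.tu, h.wu]
    · rw [h1, map_zero, map_zero, add_zero]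
      have h5 := normFactor_smul_inner g K v.proj (connector g v ζ)
      rw [h2] at h5 ⊢
      have h6 : g.val v.proj u (unitField g K v.proj) = 0 := by rw [g.symm, h.tu]
      simp only [map_smul, _root_.smul_apply, smul_eq_mul, h6, mul_zero] at h5 ⊢
      exact (mul_eq_zero.1 h5).resolve_left hf

/-- The vertical line is spanned by the vector with dπ = 0 and c = u, whose Sasaki product with ξ is
g(u, c ξ). -/
lemma mem_horizontal_iff (hK : ContMDiff 𝓘(ℝ, E) 𝓘(ℝ, E).tangent ∞
      (fun p => (⟨p, K p⟩ : TangentBundle 𝓘(ℝ, E) M)))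
    (hKt : ∀ p, g.val p (K p) (K p) < 0)
    (hvw : v.2 = normFactor g K v.proj • (unitField g K v.proj + w))
    (h : IsLorentzTriple (g.val v.proj) (unitField g K v.proj) w u) :
    ξ ∈ horizontal g K v ↔ ξ ∈ tangentNull g K v ∧ g.val v.proj u (connector g v ξ) = 0 := by
  have hor : ξ ∈ horizontal g K v ↔ ξ ∈ tangentNull g K v ∧
    ∀ ζ ∈ vertical g K v, sasaki g v ζ ξ = 0 := Iff.rfl
  rw [hor, and_congr_right_iff]
  intro _
  constructor
  · intro h1
    obtain ⟨ζ, h2, h3⟩ := exists_tangent_vector g v 0 u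
    have h4 := h1 ζ ((mem_vertical_iff hK hKt hvw h).2 ⟨h2, by rw [h3, h.uu, one_smul]⟩)
    rw [sasaki_apply, h2, h3] at h4
    simpa using h4
  · intro h1 ζ hζ
    obtain ⟨h2, h3⟩ := (mem_vertical_iff hK hKt hvw h).1 hζ
    rw [sasaki_apply, h2, h3]
    simp [h1]

/-- For tangent vectors, g(𝒯, c ξ) = -g(w, c ξ) and likewise for ζ. As 𝒯 and w have squares -1 and
1, their contributions to g(c ξ, c ζ) cancel. -/
lemma sasaki_eq_of_mem_tangentNull (hK : ContMDiff 𝓘(ℝ, E) 𝓘(ℝ, E).tangent ∞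
      (fun p => (⟨p, K p⟩ : TangentBundle 𝓘(ℝ, E) M)))
    (hKt : ∀ p, g.val p (K p) (K p) < 0)
    (hvw : v.2 = normFactor g K v.proj • (unitField g K v.proj + w))
    (h : IsLorentzTriple (g.val v.proj) (unitField g K v.proj) w u)
    (hξ : ξ ∈ tangentNull g K v) (hζ : ζ ∈ tangentNull g K v) :
    sasaki g v ξ ζ = g.val v.proj (dproj v ξ) (dproj v ζ)
      + g.val v.proj u (connector g v ξ) * g.val v.proj u (connector g v ζ) := by
  have h1 := inner_add_of_mem_tangentNull hK hKt hvw hξ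
  have h2 := inner_add_of_mem_tangentNull hK hKt hvw hζ
  rw [sasaki_apply, h.inner_eq (connector g v ξ)]
  linear_combination (g.val v.proj w (connector g v ζ)) * h1 -
    (g.val v.proj (unitField g K v.proj) (connector g v ξ)) * h2

/-- The horizontal space is the graph of the form `a ↦ g(v, ∇_a K) v`. -/
lemma mem_horizontal_iff_connector (hK : ContMDiff 𝓘(ℝ, E) 𝓘(ℝ, E).tangent ∞
      (fun p => (⟨p, K p⟩ : TangentBundle 𝓘(ℝ, E) M)))
    (hKt : ∀ p, g.val p (K p) (K p) < 0) (hv : v ∈ nullCongruence g K)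
    (hvw : v.2 = normFactor g K v.proj • (unitField g K v.proj + w))
    (h : IsLorentzTriple (g.val v.proj) (unitField g K v.proj) w u)
    {p : M} (hp : v.proj ∈ (chartAt E p).source) :
    ξ ∈ horizontal g K v ↔ connector g v ξ
      = nablaForm g K p (chartTM p v) (toModel p v.proj (dproj v ξ)) • v.2 := by
  have hf := (normFactor_pos hKt v.proj).ne'
  rw [mem_horizontal_iff hK hKt hvw h]
  have hmem := mem_tangentNull_iff g hK hp ξ
  set N := nablaForm g K p (chartTM p v) (toModel p v.proj (dproj v ξ))
  set t := unitField g K v.proj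
  constructor
  · rintro ⟨h1, h2⟩
    have h3 := inner_add_of_mem_tangentNull hK hKt hvw h1
    have h4 := (hmem.1 h1).2
    have h5 := normFactor_smul_inner g K v.proj (connector g v ξ)
    rw [g.symm _ (connector g v ξ) (unitField g K v.proj)] at h5
    -- Tangency gives g(c ξ, K) = -N, which fixes the 𝒯-component, and nullity fixes the w-component
    -- as its opposite.
    have h6 : g.val v.proj t (connector g v ξ) = -(N * normFactor g K v.proj) := by
      rw [← h5]; linear_combination normFactor g K v.proj * h4
    have h7 : g.val v.proj w (connector g v ξ) = N * normFactor g K v.proj := by linarith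
    rw [h.expand (connector g v ξ), h2, h6, h7, hvw]
    module
  · intro h1
    refine ⟨hmem.2 ⟨?_, ?_⟩, ?_⟩
    · rw [h1, map_smul, hv.1, smul_zero]
    · rw [h1, map_smul, _root_.smul_apply, hv.2]
      simp
    · have e2 : g.val v.proj u t = 0 := by rw [g.symm, h.tu]
      have e3 : g.val v.proj u w = 0 := by rw [g.symm, h.wu]
      rw [h1, hvw]
      simp [e2, e3]

end Fibre
-- The circle action in a smooth oriented frame.
section LocalAction

variable {E : Type*} [NormedAddCommGroup E] [NormedSpace ℝ E]
  {M : Type*} [TopologicalSpace M] [ChartedSpace E M] [IsManifold 𝓘(ℝ, E) ∞ M]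
  {g : LorentzianMetric E M} {K : ∀ q : M, TangentSpace 𝓘(ℝ, E) q}

lemma contMDiff_normFactor (hK : ContMDiff 𝓘(ℝ, E) 𝓘(ℝ, E).tangent ∞
      (fun p => (⟨p, K p⟩ : TangentBundle 𝓘(ℝ, E) M)))
    (hKt : ∀ p, g.val p (K p) (K p) < 0) :
    ContMDiff 𝓘(ℝ, E) 𝓘(ℝ, ℝ) ∞ (normFactor g K) := by
  intro p
  have h1 := contMDiffAt_metric_apply g (hK p) (hK p)
  have h2 : ContDiffAt ℝ ∞ (fun r : ℝ => 1 / √(-r)) (g.val p (K p) (K p)) := by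
    have h3 : (-(g.val p (K p) (K p))) ≠ 0 := by have := hKt p; linarith
    exact contDiffAt_const.div (contDiffAt_id.neg.sqrt h3)
      (Real.sqrt_ne_zero'.2 (neg_pos.2 (hKt p)))
  exact ContMDiffAt.comp (I' := 𝓘(ℝ, ℝ)) p (g := fun r : ℝ => 1 / √(-r)) h2.contMDiffAt h1

lemma contMDiff_unitField (hK : ContMDiff 𝓘(ℝ, E) 𝓘(ℝ, E).tangent ∞
      (fun p => (⟨p, K p⟩ : TangentBundle 𝓘(ℝ, E) M)))
    (hKt : ∀ p, g.val p (K p) (K p) < 0) :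
    ContMDiff 𝓘(ℝ, E) 𝓘(ℝ, E).tangent ∞
      (fun p => (⟨p, unitField g K p⟩ : TangentBundle 𝓘(ℝ, E) M)) :=
  ContMDiff.smul_section (contMDiff_normFactor hK hKt) hK

/-- The vector σ - t lies in the plane of w and u, and `IsQuarterTurn.combine` together with
uniqueness of the quarter turn shows how that plane is turned. -/
lemma rotate_eq {q : M} {o : Orientation ℝ (TangentSpace 𝓘(ℝ, E) q) (Fin 3)}
    {t w u σ : TangentSpace 𝓘(ℝ, E) q} (h : IsLorentzTriple (g.val q) t w u)
    (hq : IsQuarterTurn (g.form q) o t w u) (hσ : g.val q t σ = -1) (z : Circle) :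
    rotate (g.form q) o t z σ = t
      + ((z : ℂ).re * g.val q w σ - (z : ℂ).im * g.val q u σ) • w
      + ((z : ℂ).re * g.val q u σ + (z : ℂ).im * g.val q w σ) • u := by
  obtain ⟨b, hb⟩ := g.signature q
  have h1 : σ - t = g.val q w σ • w + g.val q u σ • u := by
    conv_lhs => rw [h.expand σ, hσ]
    module
  have h2 : g.form q t (g.val q w σ • w + g.val q u σ • u) = 0 := by
    change g.val q t _ = 0
    simp [h.tw, h.tu]
  rw [rotate, h1, quarterTurn_eq (B := g.form q) hb h.tt h2
    (hq.combine (B := g.form q) hb h.tt h.tw _ _)]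
  module

/-- The frame need not be adapted to `v`, nor `v` lie on C_KM. One smooth frame field thus describes
the action on a neighbourhood in TM, where it can be differentiated. -/
lemma circleAction_eq {o : ManifoldOrientation E M} {v : TangentBundle 𝓘(ℝ, E) M}
    {w u : TangentSpace 𝓘(ℝ, E) v.proj}
    (h : IsLorentzTriple (g.val v.proj) (unitField g K v.proj) w u)
    (hq : IsQuarterTurn (g.form v.proj) (o.fibre v.proj) (unitField g K v.proj) w u)
    (hv : g.val v.proj v.2 (unitField g K v.proj) ≠ 0) (z : Circle) :
    circleAction g o K z v = ⟨v.proj, normFactor g K v.proj • (unitField g K v.proj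
      + ((z : ℂ).re * g.val v.proj w (-(g.val v.proj v.2 (unitField g K v.proj))⁻¹ • v.2)
        - (z : ℂ).im * g.val v.proj u (-(g.val v.proj v.2 (unitField g K v.proj))⁻¹ • v.2)) • w
      + ((z : ℂ).re * g.val v.proj u (-(g.val v.proj v.2 (unitField g K v.proj))⁻¹ • v.2)
        + (z : ℂ).im * g.val v.proj w (-(g.val v.proj v.2 (unitField g K v.proj))⁻¹ • v.2)) • u)⟩ := by
  rw [circleAction, rotate_eq h hq]
  rw [map_smul, g.symm _ (unitField g K v.proj) v.2, smul_eq_mul]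
  field_simp

/-- The sign of the orientation of a continuous frame is locally constant. -/
lemma eventually_orientation [FiniteDimensional ℝ E] {o : Orientation ℝ E (Fin 3)} {x : E}
    {T W U : E → E} (hT : ContinuousAt T x) (hW : ContinuousAt W x) (hU : ContinuousAt U x)
    (h : ∃ b : Module.Basis (Fin 3) ℝ E, b 0 = T x ∧ b 1 = W x ∧ b 2 = U x ∧ b.orientation = o) :
    ∀ᶠ y in 𝓝 x, ∃ b : Module.Basis (Fin 3) ℝ E, b 0 = T y ∧ b 1 = W y ∧ b 2 = U y ∧
      b.orientation = o := by
  have h' := h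
  obtain ⟨b, -⟩ := h'
  -- The orientation condition becomes positivity of a continuous determinant, which is an open
  -- condition.
  obtain ⟨k, -, hk⟩ := exists_sign b o
  simp only [hk, det_vec] at h ⊢
  have hc : ∀ {X : E → E}, ContinuousAt X x → ∀ i, ContinuousAt (fun y => b.repr (X y) i) x :=
    fun hX i => (LinearMap.continuous_of_finiteDimensional (b.coord i)).continuousAt.comp hX
  have hcont : ContinuousAt (fun y => k * (b.repr (T y) 0 * (b.repr (W y) 1 * b.repr (U y) 2
        - b.repr (W y) 2 * b.repr (U y) 1)
      - b.repr (T y) 1 * (b.repr (W y) 0 * b.repr (U y) 2 - b.repr (W y) 2 * b.repr (U y) 0)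
      + b.repr (T y) 2 * (b.repr (W y) 0 * b.repr (U y) 1
        - b.repr (W y) 1 * b.repr (U y) 0))) x := by
    have t := hc hT
    have w := hc hW
    have u := hc hU
    exact continuousAt_const.mul ((((t 0).mul (((w 1).mul (u 2)).sub ((w 2).mul (u 1)))).sub
      ((t 1).mul (((w 0).mul (u 2)).sub ((w 2).mul (u 0))))).add
      ((t 2).mul (((w 0).mul (u 1)).sub ((w 1).mul (u 0)))))
  exact hcont.eventually (lt_mem_nhds h)

/-- Transport of oriented bases along an isomorphism. -/
lemma exists_oriented_basis_map {V V' : Type*} [AddCommGroup V] [Module ℝ V] [AddCommGroup V']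
    [Module ℝ V'] (e : V ≃ₗ[ℝ] V') {o : Orientation ℝ V (Fin 3)} {t w u : V}
    (h : ∃ b : Module.Basis (Fin 3) ℝ V, b 0 = t ∧ b 1 = w ∧ b 2 = u ∧ b.orientation = o) :
    ∃ b : Module.Basis (Fin 3) ℝ V', b 0 = e t ∧ b 1 = e w ∧ b 2 = e u ∧
      b.orientation = Orientation.map (Fin 3) e o := by
  obtain ⟨b, rfl, rfl, rfl, rfl⟩ := h
  exact ⟨b.map e, by simp, by simp, by simp, b.orientation_map e⟩

variable [FiniteDimensional ℝ E]

/-- The extension of a frame at a point to a smooth oriented frame near the point. -/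
lemma exists_local_frame (hK : ContMDiff 𝓘(ℝ, E) 𝓘(ℝ, E).tangent ∞
      (fun p => (⟨p, K p⟩ : TangentBundle 𝓘(ℝ, E) M)))
    (hKt : ∀ p, g.val p (K p) (K p) < 0) (o : ManifoldOrientation E M) {p : M}
    {w u : TangentSpace 𝓘(ℝ, E) p} (h : IsLorentzTriple (g.val p) (unitField g K p) w u)
    (hq : IsQuarterTurn (g.form p) (o.fibre p) (unitField g K p) w u) :
    ∃ W U : E → E, ContDiffAt ℝ ∞ W (extChartAt 𝓘(ℝ, E) p p) ∧
      ContDiffAt ℝ ∞ U (extChartAt 𝓘(ℝ, E) p p) ∧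
      W (extChartAt 𝓘(ℝ, E) p p) = toModel p p w ∧ U (extChartAt 𝓘(ℝ, E) p p) = toModel p p u ∧
      (∀ᶠ y in 𝓝 (extChartAt 𝓘(ℝ, E) p p),
        IsLorentzTriple (metricInChart g p y) (fieldInChart (unitField g K) p y) (W y) (U y)) ∧
      ∀ᶠ q in 𝓝 p, q ∈ (chartAt E p).source ∧
        IsLorentzTriple (g.val q) (unitField g K q) (ofModel p q (W (extChartAt 𝓘(ℝ, E) p q)))
          (ofModel p q (U (extChartAt 𝓘(ℝ, E) p q))) ∧
        IsQuarterTurn (g.form q) (o.fibre q) (unitField g K q)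
          (ofModel p q (W (extChartAt 𝓘(ℝ, E) p q))) (ofModel p q (U (extChartAt 𝓘(ℝ, E) p q))) := by
  have hp : p ∈ (chartAt E p).source := by simp
  set x := extChartAt 𝓘(ℝ, E) p p with hx
  have hG := isMetricAt_metricInChart g hp
  have hT := contDiffAt_fieldInChart hp (contMDiff_unitField hK hKt).contMDiffAt
  have hTx : fieldInChart (unitField g K) p x = toModel p p (unitField g K p) :=
    fieldInChart_apply _ hp
  have hTT : ∀ᶠ y in 𝓝 x, metricInChart g p y (fieldInChart (unitField g K) p y)
      (fieldInChart (unitField g K) p y) = -1 := by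
    filter_upwards [eventually_extChartAt_symm hp (P := fun _ => True) (by simp)]
      with y ⟨r, hr, hry, _⟩
    subst hry
    rw [fieldInChart_apply _ hr, metricInChart_toModel g hr]
    exact form_unitField hKt r
  have htr : IsLorentzTriple (metricInChart g p x) (fieldInChart (unitField g K) p x)
      (toModel p p w) (toModel p p u) := by
    rw [hTx]
    constructor <;> rw [metricInChart_toModel g hp]
    exacts [h.tt, h.ww, h.uu, h.tw, h.tu, h.wu]
  obtain ⟨W, U, hW, hU, hWx, hUx, hWU⟩ := exists_frame hG hT hTT htr
  refine ⟨W, U, hW, hU, hWx, hUx, hWU, ?_⟩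
  have hcont : ContinuousAt (extChartAt 𝓘(ℝ, E) p) p := continuousAt_extChartAt p
  obtain ⟨o₀, ho⟩ := o.locallyConstant p
  -- In the trivialization at `p` the orientation of M is the constant `o₀` near `p`, so
  -- orientedness of the frame spreads from `p` to nearby points.
  have hor : ∀ᶠ y in 𝓝 x, ∃ b : Module.Basis (Fin 3) ℝ E,
      b 0 = fieldInChart (unitField g K) p y ∧ b 1 = W y ∧ b 2 = U y ∧ b.orientation = o₀ := by
    refine eventually_orientation hT.continuousAt hW.continuousAt hU.continuousAt ?_
    obtain ⟨hb, ho⟩ := ho.self_of_nhds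
    have hw0 : w ≠ 0 := by
      rintro rfl
      simpa using h.ww
    have := exists_oriented_basis_map ((trivializationAt E (TangentSpace 𝓘(ℝ, E) : M → Type _)
        p).continuousLinearEquivAt ℝ p hb).toLinearEquiv (hq.2.2.2 hw0)
    rw [hTx, hWx, hUx, ← ho]
    simp only [← trivializationAt_snd hp]
    exact this
  filter_upwards [(chartAt E p).open_source.mem_nhds hp, hcont.eventually hWU, hcont.eventually hor,
    ho] with q hq h1 h2 ⟨hb, h3⟩
  have htri : IsLorentzTriple (g.val q) (unitField g K q)
      (ofModel p q (W (extChartAt 𝓘(ℝ, E) p q))) (ofModel p q (U (extChartAt 𝓘(ℝ, E) p q))) := by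
    have h4 : IsLorentzTriple (g.val q) (ofModel p q (fieldInChart (unitField g K) p
        (extChartAt 𝓘(ℝ, E) p q))) (ofModel p q (W (extChartAt 𝓘(ℝ, E) p q)))
        (ofModel p q (U (extChartAt 𝓘(ℝ, E) p q))) := by
      constructor <;> rw [← metricInChart_apply g hq]
      exacts [h1.tt, h1.ww, h1.uu, h1.tw, h1.tu, h1.wu]
    rwa [fieldInChart_apply _ hq, ofModel_toModel hq] at h4
  refine ⟨hq, htri, htri.tu, htri.wu, htri.uu.trans htri.ww.symm, fun _ => ?_⟩
  have h4 := exists_oriented_basis_map ((trivializationAt E (TangentSpace 𝓘(ℝ, E) : M → Type _)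
        p).continuousLinearEquivAt ℝ q hb).toLinearEquiv.symm h2
  rw [fieldInChart_apply _ hq, ← h3, ← Orientation.map_symm, Equiv.symm_apply_apply] at h4
  have h5 : ∀ y, ((trivializationAt E (TangentSpace 𝓘(ℝ, E) : M → Type _)
        p).continuousLinearEquivAt ℝ q hb).toLinearEquiv.symm y = ofModel p q y := by
    intro y
    rw [LinearEquiv.symm_apply_eq]
    exact ((trivializationAt_snd hq _).trans (toModel_ofModel hq y)).symm
  rwa [h5, h5, h5, ofModel_toModel hq] at h4

end LocalAction
-- The action in charts and its compatibility with the level map.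
section DiffAction

lemma re_sq_add_im_sq (z : Circle) : (z : ℂ).re ^ 2 + (z : ℂ).im ^ 2 = 1 := by
  have := Circle.normSq_coe z
  rw [Complex.normSq_apply] at this
  linarith

variable {E : Type*} [NormedAddCommGroup E] [NormedSpace ℝ E] [FiniteDimensional ℝ E]
  {M : Type*} [TopologicalSpace M] [ChartedSpace E M] [IsManifold 𝓘(ℝ, E) ∞ M]
  {g : LorentzianMetric E M} {K : ∀ q : M, TangentSpace 𝓘(ℝ, E) q}
  {v : TangentBundle 𝓘(ℝ, E) M} {w u : TangentSpace 𝓘(ℝ, E) v.proj}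

omit [FiniteDimensional ℝ E] in
lemma inner_unitField_of_adapted (h : IsLorentzTriple (g.val v.proj) (unitField g K v.proj) w u)
    (hvw : v.2 = normFactor g K v.proj • (unitField g K v.proj + w)) :
    g.val v.proj v.2 (unitField g K v.proj) = -normFactor g K v.proj := by
  have e : g.val v.proj w (unitField g K v.proj) = 0 := by rw [g.symm, h.tw]
  rw [hvw]
  simp [h.tt, e]

omit [FiniteDimensional ℝ E] in
lemma circleAction_of_adapted {o : ManifoldOrientation E M}
    (hKt : ∀ p, g.val p (K p) (K p) < 0)
    (h : IsLorentzTriple (g.val v.proj) (unitField g K v.proj) w u)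
    (hq : IsQuarterTurn (g.form v.proj) (o.fibre v.proj) (unitField g K v.proj) w u)
    (hvw : v.2 = normFactor g K v.proj • (unitField g K v.proj + w)) (z : Circle) :
    circleAction g o K z v = ⟨v.proj, normFactor g K v.proj • (unitField g K v.proj
      + ((z : ℂ).re • w + (z : ℂ).im • u))⟩ := by
  have hf := (normFactor_pos hKt v.proj).ne'
  have h1 := inner_unitField_of_adapted h hvw
  have h2 : -(g.val v.proj v.2 (unitField g K v.proj))⁻¹ • v.2 = unitField g K v.proj + w := by
    rw [h1, hvw, smul_smul]
    field_simp
    simp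
  rw [circleAction_eq h hq (by rw [h1]; exact neg_ne_zero.2 hf), h2]
  have e1 : g.val v.proj w (unitField g K v.proj) = 0 := by rw [g.symm, h.tw]
  have e2 : g.val v.proj u (unitField g K v.proj) = 0 := by rw [g.symm, h.tu]
  have e3 : g.val v.proj u w = 0 := by rw [g.symm, h.wu]
  simp [e1, e2, e3, h.ww, add_assoc]

omit [FiniteDimensional ℝ E] in
/-- The functions that cut out `C_K M`, after the circle action. -/
lemma levelMap_circleAction {o : ManifoldOrientation E M}
    (hKt : ∀ p, g.val p (K p) (K p) < 0)
    (h : IsLorentzTriple (g.val v.proj) (unitField g K v.proj) w u)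
    (hq : IsQuarterTurn (g.form v.proj) (o.fibre v.proj) (unitField g K v.proj) w u)
    (hv : g.val v.proj v.2 (unitField g K v.proj) ≠ 0) (z : Circle) :
    (levelMap g (unitField g K) v).2 ^ 2 * (levelMap g K (circleAction g o K z v)).1
      = normFactor g K v.proj ^ 2 * (levelMap g K v).1 ∧
    (levelMap g K (circleAction g o K z v)).2 = -1 := by
  have hf := (normFactor_pos hKt v.proj).ne'
  rw [circleAction_eq h hq hv]
  set σ := -(g.val v.proj v.2 (unitField g K v.proj))⁻¹ • v.2 with hσ
  have e1 : g.val v.proj w (unitField g K v.proj) = 0 := by rw [g.symm, h.tw]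
  have e2 : g.val v.proj u (unitField g K v.proj) = 0 := by rw [g.symm, h.tu]
  have e3 : g.val v.proj u w = 0 := by rw [g.symm, h.wu]
  have hz := re_sq_add_im_sq z
  have ht : g.val v.proj (unitField g K v.proj) σ = -1 := by
    rw [hσ, map_smul, g.symm _ (unitField g K v.proj) v.2, smul_eq_mul]
    field_simp
  have h1 := h.inner_eq σ σ
  rw [ht] at h1
  have h2 : g.val v.proj v.2 (unitField g K v.proj) ^ 2 * g.val v.proj σ σ
      = g.val v.proj v.2 v.2 := by
    rw [hσ]
    simp only [map_smul, _root_.smul_apply, smul_eq_mul]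
    field_simp
  generalize (z : ℂ).re = c at *
  generalize (z : ℂ).im = s at *
  generalize g.val v.proj w σ = α at *
  generalize g.val v.proj u σ = β at *
  constructor
  · simp only [levelMap, map_add, map_smul, _root_.add_apply, _root_.smul_apply, smul_eq_mul,
      h.tt, h.tw, h.tu, h.ww, h.wu, h.uu, e1, e2, e3]
    rw [← h2, h1]
    -- The image has square f² (-1 + (c² + s²)(α² + β²)), while σ has square -1 + α² + β².
    linear_combination (normFactor g K v.proj ^ 2 *
      (g.val v.proj v.2 (unitField g K v.proj)) ^ 2 / 2 * (α ^ 2 + β ^ 2)) * hz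
  · have h3 := normFactor_smul_inner g K v.proj (unitField g K v.proj
      + (c * α - s * β) • w + (c * β + s * α) • u)
    simp only [levelMap, map_smul, _root_.smul_apply, smul_eq_mul]
    rw [h3]
    simp [h.tt, e1, e2]

/-- Near a vector of the null congruence there are oriented frames that make the action explicit
in the chart. -/
lemma exists_local_action (hK : ContMDiff 𝓘(ℝ, E) 𝓘(ℝ, E).tangent ∞
      (fun p => (⟨p, K p⟩ : TangentBundle 𝓘(ℝ, E) M)))
    (hKt : ∀ p, g.val p (K p) (K p) < 0) (o : ManifoldOrientation E M)
    (h : IsLorentzTriple (g.val v.proj) (unitField g K v.proj) w u)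
    (hq : IsQuarterTurn (g.form v.proj) (o.fibre v.proj) (unitField g K v.proj) w u)
    (hvw : v.2 = normFactor g K v.proj • (unitField g K v.proj + w)) (z : Circle) :
    ∃ (f : E → ℝ) (W U : E → E), ContDiffAt ℝ ∞ f (extChartAt 𝓘(ℝ, E) v.proj v.proj) ∧
      ContDiffAt ℝ ∞ W (extChartAt 𝓘(ℝ, E) v.proj v.proj) ∧
      ContDiffAt ℝ ∞ U (extChartAt 𝓘(ℝ, E) v.proj v.proj) ∧
      f (extChartAt 𝓘(ℝ, E) v.proj v.proj) = normFactor g K v.proj ∧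
      W (extChartAt 𝓘(ℝ, E) v.proj v.proj) = toModel v.proj v.proj w ∧
      U (extChartAt 𝓘(ℝ, E) v.proj v.proj) = toModel v.proj v.proj u ∧
      (∀ᶠ y in 𝓝 (extChartAt 𝓘(ℝ, E) v.proj v.proj), IsLorentzTriple (metricInChart g v.proj y)
        (fieldInChart (unitField g K) v.proj y) (W y) (U y)) ∧
      (fun v' => (trivializationAt E (TangentSpace 𝓘(ℝ, E) : M → Type _) v.proj
        (circleAction g o K z v')).2) =ᶠ[𝓝 v]
        frameRotation (metricInChart g v.proj) f (fieldInChart (unitField g K) v.proj) W U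
          (z : ℂ).re (z : ℂ).im ∘ chartTM v.proj ∧
      ∀ᶠ v' in 𝓝 v, (levelMap g (unitField g K) v').2 ^ 2
          * (levelMap g K (circleAction g o K z v')).1
        = normFactor g K v'.proj ^ 2 * (levelMap g K v').1 ∧
        (levelMap g K (circleAction g o K z v')).2 = -1 := by
  have hp : v.proj ∈ (chartAt E v.proj).source := by simp
  obtain ⟨W, U, hW, hU, hWx, hUx, hWU, hfr⟩ := exists_local_frame hK hKt o h hq
  have hf : ContDiffAt ℝ ∞ (normFactor g K ∘ (extChartAt 𝓘(ℝ, E) v.proj).symm)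
      (extChartAt 𝓘(ℝ, E) v.proj v.proj) :=
    contDiffAt_comp_extChartAt_symm hp (contMDiff_normFactor hK hKt).contMDiffAt
  have hfapp : ∀ q ∈ (chartAt E v.proj).source, (normFactor g K ∘ (extChartAt 𝓘(ℝ, E) v.proj).symm)
      (extChartAt 𝓘(ℝ, E) v.proj q) = normFactor g K q := fun q hq => by
    rw [Function.comp_apply, (extChartAt 𝓘(ℝ, E) v.proj).left_inv (by simpa using hq)]
  have hproj : Filter.Tendsto (fun v' : TangentBundle 𝓘(ℝ, E) M => v'.proj) (𝓝 v) (𝓝 v.proj) :=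
    (FiberBundle.continuous_proj E (TangentSpace 𝓘(ℝ, E) : M → Type _)).continuousAt
  have hne : ∀ᶠ v' in 𝓝 v, g.val v'.proj v'.2 (unitField g K v'.proj) ≠ 0 := by
    have h1 := (mfderiv_levelMap g (contMDiff_unitField hK hKt) hp).1.continuousAt
    have h2 : ContinuousAt (fun v' => (levelMap g (unitField g K) v').2) v :=
      continuous_snd.continuousAt.comp h1
    refine h2.eventually_ne ?_
    change g.val v.proj v.2 (unitField g K v.proj) ≠ 0
    rw [inner_unitField_of_adapted h hvw]
    exact neg_ne_zero.2 (normFactor_pos hKt v.proj).ne'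
  refine ⟨_, W, U, hf, hW, hU, hfapp _ hp, hWx, hUx, hWU, ?_, ?_⟩
  · filter_upwards [hne, hproj.eventually hfr] with v' h1 ⟨h2, h3, h4⟩
    rw [circleAction_eq h3 h4 h1, trivializationAt_snd h2]
    have hc : chartTM v.proj v' = _ := chartTM_mk h2 v'.2
    rw [Function.comp_apply, hc]
    simp only [frameRotation]
    rw [hfapp _ h2, fieldInChart_apply _ h2, metricInChart_toModel g h2]
    simp only [map_smul, map_add, toModel_ofModel h2]
    have h5 : ∀ b : E, metricInChart g v.proj (extChartAt 𝓘(ℝ, E) v.proj v'.proj) b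
        (toModel v.proj v'.proj v'.2) = g.val v'.proj (ofModel v.proj v'.proj b) v'.2 := fun b => by
      rw [metricInChart_apply g h2, ofModel_toModel h2]
    simp only [h5]
  · filter_upwards [hne, hproj.eventually hfr] with v' h1 ⟨h2, h3, h4⟩
    exact levelMap_circleAction hKt h3 h4 h1 z

end DiffAction
-- The differential of the action on tangent vectors.
section DiffAction

variable {E : Type*} [NormedAddCommGroup E] [NormedSpace ℝ E] [FiniteDimensional ℝ E]
  {M : Type*} [TopologicalSpace M] [ChartedSpace E M] [IsManifold 𝓘(ℝ, E) ∞ M]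
  {g : LorentzianMetric E M} {K : ∀ q : M, TangentSpace 𝓘(ℝ, E) q}
  {v : TangentBundle 𝓘(ℝ, E) M} {w u : TangentSpace 𝓘(ℝ, E) v.proj}

lemma mdifferentiableAt_circleAction (hK : ContMDiff 𝓘(ℝ, E) 𝓘(ℝ, E).tangent ∞
      (fun p => (⟨p, K p⟩ : TangentBundle 𝓘(ℝ, E) M)))
    (hKt : ∀ p, g.val p (K p) (K p) < 0) (o : ManifoldOrientation E M)
    (hv : v ∈ nullCongruence g K) (z : Circle) :
    MDifferentiableAt 𝓘(ℝ, E).tangent 𝓘(ℝ, E).tangent (circleAction g o K z) v := by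
  obtain ⟨w, u, h, hq, hvw⟩ := exists_adapted_frame hKt o hv
  have hp : v.proj ∈ (chartAt E v.proj).source := by simp
  obtain ⟨f, W, U, hf, hW, hU, hfx, hWx, hUx, hWU, hact, -⟩ :=
    exists_local_action hK hKt o h hq hvw z
  refine (mdifferentiableAt_totalSpace 𝓘(ℝ, E) _).2
    ⟨Bundle.mdifferentiableAt_proj (TangentSpace 𝓘(ℝ, E) : M → Type _), ?_⟩
  have hT := contDiffAt_fieldInChart hp (contMDiff_unitField hK hKt).contMDiffAt
  refine (hasMFDerivAt_of_chartTM hp (DifferentiableAt.hasFDerivAt ?_) hact).1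
  have hc : chartTM v.proj v = _ := chartTM_mk hp v.2
  rw [hc]
  refine (contDiffAt_frameRotation (isMetricAt_metricInChart g hp) hf hT hW hU ?_
    _ _).differentiableAt (by simp)
  rw [fieldInChart_apply _ hp, metricInChart_toModel g hp, inner_unitField_of_adapted h hvw]
  exact neg_ne_zero.2 (normFactor_pos hKt v.proj).ne'

/-- The chain rule for π ∘ Φ_θ = π. -/
lemma dproj_dcircleAction (hK : ContMDiff 𝓘(ℝ, E) 𝓘(ℝ, E).tangent ∞
      (fun p => (⟨p, K p⟩ : TangentBundle 𝓘(ℝ, E) M)))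
    (hKt : ∀ p, g.val p (K p) (K p) < 0) (o : ManifoldOrientation E M)
    (hv : v ∈ nullCongruence g K) (z : Circle) (ξ : TangentSpace 𝓘(ℝ, E).tangent v) :
    dproj (circleAction g o K z v) (dcircleAction g o K z v ξ) = dproj v ξ :=
  (mfderiv_comp_apply v (I' := 𝓘(ℝ, E).tangent) (I'' := 𝓘(ℝ, E))
    (Bundle.mdifferentiableAt_proj (TangentSpace 𝓘(ℝ, E) : M → Type _))
    (mdifferentiableAt_circleAction hK hKt o hv z) ξ).symm

/-- The identities of `levelMap_circleAction` hold on a neighbourhood in TM and can be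
differentiated at `v`. As both first components vanish there, g(v,𝒯)² d(F₁ ∘ Φ_θ) = f² dF₁, and F₂ ∘
Φ_θ is constant; so the kernel of dF goes to the kernel of dF. -/
lemma dcircleAction_mem_tangentNull (hK : ContMDiff 𝓘(ℝ, E) 𝓘(ℝ, E).tangent ∞
      (fun p => (⟨p, K p⟩ : TangentBundle 𝓘(ℝ, E) M)))
    (hKt : ∀ p, g.val p (K p) (K p) < 0) (o : ManifoldOrientation E M)
    (hv : v ∈ nullCongruence g K) (z : Circle) {ξ : TangentSpace 𝓘(ℝ, E).tangent v}
    (hξ : ξ ∈ tangentNull g K v) :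
    dcircleAction g o K z v ξ ∈ tangentNull g K (circleAction g o K z v) := by
  obtain ⟨w, u, h, hq, hvw⟩ := exists_adapted_frame hKt o hv
  obtain ⟨-, -, -, -, -, -, -, -, -, -, -, hlev⟩ := exists_local_action hK hKt o h hq hvw z
  have hp : v.proj ∈ (chartAt E v.proj).source := by simp
  have hΦ := circleAction_mem hKt o z hv
  have hf := (normFactor_pos hKt v.proj).ne'
  have hA := (mfderiv_levelMap g (contMDiff_unitField hK hKt) hp).1.hasMFDerivAt
  have hF := (mfderiv_levelMap g hK hp).1.hasMFDerivAt
  have hFΦ := (mfderiv_levelMap g hK (w := circleAction g o K z v) hp).1.hasMFDerivAt.comp v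
    (mdifferentiableAt_circleAction hK hKt o hv z).hasMFDerivAt
  have hn := ((contMDiff_normFactor hK hKt).mdifferentiable (by simp) v.proj).hasMFDerivAt.comp v
    (Bundle.mdifferentiableAt_proj (TangentSpace 𝓘(ℝ, E) : M → Type _) (p := v)).hasMFDerivAt
  have fst : ∀ x : ℝ × ℝ, HasMFDerivAt 𝓘(ℝ, ℝ × ℝ) 𝓘(ℝ, ℝ) Prod.fst x
    (ContinuousLinearMap.fst ℝ ℝ ℝ) := fun x => hasFDerivAt_fst.hasMFDerivAt
  have snd : ∀ x : ℝ × ℝ, HasMFDerivAt 𝓘(ℝ, ℝ × ℝ) 𝓘(ℝ, ℝ) Prod.snd x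
    (ContinuousLinearMap.snd ℝ ℝ ℝ) := fun x => hasFDerivAt_snd.hasMFDerivAt
  have hA2 := (snd _).comp v hA
  have hF1 := (fst _).comp v hF
  have hFΦ1 := (fst _).comp v hFΦ
  have hFΦ2 := (snd _).comp v hFΦ
  have hL := (hA2.mul hA2).mul hFΦ1
  have hR := (hn.mul hn).mul hF1
  have hLR := hasMFDerivAt_unique hL (hR.congr_of_eventuallyEq (by
    filter_upwards [hlev] with v' h1
    have := h1.1
    simp only [Pi.mul_apply, Function.comp_apply]
    rw [← sq, this, sq]))
  have h2 := hasMFDerivAt_unique hFΦ2 ((hasMFDerivAt_const (-1 : ℝ) v).congr_of_eventuallyEq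
    (hlev.mono fun v' h1 => h1.2))
  have hv0 := (mem_nullCongruence_iff g K v).1 hv
  have hv1 := (mem_nullCongruence_iff g K _).1 hΦ
  have hξ' : mfderiv 𝓘(ℝ, E).tangent 𝓘(ℝ, ℝ × ℝ) (levelMap g K) v ξ = (0 : ℝ × ℝ) := hξ
  set D : ℝ × ℝ := mfderiv 𝓘(ℝ, E).tangent 𝓘(ℝ, ℝ × ℝ) (levelMap g K) (circleAction g o K z v)
    (dcircleAction g o K z v ξ) with hD
  have hA0 : (levelMap g (unitField g K) v).2 ≠ 0 := by
    change g.val v.proj v.2 (unitField g K v.proj) ≠ 0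
    rw [inner_unitField_of_adapted h hvw]
    exact neg_ne_zero.2 hf
  have e1 : (levelMap g K (circleAction g o K z v)).1 = 0 := by rw [hv1]
  have e2 : (levelMap g K v).1 = 0 := by rw [hv0]
  -- Here x and y are the derivatives of the squared coefficients. Their values do not matter, since
  -- they are multiplied by components that vanish.
  obtain ⟨x, y, hLR'⟩ : ∃ x y : ℝ,
      ((levelMap g (unitField g K) v).2 * (levelMap g (unitField g K) v).2) * D.1
        + (levelMap g K (circleAction g o K z v)).1 * x
      = (normFactor g K v.proj * normFactor g K v.proj)
          * (mfderiv 𝓘(ℝ, E).tangent 𝓘(ℝ, ℝ × ℝ) (levelMap g K) v ξ : ℝ × ℝ).1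
        + (levelMap g K v).1 * y := ⟨_, _, DFunLike.congr_fun hLR ξ⟩
  have h2' : D.2 = 0 := DFunLike.congr_fun h2 ξ
  rw [hξ', e1, e2, Prod.fst_zero, mul_zero, zero_mul, zero_mul, add_zero, add_zero] at hLR'
  have hD0 : D = 0 := Prod.ext ((mul_eq_zero.1 hLR').resolve_left (mul_ne_zero hA0 hA0)) h2'
  exact hD0

/-- The action of `dΦ_θ` on the vertical component: it is changed by a form that depends on the
covariant derivative of the unit field. -/
lemma inner_connector_dcircleAction (hK : ContMDiff 𝓘(ℝ, E) 𝓘(ℝ, E).tangent ∞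
      (fun p => (⟨p, K p⟩ : TangentBundle 𝓘(ℝ, E) M)))
    (hKt : ∀ p, g.val p (K p) (K p) < 0) (o : ManifoldOrientation E M)
    (hv : v ∈ nullCongruence g K)
    (h : IsLorentzTriple (g.val v.proj) (unitField g K v.proj) w u)
    (hq : IsQuarterTurn (g.form v.proj) (o.fibre v.proj) (unitField g K v.proj) w u)
    (hvw : v.2 = normFactor g K v.proj • (unitField g K v.proj + w)) (z : Circle)
    (ξ : TangentSpace 𝓘(ℝ, E).tangent v) :
    g.val v.proj ((z : ℂ).re • u - (z : ℂ).im • w)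
        (connector g (circleAction g o K z v) (dcircleAction g o K z v ξ))
      = g.val v.proj u (connector g v ξ) + normFactor g K v.proj *
        (((z : ℂ).re - 1) * g.val v.proj u (covDeriv g (unitField g K) v.proj (dproj v ξ))
          - (z : ℂ).im * g.val v.proj w (covDeriv g (unitField g K) v.proj (dproj v ξ))) := by
  have hp : v.proj ∈ (chartAt E v.proj).source := by simp
  obtain ⟨f, W, U, hf, hW, hU, hfx, hWx, hUx, hWU, hact, -⟩ :=
    exists_local_action hK hKt o h hq hvw z
  set p := v.proj with hpdef
  set x := extChartAt 𝓘(ℝ, E) p p with hx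
  have hG := isMetricAt_metricInChart g hp
  have hTs := contMDiff_unitField hK hKt
  have hT := contDiffAt_fieldInChart hp hTs.contMDiffAt
  have hTx : fieldInChart (unitField g K) p x = toModel p p (unitField g K p) :=
    fieldInChart_apply _ hp
  have hz := re_sq_add_im_sq z
  have hdiff : DifferentiableAt ℝ (frameRotation (metricInChart g p) f
      (fieldInChart (unitField g K) p) W U (z : ℂ).re (z : ℂ).im) (chartTM p v) := by
    have hc : chartTM p v = _ := chartTM_mk hp v.2
    rw [hc]
    refine (contDiffAt_frameRotation hG hf hT hW hU ?_ _ _).differentiableAt (by simp)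
    rw [hTx, metricInChart_toModel g hp, inner_unitField_of_adapted h hvw]
    exact neg_ne_zero.2 (normFactor_pos hKt v.proj).ne'
  obtain ⟨γ, Y, hγ, h0, hY0, hY, hγY⟩ := exists_curve g (p := p) hp ξ
  have hd := hasDerivAt_of_curve (p := p) hp h0 hY0 hγY hdiff hact
  have hY0' : Y 0 = f x • (fieldInChart (unitField g K) p x + W x) := by
    rw [hY0, hvw, hfx, hTx, hWx, map_smul, map_add]
  have ht := hasCovDerivAlong_fieldInChart g hT hγ h0
  -- The covariant derivative of the image curve; the rest of the proof recognizes it as the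
  -- connection map applied to dΦ_θ ξ.
  have hcov := HasCovDerivAlong.of_hasDerivAt (G := metricInChart g p) (x := x)
    (a := toModel p p (dproj v ξ)) hd
  have key := inner_covDeriv_frameRotation hG hf hT hW hU hWU
    (by rw [hfx]; exact (normFactor_pos hKt v.proj).ne') hz hγ h0 hY hY0' ht hcov
  rw [← toModel_covDeriv g hTs.contMDiffAt, hUx, hWx, hfx, metricInChart_toModel g hp,
    metricInChart_toModel g hp, metricInChart_toModel g hp] at key
  have hconn := toModel_connector g (p := p) (w := circleAction g o K z v) hp
    (dcircleAction g o K z v ξ)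
  rw [dproj_dcircleAction hK hKt o hv] at hconn
  -- By the chain rule, the fibre component of dΦ_θ ξ in the chart is the derivative of the fibre
  -- component of Φ_θ.
  have e1 := (hasMFDerivAt_of_chartTM (p := p) (w := circleAction g o K z v) hp hasFDerivAt_snd
    (f := fun v' => (trivializationAt E (TangentSpace 𝓘(ℝ, E) : M → Type _) p v').2)
    (.of_forall fun _ => rfl))
  have e2 := mfderiv_comp_apply v e1.1 (mdifferentiableAt_circleAction hK hKt o hv z) ξ
  have e3 := e2.trans (e1.2 _)
  have e4 : frameRotation (metricInChart g p) f (fieldInChart (unitField g K) p) W U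
      (z : ℂ).re (z : ℂ).im (γ 0, Y 0) = toModel p p (circleAction g o K z v).2 := by
    have hc : chartTM p v = (γ 0, Y 0) := by rw [h0, hY0]; exact chartTM_mk hp v.2
    rw [← hc]
    exact hact.self_of_nhds.symm.trans (trivializationAt_snd hp _)
  rw [e4] at key
  refine Eq.trans ?_ key
  rw [← map_smul, ← map_smul, ← map_sub]
  refine (metricInChart_toModel g hp _ _).symm.trans ?_
  refine congrArg _ (hconn.trans ?_)
  exact congrArg₂ (· + ·) e3.symm rfl

end DiffAction
-- Parallelism, isometry and invariance of the horizontal spaces.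
section Equivalences

variable {E : Type*} [NormedAddCommGroup E] [NormedSpace ℝ E]
  {M : Type*} [TopologicalSpace M] [ChartedSpace E M] [IsManifold 𝓘(ℝ, E) ∞ M]
  {g : LorentzianMetric E M} {K : ∀ q : M, TangentSpace 𝓘(ℝ, E) q}

/-- Every fibre of C_KM is nonempty, so conditions on C_KM say something about ∇𝒯 at every point. -/
lemma exists_mem_nullCongruence (hKt : ∀ p, g.val p (K p) (K p) < 0) (p : M) :
    ∃ x : TangentSpace 𝓘(ℝ, E) p, (⟨p, x⟩ : TangentBundle 𝓘(ℝ, E) M) ∈ nullCongruence g K := by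
  obtain ⟨b, hb⟩ := g.signature p
  set t := unitField g K p with htdef
  have ht : g.val p t t = -1 := form_unitField hKt p
  set x := b 1 + g.val p t (b 1) • t with hx
  have htx : g.val p t x = 0 := by
    rw [hx, map_add, map_smul, ht]; simp
  -- Otherwise b 1 would be a multiple of 𝒯 and have square at most 0, whereas its square is 1.
  have hx0 : x ≠ 0 := by
    intro h0
    have h1 := hb 1 1
    rw [eq_neg_of_add_eq_zero_left h0] at h1
    simp only [map_neg, map_smul, _root_.neg_apply, _root_.smul_apply, smul_eq_mul, ht] at h1
    norm_num at h1
    nlinarith [sq_nonneg (g.val p t (b 1))]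
  have hpos : 0 < g.val p x x :=
    pos_of_orthogonal (B := g.form p) hb (by rw [form_unitField hKt p]; norm_num) htx hx0
  set w := (√(g.val p x x))⁻¹ • x with hw
  have htw : g.val p t w = 0 := by rw [hw, map_smul, htx, smul_zero]
  have hwt : g.val p w t = 0 := by rw [g.symm, htw]
  have hww : g.val p w w = 1 := by
    rw [hw, map_smul, map_smul, _root_.smul_apply, smul_eq_mul, smul_eq_mul]
    have h2 := Real.sq_sqrt hpos.le
    have h3 := (Real.sqrt_pos.2 hpos).ne'
    field_simp
    linarith
  refine ⟨normFactor g K p • (t + w), ?_, ?_⟩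
  · simp [ht, htw, hwt, hww]
  · have h2 := normFactor_smul_inner g K p (t + w)
    have h3 : g.val p (t + w) t = -1 := by rw [map_add, _root_.add_apply, ht, hwt, add_zero]
    rw [h3] at h2
    change g.val p (normFactor g K p • (t + w)) (K p) = -1
    rw [map_smul]
    exact h2

variable {v : TangentBundle 𝓘(ℝ, E) M} {w u : TangentSpace 𝓘(ℝ, E) v.proj}

/-- A frame adapted to `Φ_θ(v)`. -/
lemma adapted_circleAction {o : ManifoldOrientation E M}
    (hKt : ∀ p, g.val p (K p) (K p) < 0)
    (h : IsLorentzTriple (g.val v.proj) (unitField g K v.proj) w u)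
    (hq : IsQuarterTurn (g.form v.proj) (o.fibre v.proj) (unitField g K v.proj) w u)
    (hvw : v.2 = normFactor g K v.proj • (unitField g K v.proj + w)) (z : Circle) :
    ((circleAction g o K z v).2 : TangentSpace 𝓘(ℝ, E) v.proj)
      = normFactor g K v.proj • (unitField g K v.proj + ((z : ℂ).re • w + (z : ℂ).im • u)) :=
  eq_of_heq (Bundle.TotalSpace.mk.inj (circleAction_of_adapted hKt h hq hvw z)).2

variable [FiniteDimensional ℝ E] {ξ ζ : TangentSpace 𝓘(ℝ, E).tangent v}

/-- Every tangent vector of `M` has a horizontal lift. -/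
lemma exists_mem_horizontal (hK : ContMDiff 𝓘(ℝ, E) 𝓘(ℝ, E).tangent ∞
      (fun p => (⟨p, K p⟩ : TangentBundle 𝓘(ℝ, E) M)))
    (hKt : ∀ p, g.val p (K p) (K p) < 0) (hv : v ∈ nullCongruence g K)
    (hvw : v.2 = normFactor g K v.proj • (unitField g K v.proj + w))
    (h : IsLorentzTriple (g.val v.proj) (unitField g K v.proj) w u)
    (a : TangentSpace 𝓘(ℝ, E) v.proj) : ∃ ξ ∈ horizontal g K v, dproj v ξ = a := by
  obtain ⟨ξ, h1, h2⟩ := exists_tangent_vector g v a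
    (nablaForm g K v.proj (chartTM v.proj v) (toModel v.proj v.proj a) • v.2)
  exact ⟨ξ, (mem_horizontal_iff_connector hK hKt hv hvw h (p := v.proj) (by simp)).2
    (by rw [h1, h2]), h1⟩

/-- The covariant derivative of the unit field is orthogonal to the field. -/
lemma inner_covDeriv_unitField (hK : ContMDiff 𝓘(ℝ, E) 𝓘(ℝ, E).tangent ∞
      (fun p => (⟨p, K p⟩ : TangentBundle 𝓘(ℝ, E) M)))
    (hKt : ∀ p, g.val p (K p) (K p) < 0) (p : M) (a : TangentSpace 𝓘(ℝ, E) p) :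
    g.val p (unitField g K p) (covDeriv g (unitField g K) p a) = 0 := by
  have hp : p ∈ (chartAt E p).source := by simp
  have hTs := contMDiff_unitField hK hKt
  have hT := contDiffAt_fieldInChart hp hTs.contMDiffAt
  have hG := isMetricAt_metricInChart g hp
  have hγ : HasDerivAt (fun s : ℝ => extChartAt 𝓘(ℝ, E) p p + s • toModel p p a)
      (toModel p p a) 0 := by
    simpa using ((hasDerivAt_id (0 : ℝ)).smul_const (toModel p p a)).const_add
      (extChartAt 𝓘(ℝ, E) p p)
  have h0 : (fun s : ℝ => extChartAt 𝓘(ℝ, E) p p + s • toModel p p a) 0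
    = extChartAt 𝓘(ℝ, E) p p := by simp
  have h1 := hasCovDerivAlong_fieldInChart g hT hγ h0
  have h2 := h1.inner hG hγ h0 h1
  have h3 := eventually_extChartAt_symm hp (P := fun _ => True) (by simp)
  have hc := hγ.continuousAt.tendsto
  simp only [zero_smul, add_zero] at hc
  have hev := hc.eventually h3
  have h4 := h2.unique ((hasDerivAt_const (0 : ℝ) (-1 : ℝ)).congr_of_eventuallyEq (by
    filter_upwards [hev] with s ⟨r, hr, hrs, _⟩
    simp only [Function.comp_apply]
    rw [← hrs, fieldInChart_apply _ hr, metricInChart_toModel g hr]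
    exact form_unitField hKt r))
  simp only [Function.comp_apply, zero_smul, add_zero] at h4
  rw [← toModel_covDeriv g hTs.contMDiffAt, fieldInChart_apply _ hp,
    metricInChart_toModel g hp, metricInChart_toModel g hp, g.symm] at h4
  linarith

/-- The unit field is parallel if the vertical components are preserved by the action. -/
lemma isParallel_unitField (hK : ContMDiff 𝓘(ℝ, E) 𝓘(ℝ, E).tangent ∞
      (fun p => (⟨p, K p⟩ : TangentBundle 𝓘(ℝ, E) M)))
    (hKt : ∀ p, g.val p (K p) (K p) < 0) (o : ManifoldOrientation E M)
    (H : ∀ v ∈ nullCongruence g K, ∀ w u : TangentSpace 𝓘(ℝ, E) v.proj,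
      IsLorentzTriple (g.val v.proj) (unitField g K v.proj) w u →
      IsQuarterTurn (g.form v.proj) (o.fibre v.proj) (unitField g K v.proj) w u →
      v.2 = normFactor g K v.proj • (unitField g K v.proj + w) →
      ∀ (z : Circle), ∀ ξ ∈ horizontal g K v, g.val v.proj ((z : ℂ).re • u - (z : ℂ).im • w)
        (connector g (circleAction g o K z v) (dcircleAction g o K z v ξ)) = 0) :
    IsParallel g (unitField g K) := by
  intro p a
  obtain ⟨x, hv⟩ := exists_mem_nullCongruence hKt p
  obtain ⟨w, u, h, hq, hvw⟩ := exists_adapted_frame hKt o hv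
  obtain ⟨ξ, hξ, ha⟩ := exists_mem_horizontal hK hKt hv hvw h a
  have hμ := ((mem_horizontal_iff hK hKt hvw h).1 hξ).2
  have hf := (normFactor_pos hKt p).ne'
  have key : ∀ z : Circle, ((z : ℂ).re - 1) * g.val p u (covDeriv g (unitField g K) p a)
      - (z : ℂ).im * g.val p w (covDeriv g (unitField g K) p a) = 0 := by
    intro z
    have h1 := inner_connector_dcircleAction hK hKt o hv h hq hvw z ξ
    rw [H _ hv w u h hq hvw z ξ hξ, hμ, zero_add, ha] at h1
    exact (mul_eq_zero.1 h1.symm).resolve_left hf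
  -- At θ = π only -2 g(u, ∇_a 𝒯) survives; θ = π/2 then gives g(w, ∇_a 𝒯) = 0.
  have h1 := key (Circle.exp Real.pi)
  have h2 := key (Circle.exp (Real.pi / 2))
  simp [Circle.coe_exp, Complex.exp_mul_I] at h1 h2
  have h3 : g.val p u (covDeriv g (unitField g K) p a) = 0 :=
    h1.resolve_left (by norm_num)
  have h4 : g.val p w (covDeriv g (unitField g K) p a) = 0 := by linarith
  refine (h.expand _).trans ?_
  have h5 := inner_covDeriv_unitField hK hKt p a
  refine (congrArg₂ (· + ·) (congrArg₂ (· + ·) (congrArg (fun r : ℝ => -r • unitField g K p) h5)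
    (congrArg (fun r : ℝ => r • w) h4)) (congrArg (fun r : ℝ => r • u) h3)).trans ?_
  simp

/-- If the unit field is parallel, the vertical components are preserved by the action. -/
lemma IsParallel.inner_connector (hT : IsParallel g (unitField g K))
    (hK : ContMDiff 𝓘(ℝ, E) 𝓘(ℝ, E).tangent ∞
      (fun p => (⟨p, K p⟩ : TangentBundle 𝓘(ℝ, E) M)))
    (hKt : ∀ p, g.val p (K p) (K p) < 0) (o : ManifoldOrientation E M)
    (hv : v ∈ nullCongruence g K)
    (h : IsLorentzTriple (g.val v.proj) (unitField g K v.proj) w u)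
    (hq : IsQuarterTurn (g.form v.proj) (o.fibre v.proj) (unitField g K v.proj) w u)
    (hvw : v.2 = normFactor g K v.proj • (unitField g K v.proj + w)) (z : Circle)
    (ξ : TangentSpace 𝓘(ℝ, E).tangent v) :
    g.val v.proj ((z : ℂ).re • u - (z : ℂ).im • w)
        (connector g (circleAction g o K z v) (dcircleAction g o K z v ξ))
      = g.val v.proj u (connector g v ξ) := by
  rw [inner_connector_dcircleAction hK hKt o hv h hq hvw, hT]
  simp

/-- This is `sasaki_eq_of_mem_tangentNull` at Φ_θ(v), in the rotated frame. -/
lemma sasaki_dcircleAction (hK : ContMDiff 𝓘(ℝ, E) 𝓘(ℝ, E).tangent ∞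
      (fun p => (⟨p, K p⟩ : TangentBundle 𝓘(ℝ, E) M)))
    (hKt : ∀ p, g.val p (K p) (K p) < 0) (o : ManifoldOrientation E M)
    (hv : v ∈ nullCongruence g K)
    (h : IsLorentzTriple (g.val v.proj) (unitField g K v.proj) w u)
    (hq : IsQuarterTurn (g.form v.proj) (o.fibre v.proj) (unitField g K v.proj) w u)
    (hvw : v.2 = normFactor g K v.proj • (unitField g K v.proj + w)) (z : Circle)
    (hξ : ξ ∈ tangentNull g K v) (hζ : ζ ∈ tangentNull g K v) :
    sasaki g (circleAction g o K z v) (dcircleAction g o K z v ξ) (dcircleAction g o K z v ζ)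
      = g.val v.proj (dproj v ξ) (dproj v ζ)
        + g.val v.proj ((z : ℂ).re • u - (z : ℂ).im • w)
            (connector g (circleAction g o K z v) (dcircleAction g o K z v ξ))
          * g.val v.proj ((z : ℂ).re • u - (z : ℂ).im • w)
            (connector g (circleAction g o K z v) (dcircleAction g o K z v ζ)) := by
  have h1 := sasaki_eq_of_mem_tangentNull hK hKt (adapted_circleAction hKt h hq hvw z)
    (h.rotate (re_sq_add_im_sq z)) (dcircleAction_mem_tangentNull hK hKt o hv z hξ)
    (dcircleAction_mem_tangentNull hK hKt o hv z hζ)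
  rw [dproj_dcircleAction hK hKt o hv, dproj_dcircleAction hK hKt o hv] at h1
  exact h1

lemma dcircleAction_mem_horizontal_iff (hK : ContMDiff 𝓘(ℝ, E) 𝓘(ℝ, E).tangent ∞
      (fun p => (⟨p, K p⟩ : TangentBundle 𝓘(ℝ, E) M)))
    (hKt : ∀ p, g.val p (K p) (K p) < 0) (o : ManifoldOrientation E M)
    (hv : v ∈ nullCongruence g K)
    (h : IsLorentzTriple (g.val v.proj) (unitField g K v.proj) w u)
    (hq : IsQuarterTurn (g.form v.proj) (o.fibre v.proj) (unitField g K v.proj) w u)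
    (hvw : v.2 = normFactor g K v.proj • (unitField g K v.proj + w)) (z : Circle)
    (hξ : ξ ∈ tangentNull g K v) :
    dcircleAction g o K z v ξ ∈ horizontal g K (circleAction g o K z v) ↔
      g.val v.proj ((z : ℂ).re • u - (z : ℂ).im • w)
        (connector g (circleAction g o K z v) (dcircleAction g o K z v ξ)) = 0 :=
  (mem_horizontal_iff hK hKt (adapted_circleAction hKt h hq hvw z)
    (h.rotate (re_sq_add_im_sq z))).trans
    (and_iff_right (dcircleAction_mem_tangentNull hK hKt o hv z hξ))

lemma isIsometricAction_of_isParallel (hK : ContMDiff 𝓘(ℝ, E) 𝓘(ℝ, E).tangent ∞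
      (fun p => (⟨p, K p⟩ : TangentBundle 𝓘(ℝ, E) M)))
    (hKt : ∀ p, g.val p (K p) (K p) < 0) (o : ManifoldOrientation E M)
    (hT : IsParallel g (unitField g K)) : IsIsometricAction g o K := by
  intro z v hv ξ hξ ζ hζ
  obtain ⟨w, u, h, hq, hvw⟩ := exists_adapted_frame hKt o hv
  rw [sasaki_dcircleAction hK hKt o hv h hq hvw z hξ hζ,
    sasaki_eq_of_mem_tangentNull hK hKt hvw h hξ hζ,
    hT.inner_connector hK hKt o hv h hq hvw, hT.inner_connector hK hKt o hv h hq hvw]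

/-- For horizontal ξ, equality of ĝ(dΦ_θ ξ, dΦ_θ ξ) and ĝ(ξ, ξ) leaves μ'(dΦ_θ ξ)² = 0. -/
lemma isParallel_of_isIsometricAction (hK : ContMDiff 𝓘(ℝ, E) 𝓘(ℝ, E).tangent ∞
      (fun p => (⟨p, K p⟩ : TangentBundle 𝓘(ℝ, E) M)))
    (hKt : ∀ p, g.val p (K p) (K p) < 0) (o : ManifoldOrientation E M)
    (hI : IsIsometricAction g o K) : IsParallel g (unitField g K) := by
  refine isParallel_unitField hK hKt o fun v hv w u h hq hvw z ξ hξ => ?_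
  obtain ⟨h1, h2⟩ := (mem_horizontal_iff hK hKt hvw h).1 hξ
  have h3 := hI z v hv ξ h1 ξ h1
  rw [sasaki_dcircleAction hK hKt o hv h hq hvw z h1 h1,
    sasaki_eq_of_mem_tangentNull hK hKt hvw h h1 h1, h2, mul_zero] at h3
  exact mul_self_eq_zero.1 (add_left_cancel h3)

lemma isParallel_of_isPrincipalConnection (hK : ContMDiff 𝓘(ℝ, E) 𝓘(ℝ, E).tangent ∞
      (fun p => (⟨p, K p⟩ : TangentBundle 𝓘(ℝ, E) M)))
    (hKt : ∀ p, g.val p (K p) (K p) < 0) (o : ManifoldOrientation E M)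
    (hC : IsPrincipalConnection g o K (horizontal g K)) : IsParallel g (unitField g K) := by
  refine isParallel_unitField hK hKt o fun v hv w u h hq hvw z ξ hξ => ?_
  refine (dcircleAction_mem_horizontal_iff hK hKt o hv h hq hvw z
    ((mem_horizontal_iff hK hKt hvw h).1 hξ).1).1 ?_
  rw [← hC.invariant z v hv]
  exact Submodule.mem_map_of_mem hξ

/-- Although ĝ is indefinite, it is positive on the vertical line because g(u,u) = 1, so the
orthogonal space is a complement. -/
lemma horizontal_inf_vertical (hK : ContMDiff 𝓘(ℝ, E) 𝓘(ℝ, E).tangent ∞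
      (fun p => (⟨p, K p⟩ : TangentBundle 𝓘(ℝ, E) M)))
    (hKt : ∀ p, g.val p (K p) (K p) < 0)
    (hvw : v.2 = normFactor g K v.proj • (unitField g K v.proj + w))
    (h : IsLorentzTriple (g.val v.proj) (unitField g K v.proj) w u) :
    horizontal g K v ⊓ vertical g K v = ⊥ := by
  refine (Submodule.eq_bot_iff _).2 fun ξ hξ => ?_
  have h1 := ((mem_horizontal_iff hK hKt hvw h).1 hξ.1).2
  obtain ⟨h2, h3⟩ := (mem_vertical_iff hK hKt hvw h).1 hξ.2
  rw [h1, zero_smul] at h3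
  exact tangent_vector_ext g (by rw [h2, map_zero]) (by rw [h3, map_zero])

lemma horizontal_sup_vertical (hK : ContMDiff 𝓘(ℝ, E) 𝓘(ℝ, E).tangent ∞
      (fun p => (⟨p, K p⟩ : TangentBundle 𝓘(ℝ, E) M)))
    (hKt : ∀ p, g.val p (K p) (K p) < 0)
    (hvw : v.2 = normFactor g K v.proj • (unitField g K v.proj + w))
    (h : IsLorentzTriple (g.val v.proj) (unitField g K v.proj) w u) :
    horizontal g K v ⊔ vertical g K v = tangentNull g K v := by
  refine le_antisymm (sup_le inf_le_left inf_le_left) fun ξ hξ => ?_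
  -- The vertical part of ξ is the vertical vector with the same value of g(u, c ·).
  obtain ⟨ζ, h1, h2⟩ := exists_tangent_vector g v 0 (g.val v.proj u (connector g v ξ) • u)
  have h3 : ζ ∈ vertical g K v := (mem_vertical_iff hK hKt hvw h).2
    ⟨h1, by rw [h2, map_smul, h.uu, smul_eq_mul, mul_one]⟩
  rw [← sub_add_cancel ξ ζ]
  refine Submodule.add_mem_sup ((mem_horizontal_iff hK hKt hvw h).2
    ⟨Submodule.sub_mem _ hξ h3.1, ?_⟩) h3
  rw [map_sub, h2, map_sub, map_smul, h.uu, smul_eq_mul, mul_one, sub_self]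

lemma horizontal_ext (hK : ContMDiff 𝓘(ℝ, E) 𝓘(ℝ, E).tangent ∞
      (fun p => (⟨p, K p⟩ : TangentBundle 𝓘(ℝ, E) M)))
    (hKt : ∀ p, g.val p (K p) (K p) < 0) (hv : v ∈ nullCongruence g K)
    (hvw : v.2 = normFactor g K v.proj • (unitField g K v.proj + w))
    (h : IsLorentzTriple (g.val v.proj) (unitField g K v.proj) w u)
    (hξ : ξ ∈ horizontal g K v) (hζ : ζ ∈ horizontal g K v) (he : dproj v ξ = dproj v ζ) :
    ξ = ζ := by
  have hp : v.proj ∈ (chartAt E v.proj).source := by simp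
  refine tangent_vector_ext g he ?_
  rw [(mem_horizontal_iff_connector hK hKt hv hvw h hp).1 hξ,
    (mem_horizontal_iff_connector hK hKt hv hvw h hp).1 hζ, he]

lemma map_horizontal_of_isParallel (hK : ContMDiff 𝓘(ℝ, E) 𝓘(ℝ, E).tangent ∞
      (fun p => (⟨p, K p⟩ : TangentBundle 𝓘(ℝ, E) M)))
    (hKt : ∀ p, g.val p (K p) (K p) < 0) (o : ManifoldOrientation E M)
    (hT : IsParallel g (unitField g K)) (z : Circle) (hv : v ∈ nullCongruence g K) :
    (horizontal g K v).map (dcircleAction g o K z v).toLinearMap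
      = horizontal g K (circleAction g o K z v) := by
  obtain ⟨w, u, h, hq, hvw⟩ := exists_adapted_frame hKt o hv
  have hmem : ∀ ξ ∈ horizontal g K v,
      dcircleAction g o K z v ξ ∈ horizontal g K (circleAction g o K z v) := fun ξ hξ => by
    obtain ⟨h1, h2⟩ := (mem_horizontal_iff hK hKt hvw h).1 hξ
    exact (dcircleAction_mem_horizontal_iff hK hKt o hv h hq hvw z h1).2
      ((hT.inner_connector hK hKt o hv h hq hvw z ξ).trans h2)
  refine le_antisymm (Submodule.map_le_iff_le_comap.2 hmem) fun ζ hζ => ?_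
  -- The horizontal lift at v of dπ ζ is sent to a horizontal vector over the same vector of M,
  -- which is ζ itself.
  obtain ⟨ξ, hξ, ha⟩ := exists_mem_horizontal hK hKt hv hvw h
    (dproj (circleAction g o K z v) ζ)
  exact ⟨ξ, hξ, horizontal_ext hK hKt (circleAction_mem hKt o z hv)
    (adapted_circleAction hKt h hq hvw z) (h.rotate (re_sq_add_im_sq z)) (hmem ξ hξ) hζ
    ((dproj_dcircleAction hK hKt o hv z ξ).trans ha)⟩

end Equivalences
-- Smoothness of the horizontal distribution.
section Smooth

variable {E : Type*} [NormedAddCommGroup E] [NormedSpace ℝ E] [FiniteDimensional ℝ E]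
  {M : Type*} [TopologicalSpace M] [ChartedSpace E M] [IsManifold 𝓘(ℝ, E) ∞ M]
  {g : LorentzianMetric E M} {K : ∀ q : M, TangentSpace 𝓘(ℝ, E) q}

/-- The horizontal lift of the vector `e` at the point `n` of `TM`, in the chart at `p`. -/
noncomputable def horizontalLift (g : LorentzianMetric E M) (K : ∀ q : M, TangentSpace 𝓘(ℝ, E) q)
    (p : M) (e : E) (n : E × E) : E × E :=
  (e, nablaForm g K p n e • n.2 - christoffelSymbol (metricInChart g p) n.1 e n.2)

lemma contDiffAt_horizontalLift (hK : ContMDiff 𝓘(ℝ, E) 𝓘(ℝ, E).tangent ∞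
      (fun p => (⟨p, K p⟩ : TangentBundle 𝓘(ℝ, E) M))) {p : M} {w : TangentBundle 𝓘(ℝ, E) M}
    (hw : w.proj ∈ (chartAt E p).source) (e : E) :
    ContDiffAt ℝ ∞ (horizontalLift g K p e) (chartTM p w) := by
  have := FiniteDimensional.complete ℝ E
  have hG : IsMetricAt (metricInChart g p) (chartTM p w).1 := isMetricAt_metricInChart g hw
  have hX : ContDiffAt ℝ ∞ (fieldInChart K p) (chartTM p w).1 :=
    contDiffAt_fieldInChart hw hK.contMDiffAt
  have h1 : ContDiffAt ℝ ∞ (fun n : E × E => n.1) (chartTM p w) := contDiffAt_fst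
  have h2 : ContDiffAt ℝ ∞ (fun n : E × E => n.2) (chartTM p w) := contDiffAt_snd
  have hX1 : ContDiffAt ℝ ∞ (fun n : E × E => fieldInChart K p n.1) (chartTM p w) :=
    ContDiffAt.comp (g := fieldInChart K p) (f := Prod.fst) _ hX h1
  have hG1 : ContDiffAt ℝ ∞ (fun n : E × E => metricInChart g p n.1) (chartTM p w) :=
    ContDiffAt.comp (g := metricInChart g p) (f := Prod.fst) _ hG.smooth h1
  have hdX : ContDiffAt ℝ ∞ (fun n : E × E => fderiv ℝ (fieldInChart K p) n.1) (chartTM p w) :=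
    ContDiffAt.comp (g := fderiv ℝ (fieldInChart K p)) (f := Prod.fst) _
      (hX.fderiv_right (m := ∞) (by simp)) h1
  have hc : ContDiffAt ℝ ∞ (fun n : E × E => covDerivInChart g K p n.1 e) (chartTM p w) :=
    (hdX.clm_apply contDiffAt_const).add
      (IsMetricAt.contDiffAt_christoffelSymbol_apply h1 hG contDiffAt_const hX1)
  exact contDiffAt_const.prodMk ((((hG1.clm_apply h2).clm_apply hc).smul h2).sub
    (IsMetricAt.contDiffAt_christoffelSymbol_apply h1 hG contDiffAt_const h2))

/-- By `mem_horizontal_iff_connector` the horizontal space is a graph over the tangent space of M,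
given by a formula that stays smooth off C_KM. The lifts of the coordinate fields are thus smooth on
an open set of TM, and they span ℋ along C_KM. -/
lemma isSmoothDistribution_horizontal (hK : ContMDiff 𝓘(ℝ, E) 𝓘(ℝ, E).tangent ∞
      (fun p => (⟨p, K p⟩ : TangentBundle 𝓘(ℝ, E) M)))
    (hKt : ∀ p, g.val p (K p) (K p) < 0) (o : ManifoldOrientation E M) :
    IsSmoothDistribution g K (horizontal g K) := by
  intro v hv
  set T := trivializationAt (E × E) (TangentSpace 𝓘(ℝ, E).tangent :
    TangentBundle 𝓘(ℝ, E) M → Type _) v with hT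
  set b := Module.finBasis ℝ E
  set U : Set (TangentBundle 𝓘(ℝ, E) M) := {w | w.proj ∈ (chartAt E v.proj).source} with hU
  have hbase : ∀ w ∈ U, w ∈ T.baseSet := fun w hw => by
    have hw' : w.proj ∈ (chartAt E v.proj).source := hw
    rw [hT, TangentBundle.trivializationAt_baseSet]
    simpa using hw'
  have hUo : IsOpen U := (chartAt E v.proj).open_source.preimage
    (FiberBundle.continuous_proj E (TangentSpace 𝓘(ℝ, E) : M → Type _))
  set X : Fin (Module.finrank ℝ E) → ∀ w : TangentBundle 𝓘(ℝ, E) M,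
      TangentSpace 𝓘(ℝ, E).tangent w := fun i w =>
    T.symmL ℝ w (horizontalLift g K v.proj (b i) (chartTM v.proj w)) with hX
  have hXT : ∀ i, ∀ w ∈ U, T.continuousLinearMapAt ℝ w (X i w)
      = horizontalLift g K v.proj (b i) (chartTM v.proj w) := fun i w hw =>
    T.continuousLinearMapAt_symmL (hbase w hw) _
  have hXc : ∀ i, ∀ w ∈ U, mfderiv 𝓘(ℝ, E).tangent 𝓘(ℝ, E × E) (chartTM v.proj) w (X i w)
      = horizontalLift g K v.proj (b i) (chartTM v.proj w) := fun i w hw => by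
    have hw' : w.proj ∈ (chartAt E v.proj).source := hw
    have h1 := TangentBundle.continuousLinearMapAt_trivializationAt (I := 𝓘(ℝ, E).tangent)
      (x₀ := v) (x := w) (by simpa using hw')
    rw [extChartAt_tangent] at h1
    exact (DFunLike.congr_fun h1 _).symm.trans (hXT i w hw)
  refine ⟨U, _, X, hUo, by simp [hU], fun i => ?_, fun w hw => ?_⟩
  · intro w hw
    refine ContMDiffAt.contMDiffWithinAt ?_
    refine (T.contMDiffAt_iff (T.mem_source.2 (hbase w hw))).2 ⟨contMDiffAt_id, ?_⟩
    refine ((contDiffAt_horizontalLift hK (g := g) hw (b i)).contMDiffAt.comp w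
      (contMDiffAt_chartTM hw)).congr_of_eventuallyEq ?_
    filter_upwards [hUo.mem_nhds hw] with w' hw'
    rw [Function.comp_apply, ← hXT i w' hw', Bundle.Trivialization.continuousLinearMapAt_apply,
      Bundle.Trivialization.linearMapAt_apply, if_pos (hbase w' hw')]
  · obtain ⟨hw1, hw2⟩ := hw
    obtain ⟨x, y, h, -, hvw⟩ := exists_adapted_frame hKt o hw2
    have hd : ∀ i, toModel v.proj w.proj (dproj w (X i w)) = b i := fun i =>
      (mfderiv_chartTM_fst hw1 (X i w)).symm.trans (congrArg Prod.fst (hXc i w hw1))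
    have hmem : ∀ i, X i w ∈ horizontal g K w := fun i => by
      refine (mem_horizontal_iff_connector hK hKt hw2 hvw h hw1).2 ?_
      have h1 := toModel_connector g hw1 (X i w)
      have hc : chartTM v.proj w = _ := chartTM_mk hw1 w.2
      rw [hXc i w hw1, hd, horizontalLift, hc, sub_add_cancel] at h1
      rw [hd, ← ofModel_toModel hw1 (connector g w (X i w)), h1, map_smul, ofModel_toModel hw1, hc]
    refine le_antisymm (Submodule.span_le.2 (Set.range_subset_iff.2 hmem)) fun ξ hξ => ?_
    -- This combination has the same projection as ξ, and a horizontal vector is determined by its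
    -- projection.
    have hsum : ∑ i, b.repr (toModel v.proj w.proj (dproj w ξ)) i • X i w ∈ horizontal g K w :=
      Submodule.sum_mem _ fun i _ => Submodule.smul_mem _ _ (hmem i)
    rw [horizontal_ext hK hKt hw2 hvw h hξ hsum ?_]
    · exact Submodule.sum_mem _ fun i _ => Submodule.smul_mem _ _
        (Submodule.subset_span (Set.mem_range_self i))
    · refine Function.LeftInverse.injective (g := ofModel v.proj w.proj) (ofModel_toModel hw1) ?_
      simp only [map_sum, map_smul, hd]
      exact (b.sum_repr _).symm

lemma isPrincipalConnection_of_isParallel (hK : ContMDiff 𝓘(ℝ, E) 𝓘(ℝ, E).tangent ∞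
      (fun p => (⟨p, K p⟩ : TangentBundle 𝓘(ℝ, E) M)))
    (hKt : ∀ p, g.val p (K p) (K p) < 0) (o : ManifoldOrientation E M)
    (hT : IsParallel g (unitField g K)) : IsPrincipalConnection g o K (horizontal g K) where
  disjoint v hv := by
    obtain ⟨w, u, h, -, hvw⟩ := exists_adapted_frame hKt o hv
    exact horizontal_inf_vertical hK hKt hvw h
  sup_eq v hv := by
    obtain ⟨w, u, h, -, hvw⟩ := exists_adapted_frame hKt o hv
    exact horizontal_sup_vertical hK hKt hvw h
  invariant z _ hv := map_horizontal_of_isParallel hK hKt o hT z hv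
  smooth := isSmoothDistribution_horizontal hK hKt o

end Smooth
end NullCongruence

theorem mainTheorem2 {E : Type*} [NormedAddCommGroup E] [NormedSpace ℝ E]
    (hdim : Module.finrank ℝ E = 3)
    {M : Type*} [TopologicalSpace M] [T2Space M] [SecondCountableTopology M] [ConnectedSpace M]
    [ChartedSpace E M] [IsManifold 𝓘(ℝ, E) ∞ M]
    (g : NullCongruence.LorentzianMetric E M) (o : NullCongruence.ManifoldOrientation E M)
    (K : ∀ p : M, TangentSpace 𝓘(ℝ, E) p)
    (hK : ContMDiff 𝓘(ℝ, E) 𝓘(ℝ, E).tangent ∞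
      (fun p => (⟨p, K p⟩ : TangentBundle 𝓘(ℝ, E) M)))
    (hKtime : ∀ p, g.val p (K p) (K p) < 0) :
    List.TFAE [
      NullCongruence.IsParallel g (NullCongruence.unitField g K),
      NullCongruence.IsPrincipalConnection g o K (NullCongruence.horizontal g K),
      NullCongruence.IsIsometricAction g o K] := by
  have : FiniteDimensional ℝ E := .of_finrank_pos (by rw [hdim]; norm_num)
  tfae_have 1 → 2 := NullCongruence.isPrincipalConnection_of_isParallel hK hKtime o
  tfae_have 2 → 1 := NullCongruence.isParallel_of_isPrincipalConnection hK hKtime o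
  tfae_have 1 → 3 := NullCongruence.isIsometricAction_of_isParallel hK hKtime o
  tfae_have 3 → 1 := NullCongruence.isParallel_of_isIsometricAction hK hKtime o
  tfae_finish
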